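/- **Setting.** Let $\varphi:\mathbb R\to[0,\infty)$ and $\psi:\mathbb R^2\to[0,\infty)$ be smooth, $\varphi$ supported in $[0,1]$, $\psi$ symmetric ($\psi(-y)=\psi(y)$) and supported in $\{|y|\le 1/2\}$, and put $R(s,y)=(\varphi\star\tilde\varphi)(s)\,(\psi\star\psi)(y)$, where $\tilde\varphi(s)=\varphi(-s)$. Let $\Omega_1$ be the space of continuous paths $x:[0,1]\to\mathbb R^2$ with $x(0)=0$, with its Borel $\sigma$-algebra, and let $W_1$ be the Wiener measure on $\Omega_1$. Fix $\hat\beta,a\in\mathbb R$ and put $\beta_\epsilon^2=\hat\beta^2/\log\frac1\epsilon$ for $\epsilon\in(0,1)$. Let $\hat{\mathbb P}_1^{(\epsilon)}$ be the probability measure on $\Omega_1$ with density proportional to $\exp\bigl(\tfrac{\beta_\epsilon^2}{2}\int_{[0,1]^2}R(s-u,x(s)-x(u))\,ds\,du\bigr)$ with respect to $W_1$, and let $$I^{(\epsilon)}(x,y)=\beta_\epsilon^2\int_{[0,1]^2}R(a+s-u,\;y(s)+x(1)-x(u))\,ds\,du,\qquad x,y\in\Omega_1 .$$ Let $\rho^{(\epsilon)}>0$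 and $\Psi^{(\epsilon)}:\Omega_1\to\mathbb R$, measurable and bounded above and below by positive constants, satisfy $\int\Psi^{(\epsilon)}\,d\hat{\mathbb P}_1^{(\epsilon)}=1$ and $\int e^{I^{(\epsilon)}(x,y)}\Psi^{(\epsilon)}(y)\,\hat{\mathbb P}_1^{(\epsilon)}(dy)=\rho^{(\epsilon)}\Psi^{(\epsilon)}(x)$ for all $x$. Put $$\hat\pi^{(\epsilon)}(x,dy)=\frac{e^{I^{(\epsilon)}(x,y)}\Psi^{(\epsilon)}(y)}{\rho^{(\epsilon)}\Psi^{(\epsilon)}(x)}\,\hat{\mathbb P}_1^{(\epsilon)}(dy),\qquad \hat{\boldsymbol\pi}^{(\epsilon)}=\hat\pi^{(\epsilon)}\times\hat\pi^{(\epsilon)} .$$ Fix $\gamma\in(0,1)$, and let $\epsilon_0\in(0,1]$ be such that the following coupling is defined for all $\epsilon<\epsilon_0$ (that is, $\hat{\boldsymbol\pi}^{(\epsilon)}\ge\gamma\,W_1\times W_1$; for each $\gamma$ this holds if $\epsilon_0$ is small). The pair $(X_0,Y_0)$ has law $W_1\times W_1$; at each step $j\ge1$, given the past, $\eta_j$ is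 Bernoulli with success probability $\gamma$; if $\eta_j=1$ then $(X_j,Y_j)$ is sampled from $W_1\times W_1$, and if $\eta_j=0$ from $\frac{\hat{\boldsymbol\pi}^{(\epsilon)}((X_{j-1},Y_{j-1}),\cdot)-\gamma W_1\times W_1}{1-\gamma}$. Let $T_0=0$ and $T_i=\inf\{j>T_{i-1}:\eta_j=1\}$, and let $\omega_{X_0},\omega_{Y_0}\in C([0,\infty),\mathbb R^2)$ be the paths obtained by gluing the segments $(X_j)_{j\ge0}$ and $(Y_j)_{j\ge0}$: $\omega_{X_0}(n+s)=\sum_{j<n}X_j(1)+X_n(s)$ for $n\in\{0,1,2,\dots\}$ and $s\in[0,1]$, and likewise for $\omega_{Y_0}$. **Admissible families.** For a finite index set $K$, call a family $(H_\epsilon)_{\epsilon\in(0,1)}$ of nonnegative, bounded, integrable functions on $(\mathbb R^2)^{K}$ admissible with constant $B$ if $\|H_\epsilon\|_1=B$ for all $\epsilon$ and $$\lim_{L\to\infty}\ \sup_{\epsilon\in(0,1)}\int_{|\mathbf x|\ge L}H_\epsilon(\mathbf x)\,d\mathbf x=0 .$$ For $G:(\mathbb R^2)^p\to[0,\infty)$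 and $J\subseteq\{1,\dots,p\}$ let $G^J((x_i)_{i\notin J})=\sup_{x_i\in\mathbb R^2,\,i\in J}G(x_1,\dots,x_p)$, so that $G^\emptyset=G$. **Lemma.** Let $(G_\epsilon)_{\epsilon\in(0,1)}$ be an admissible family on $(\mathbb R^2)^p$ with constant $A$, such that for every $J\subseteq\{1,\dots,p\}$ there is an admissible family $(\mathcal H_\epsilon)_{\epsilon\in(0,1)}$ on $(\mathbb R^2)^{\{1,\dots,p\}\setminus J}$ (with a constant that may depend on $J$) satisfying $G_\epsilon^J\le\mathcal H_\epsilon$ for all $\epsilon\in(0,1)$. Let $\boldsymbol\delta\in\{-1,0,1\}^p$, and let $M(\epsilon)>0$ satisfy $\log M(\epsilon)/\log\frac1\epsilon\to0$ as $\epsilon\to0$. Then, as $\epsilon\to0$, $$\Bigl(\frac{\gamma}{2\pi}\log\frac1\epsilon\Bigr)^{-p}\;\mathbb E\Bigl[\sum_{1\le k_1<\dots<k_p\le[M(\epsilon)/\epsilon^2]}G_\epsilon\bigl(\omega_{X_0}(T_{k_1+\delta_1})-\omega_{Y_0}(T_{k_1}),\dots,\omega_{X_0}(T_{k_p+\delta_p})-\omega_{Y_0}(T_{k_p})\bigr)\Bigr]\longrightarrow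 A .$$ In particular, if $A\neq0$, the expectation is asymptotic to $A\bigl(\frac{\gamma}{2\pi}\log\frac1\epsilon\bigr)^p$, in the sense that the ratio tends to $1$. -/

import Mathlib

open MeasureTheory ProbabilityTheory Filter Topology

noncomputable section

namespace KR

/-- The Euclidean plane. -/
abbrev Plane : Type := EuclideanSpace ℝ (Fin 2)

/-- The Borel sigma-algebra of the uniform topology on continuous maps `[0,1] → ℝ²`. -/
instance : MeasurableSpace C(unitInterval, Plane) := borel _

instance : BorelSpace C(unitInterval, Plane) := ⟨rfl⟩

/-- Continuous paths in the plane over `[0,1]` that start at the origin, with the uniform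
topology and its Borel sigma-algebra. -/
abbrev Path : Type := {x : C(unitInterval, Plane) // x 0 = 0}

/-- The value of a path at time `t ∈ [0,1]`. -/
def Path.at (x : Path) (t : unitInterval) : Plane := x.1 t

/-- `W` is the Wiener measure on paths over `[0,1]` started at `0`: the coordinate process has
independent increments, and the increment over `[s,t]` is centred Gaussian with covariance matrix
`(t - s) I`. A Borel measure on the path space is determined by these finite-dimensional laws. -/
structure IsWiener (W : Measure Path) : Prop where
  isProbabilityMeasure : IsProbabilityMeasure W
  indepIncrements : HasIndepIncrements (fun (t : unitInterval) (x : Path) => x.at t) W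
  gaussian : ∀ s t : unitInterval, s ≤ t →
    W.map (fun x => x.at t - x.at s) =
      multivariateGaussian 0 (((t : ℝ) - (s : ℝ)) • (1 : Matrix (Fin 2) (Fin 2) ℝ))

/-- The mollifiers: `φ` is smooth, nonnegative and supported in `[0,1]`, and `ψ` is smooth,
nonnegative, symmetric and supported in the closed ball of radius `1/2`. -/
structure IsMollifierPair (φ : ℝ → ℝ) (ψ : Plane → ℝ) : Prop where
  smooth_time : ContDiff ℝ (⊤ : ℕ∞) φ
  smooth_space : ContDiff ℝ (⊤ : ℕ∞) ψ
  nonneg_time : ∀ s, 0 ≤ φ s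
  nonneg_space : ∀ y, 0 ≤ ψ y
  support_time : Function.support φ ⊆ Set.Icc 0 1
  support_space : Function.support ψ ⊆ Metric.closedBall 0 (1 / 2)
  symm_space : ∀ y, ψ (-y) = ψ y

/-- The correlation function `R(s,y) = (φ ⋆ φ~)(s) (ψ ⋆ ψ)(y)`, where `φ~(s) = φ(-s)`. -/
def corr (φ : ℝ → ℝ) (ψ : Plane → ℝ) (s : ℝ) (y : Plane) : ℝ :=
  convolution φ (fun t => φ (-t)) (ContinuousLinearMap.mul ℝ ℝ) volume s *
    convolution ψ ψ (ContinuousLinearMap.mul ℝ ℝ) volume y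

/-- The squared coupling constant `β_ε² = β² / log (1/ε)`. -/
def couplingSq (β ε : ℝ) : ℝ := β ^ 2 / Real.log (1 / ε)

/-- The exponentially tilted Wiener measure over `[0,1]`: the probability measure with density
proportional to `exp ((β_ε²/2) ∫_{[0,1]²} R(s-u, x(s)-x(u)) ds du)` with respect to `W`. -/
def tiltedWiener (W : Measure Path) (R : ℝ → Plane → ℝ) (β ε : ℝ) : Measure Path :=
  W.tilted fun x => couplingSq β ε / 2 *
    ∫ q : unitInterval × unitInterval, R ((q.1 : ℝ) - (q.2 : ℝ)) (x.at q.1 - x.at q.2)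

/-- The interaction of a segment `x` with the following segment `y`,
`β_ε² ∫_{[0,1]²} R(a + s - u, y(s) + x(1) - x(u)) ds du`. -/
def interaction (R : ℝ → Plane → ℝ) (a β ε : ℝ) (x y : Path) : ℝ :=
  couplingSq β ε *
    ∫ q : unitInterval × unitInterval,
      R (a + (q.1 : ℝ) - (q.2 : ℝ)) (y.at q.1 + x.at 1 - x.at q.2)

/-- `(r, Ψ)` is the principal eigenpair of the positive operator with kernel `exp (interaction)`
with respect to `μ`: `r > 0`, `Ψ` is bounded between positive constants, has total mass `1` with
respect to `μ`, and `∫ exp (I(x,y)) Ψ(y) μ(dy) = r Ψ(x)` for every `x`. -/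
structure IsPrincipalEigenpair (μ : Measure Path) (I : Path → Path → ℝ) (r : ℝ) (Ψ : Path → ℝ) :
    Prop where
  pos : 0 < r
  measurable : Measurable Ψ
  bounds : ∃ c C : ℝ, 0 < c ∧ ∀ x, c ≤ Ψ x ∧ Ψ x ≤ C
  normalized : ∫ x, Ψ x ∂μ = 1
  eigen : ∀ x, ∫ y, Real.exp (I x y) * Ψ y ∂μ = r * Ψ x

/-- The transition probability `exp (I(x,y)) Ψ(y) μ(dy) / (r Ψ(x))`. -/
def transition (μ : Measure Path) (I : Path → Path → ℝ) (r : ℝ) (Ψ : Path → ℝ) (x : Path) :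
    Measure Path :=
  μ.withDensity fun y => ENNReal.ofReal (Real.exp (I x y) * Ψ y / (r * Ψ x))

/-- The transition probability of two independent copies of the chain. -/
def pairTransition (μ : Measure Path) (I : Path → Path → ℝ) (r : ℝ) (Ψ : Path → ℝ)
    (z : Path × Path) : Measure (Path × Path) :=
  (transition μ I r Ψ z.1).prod (transition μ I r Ψ z.2)

/-- The residual transition probability `(κ(z,·) - γ ν) / (1 - γ)`. -/
def residual (κ : Path × Path → Measure (Path × Path)) (ν : Measure (Path × Path)) (γ : ℝ)
    (z : Path × Path) : Measure (Path × Path) :=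
  (ENNReal.ofReal (1 - γ))⁻¹ • (κ z - ENNReal.ofReal γ • ν)

/-- The history up to step `n`: the states `Z 0, …, Z n` and the coin tosses `η 1, …, η n`. -/
def history {Ω : Type*} (Z : ℕ → Ω → Path × Path) (η : ℕ → Ω → Bool) (n : ℕ) (ω : Ω) :
    (Fin (n + 1) → Path × Path) × (Fin n → Bool) :=
  (fun i => Z i ω, fun i => η (i + 1) ω)

/-- The regenerative coupling of the chain with transition probability `κ` to Bernoulli variables.
The initial state has law `ν`. At each step `n + 1`, given the history, the coin `η (n + 1)` is a
success with probability `γ`; in case of success the next state is a fresh sample of `ν`, and in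
case of failure it is a sample of the residual transition probability from `Z n`. -/
structure IsRegenerativeCoupling {Ω : Type*} [MeasurableSpace Ω] (P : Measure Ω)
    (κ : Path × Path → Measure (Path × Path)) (ν : Measure (Path × Path)) (γ : ℝ)
    (Z : ℕ → Ω → Path × Path) (η : ℕ → Ω → Bool) : Prop where
  measurable_state : ∀ n, Measurable (Z n)
  measurable_coin : ∀ n, Measurable (η n)
  initial : P.map (Z 0) = ν
  success : ∀ (n : ℕ) (A : Set ((Fin (n + 1) → Path × Path) × (Fin n → Bool)))
    (B : Set (Path × Path)), MeasurableSet A → MeasurableSet B →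
      P {ω | history Z η n ω ∈ A ∧ η (n + 1) ω = true ∧ Z (n + 1) ω ∈ B} =
        ENNReal.ofReal γ * P {ω | history Z η n ω ∈ A} * ν B
  failure : ∀ (n : ℕ) (A : Set ((Fin (n + 1) → Path × Path) × (Fin n → Bool)))
    (B : Set (Path × Path)), MeasurableSet A → MeasurableSet B →
      P {ω | history Z η n ω ∈ A ∧ η (n + 1) ω = false ∧ Z (n + 1) ω ∈ B} =
        ENNReal.ofReal (1 - γ) *
          ∫⁻ ω in {ω | history Z η n ω ∈ A}, residual κ ν γ (Z n ω) B ∂P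

/-- The regeneration times of a sequence of coin tosses: `T 0 = 0` and `T (i+1)` is the first
`j > T i` at which `η` is a success (almost surely there is one). -/
def regTime (η : ℕ → Bool) : ℕ → ℕ
  | 0 => 0
  | i + 1 => sInf {j | regTime η i < j ∧ η j = true}

/-- The path over `[0,∞)` obtained by gluing unit-time segments: on `[n, n+1]` it is the value at
time `n` plus the `n`-th segment. -/
def gluedPath (x : ℕ → Path) (t : ℝ) : Plane :=
  ∑ n ∈ Finset.range ⌊t⌋₊, (x n).at 1 +
    (x ⌊t⌋₊).at ⟨Int.fract t, Int.fract_nonneg t, (Int.fract_lt_one t).le⟩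

/-- The vector `ω_X(T_{j+d}) - ω_Y(T_j)` for the two glued paths. -/
def increment (z : ℕ → Path × Path) (η : ℕ → Bool) (j : ℕ) (d : ℤ) : Plane :=
  gluedPath (fun n => (z n).1) (regTime η ((j : ℤ) + d).toNat : ℝ) -
    gluedPath (fun n => (z n).2) (regTime η j : ℝ)

/-- The index tuples `1 ≤ k_1 < … < k_p ≤ N`. -/
def increasingTuples (p N : ℕ) : Finset (Fin p → ℕ) := by
  classical
  exact (Fintype.piFinset fun _ : Fin p => Finset.Icc 1 N).filter StrictMono

/-- The sum of `g(ω_X(T_{k_1+δ_1}) - ω_Y(T_{k_1}), …, ω_X(T_{k_p+δ_p}) - ω_Y(T_{k_p}))` over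
`1 ≤ k_1 < … < k_p ≤ N`. -/
def nonDirectedSum {p : ℕ} (g : (Fin p → Plane) → ℝ) (δ : Fin p → ℤ) (N : ℕ)
    (z : ℕ → Path × Path) (η : ℕ → Bool) : ℝ :=
  ∑ k ∈ increasingTuples p N, g fun i => increment z η (k i) (δ i)

/-- A family `(H_ε)`, `0 < ε < 1`, of nonnegative bounded integrable functions on `(ℝ²)^ι` with
`L¹`-norm equal to the constant `A` and with tails that are small uniformly in `ε`. The tails are
measured in the Euclidean norm of `(ℝ²)^ι`. -/
structure IsAdmissible {ι : Type} [Fintype ι] (H : ℝ → (ι → Plane) → ℝ) (A : ℝ) : Prop where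
  measurable : ∀ ε ∈ Set.Ioo (0 : ℝ) 1, Measurable (H ε)
  integrable : ∀ ε ∈ Set.Ioo (0 : ℝ) 1, Integrable (H ε)
  nonneg : ∀ ε ∈ Set.Ioo (0 : ℝ) 1, ∀ x, 0 ≤ H ε x
  bounded : ∀ ε ∈ Set.Ioo (0 : ℝ) 1, ∃ C : ℝ, ∀ x, H ε x ≤ C
  norm_eq : ∀ ε ∈ Set.Ioo (0 : ℝ) 1, ∫ x, ‖H ε x‖ = A
  tail : Tendsto
    (fun L : ℝ => ⨆ ε : Set.Ioo (0 : ℝ) 1, ∫ x in {x | L ≤ √(∑ i, ‖x i‖ ^ 2)}, H ε x)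
    atTop (𝓝 0)

/-- The partial supremum `g^J` of `g` over the coordinates in `J`, as a function of the remaining
coordinates. -/
def partialSup {p : ℕ} (g : (Fin p → Plane) → ℝ) (J : Finset (Fin p))
    (x : {i : Fin p // i ∉ J} → Plane) : ℝ :=
  ⨆ y : {i : Fin p // i ∈ J} → Plane, g fun i => if h : i ∈ J then y ⟨i, h⟩ else x ⟨i, h⟩

end KR

end

/-! The successes of the coins cut the pair of glued paths into blocks. Each success restarts the
pair from `W.prod W`, so the block displacements are iid
(`IsRegenerativeCoupling.iIndepFun_regBlock`, `IsRegenerativeCoupling.map_regBlock`). The difference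
of the two paths at a regeneration time is therefore a planar random walk with iid steps, and a
shift by δ changes it only by a displacement from one block next to that time.

As ε → 0 the coupling constant vanishes, and the density of the failure part of the transition
probability converges uniformly to 1 - γ (`exists_failDensity`). The step law thus approaches a
geometric mixture, of mean length 1/γ, of convolution powers of the Gaussian law with characteristic
function exp(-|ξ|²). Near the origin its characteristic function is exp(-|ξ|²/γ), up to factors 1 ±
τ in the exponent (`IsWiener.isStepLaw`). A local limit estimate then gives n steps a density of
about γ/(4πn) on bounded sets. Summing over n ≤ N = [M(ε)/ε²] yields (γ/4π) log N, which is
asymptotic to (γ/2π) log(1/ε) because log N is asymptotic to 2 log(1/ε). An increasing tuple is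
described by its p gaps. Each gap contributes one such factor and one integration over the plane,
whence A times the p-th power. The constraint that the gaps add up to at most N costs at most the
replacement of N by N/(p+1), which a logarithm does not see.

Two points need care. The step law need not have a density: it is γ times a Gaussian plus a
remainder Q. In its n-th convolution power, the terms with a Gaussian factor have a density that
Fourier inversion controls. The term Q^{*n} has mass (1-γ)^n and can only be paired with the
supremum over the coordinate in question. Its sum over n converges, so every coordinate treated this
way loses a logarithm; this is what the majorants of the partial suprema are for. Secondly, the
lower local limit bound holds on bounded sets only. There G is cut off to a bounded set, and the
blocks next to the tuple are required to be small, at the cost of factors close to 1.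

The resulting bounds are `tupleExpectation_le` and `le_tupleExpectation`; `tendsto_tupleExpectation`
lets the auxiliary parameters tend to 0. -/

noncomputable section

/-! ### Convolution powers with a Gaussian component, and Fourier inversion for Gaussian
convolutions. -/

namespace KR

open scoped ENNReal

/-- The `n`-fold convolution power of a measure. -/
def convPow {E : Type*} [AddMonoid E] [MeasurableSpace E] (μ : Measure E) : ℕ → Measure E
  | 0 => Measure.dirac 0
  | n + 1 => μ ∗ convPow μ n

/-- In the expansion of `(G + Q)^{*n}`, the terms containing `G` are `G * gaussCofactor (G + Q) Q n`,
grouped by the position of the first factor `G`. -/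
def gaussCofactor (μ Q : Measure Plane) : ℕ → Measure Plane
  | 0 => 0
  | n + 1 => convPow Q n + μ ∗ gaussCofactor μ Q n

instance isFiniteMeasure_convPow {E : Type*} [AddMonoid E] [MeasurableSpace E] [MeasurableAdd₂ E]
    (μ : Measure E) [IsFiniteMeasure μ] (n : ℕ) :
    IsFiniteMeasure (convPow μ n) := by
  induction n with
  | zero => unfold convPow; infer_instance
  | succ n ih => unfold convPow; infer_instance

instance isProbabilityMeasure_convPow {E : Type*} [AddMonoid E] [MeasurableSpace E] [MeasurableAdd₂ E]
    (μ : Measure E) [IsProbabilityMeasure μ] (n : ℕ) :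
    IsProbabilityMeasure (convPow μ n) := by
  induction n with
  | zero => unfold convPow; infer_instance
  | succ n ih => unfold convPow; infer_instance

instance isFiniteMeasure_gaussCofactor (μ Q : Measure Plane) [IsFiniteMeasure μ]
    [IsFiniteMeasure Q] (n : ℕ) : IsFiniteMeasure (gaussCofactor μ Q n) := by
  induction n with
  | zero => unfold gaussCofactor; infer_instance
  | succ n ih => unfold gaussCofactor; infer_instance

lemma charFun_convPow (μ : Measure Plane) [IsFiniteMeasure μ] (n : ℕ) (ξ : Plane) :
    charFun (convPow μ n) ξ = charFun μ ξ ^ n := by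
  induction n with
  | zero => simp [convPow]
  | succ n ih => rw [convPow, charFun_conv, ih, pow_succ']

lemma charFun_add_measure (μ ν : Measure Plane) [IsFiniteMeasure μ] [IsFiniteMeasure ν]
    (ξ : Plane) : charFun (μ + ν) ξ = charFun μ ξ + charFun ν ξ := by
  have h : ∀ (κ : Measure Plane) [IsFiniteMeasure κ],
      Integrable (fun x : Plane => Complex.exp (inner ℝ x ξ * Complex.I)) κ := by
    intro κ _
    refine Integrable.of_bound (C := 1) (by fun_prop) (ae_of_all _ fun x => ?_)
    rw [Complex.norm_exp_ofReal_mul_I]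
  rw [charFun_apply, charFun_apply, charFun_apply, integral_add_measure (h μ) (h ν)]

/-- This is f^n - q^n = (f - q) Σ f^i q^j with i + j = n - 1, kept in multiplied form so that no
division by f - q is needed. -/
lemma charFun_gaussCofactor {μ Q : Measure Plane} [IsFiniteMeasure μ] [IsFiniteMeasure Q]
    (n : ℕ) (ξ : Plane) :
    (charFun μ ξ - charFun Q ξ) * charFun (gaussCofactor μ Q n) ξ
      = charFun μ ξ ^ n - charFun Q ξ ^ n := by
  induction n with
  | zero => simp [gaussCofactor]
  | succ n ih =>
    rw [gaussCofactor, charFun_add_measure, charFun_conv, charFun_convPow]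
    have : (charFun μ ξ - charFun Q ξ) * (charFun Q ξ ^ n + charFun μ ξ *
        charFun (gaussCofactor μ Q n) ξ) = (charFun μ ξ - charFun Q ξ) * charFun Q ξ ^ n
        + charFun μ ξ * ((charFun μ ξ - charFun Q ξ) * charFun (gaussCofactor μ Q n) ξ) := by ring
    rw [this, ih]; ring

/-- The first summand is a convolution with G, hence absolutely continuous when G is a multiple of a
Gaussian law. The second has geometrically small mass. -/
lemma convPow_eq_add {μ G Q : Measure Plane} [IsFiniteMeasure μ] [IsFiniteMeasure G]
    [IsFiniteMeasure Q] (h : μ = G + Q) (n : ℕ) :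
    convPow μ n = G ∗ gaussCofactor μ Q n + convPow Q n := by
  induction n with
  | zero => simp [convPow, gaussCofactor]
  | succ n ih =>
    have e1 : convPow μ (n + 1) = μ ∗ (G ∗ gaussCofactor μ Q n) + μ ∗ convPow Q n := by
      rw [convPow, ih, Measure.conv_add]
    have e2 : μ ∗ convPow Q n = G ∗ convPow Q n + Q ∗ convPow Q n := by
      conv_lhs => rw [h]
      rw [Measure.add_conv]
    have e3 : μ ∗ (G ∗ gaussCofactor μ Q n) = G ∗ (μ ∗ gaussCofactor μ Q n) := by
      rw [← Measure.conv_assoc, Measure.conv_comm μ G, Measure.conv_assoc]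
    rw [e1, e2, e3, gaussCofactor, Measure.conv_add, convPow]
    abel

lemma convPow_univ {Q : Measure Plane} [IsFiniteMeasure Q] (n : ℕ) :
    convPow Q n Set.univ = Q Set.univ ^ n := by
  induction n with
  | zero => simp [convPow]
  | succ n ih =>
    rw [convPow, Measure.conv, Measure.map_apply measurable_add MeasurableSet.univ,
      Set.preimage_univ, Measure.prod_apply MeasurableSet.univ]
    simp [ih, pow_succ, mul_comm]

/-- The density of the centred Gaussian law with covariance `2 I` on the plane. -/
def gaussDensity (x : Plane) : ℝ := (4 * Real.pi)⁻¹ * Real.exp (-(1 / 4) * ‖x‖ ^ 2)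

lemma gaussDensity_nonneg (x : Plane) : 0 ≤ gaussDensity x := by
  unfold gaussDensity; positivity

lemma measurable_gaussDensity : Measurable gaussDensity := by
  unfold gaussDensity; fun_prop

lemma gaussDensity_le (x : Plane) : gaussDensity x ≤ (4 * Real.pi)⁻¹ := by
  unfold gaussDensity
  have : Real.exp (-(1 / 4) * ‖x‖ ^ 2) ≤ 1 := Real.exp_le_one_iff.2 (by nlinarith [sq_nonneg ‖x‖])
  have h2 : 0 ≤ (4 * Real.pi)⁻¹ := by positivity
  nlinarith

lemma integral_exp_neg_mul_normSq {b : ℝ} (hb : 0 < b) :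
    ∫ ξ : Plane, Real.exp (-b * ‖ξ‖ ^ 2) = Real.pi / b := by
  rw [GaussianFourier.integral_rexp_neg_mul_sq_norm hb]; simp

lemma integrable_exp_neg_mul_normSq {b : ℝ} (hb : 0 < b) :
    Integrable fun ξ : Plane => Real.exp (-b * ‖ξ‖ ^ 2) := by
  by_contra h
  have := integral_exp_neg_mul_normSq hb
  rw [integral_undef h] at this
  have : 0 < Real.pi / b := by positivity
  linarith

/-- Inversion is made explicit for the Gaussian alone. Fubini transfers it to every convolution with
a Gaussian, so no general inversion theorem is used. -/
lemma gaussDensity_eq_fourier (x : Plane) :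
    (gaussDensity x : ℂ) = ((4 * Real.pi ^ 2)⁻¹ : ℝ) *
      ∫ ξ : Plane, Complex.exp (-(‖ξ‖ : ℂ) ^ 2) * Complex.exp (inner ℝ x ξ * Complex.I) := by
  have h := GaussianFourier.integral_cexp_neg_mul_sq_norm_add (V := Plane) (b := 1) (by simp)
    Complex.I x
  have e : ∀ ξ : Plane, Complex.exp (-(‖ξ‖ : ℂ) ^ 2) * Complex.exp (inner ℝ x ξ * Complex.I)
      = Complex.exp (-1 * (‖ξ‖ : ℂ) ^ 2 + Complex.I * (inner ℝ x ξ : ℝ)) := by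
    intro ξ; rw [← Complex.exp_add]; congr 1; ring
  simp_rw [e]
  rw [h]
  have hpi : (Real.pi : ℂ) ≠ 0 := by exact_mod_cast Real.pi_ne_zero
  simp only [gaussDensity, finrank_euclideanSpace, Fintype.card_fin]
  push_cast
  rw [div_self (two_ne_zero), Complex.cpow_one, Complex.I_sq]
  have : (-1 * (‖x‖ : ℂ) ^ 2 / (4 * 1)) = -(1 / 4) * (‖x‖ : ℂ) ^ 2 := by ring
  rw [this]
  field_simp

lemma eq_withDensity_gaussDensity {N : Measure Plane} [IsProbabilityMeasure N]
    (hN : ∀ ξ, charFun N ξ = Real.exp (-‖ξ‖ ^ 2)) :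
    N = volume.withDensity fun x => ENNReal.ofReal (gaussDensity x) := by
  have hint : Integrable gaussDensity := by
    unfold gaussDensity
    exact (integrable_exp_neg_mul_normSq (by norm_num)).const_mul _
  have : IsFiniteMeasure (volume.withDensity fun x => ENNReal.ofReal (gaussDensity x)) :=
    isFiniteMeasure_withDensity_ofReal hint.2
  refine Measure.ext_of_charFun ?_
  ext ξ
  rw [hN, charFun_apply, integral_withDensity_eq_integral_toReal_smul
    (measurable_gaussDensity.ennreal_ofReal) (ae_of_all _ fun _ => ENNReal.ofReal_lt_top)]
  have h := GaussianFourier.integral_cexp_neg_mul_sq_norm_add (V := Plane) (b := 1 / 4)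
    (by norm_num) Complex.I ξ
  have e : ∀ x : Plane, (ENNReal.ofReal (gaussDensity x)).toReal •
      Complex.exp (inner ℝ x ξ * Complex.I) = (4 * Real.pi : ℂ)⁻¹ *
        Complex.exp (-(1 / 4) * (‖x‖ : ℂ) ^ 2 + Complex.I * (inner ℝ ξ x : ℝ)) := by
    intro x
    rw [ENNReal.toReal_ofReal (gaussDensity_nonneg x), Complex.exp_add, gaussDensity,
      Complex.real_smul, real_inner_comm]
    push_cast
    rw [mul_comm (Complex.I)]
    ring
  simp_rw [e]
  rw [integral_const_mul, h]
  have hpi : (Real.pi : ℂ) ≠ 0 := by exact_mod_cast Real.pi_ne_zero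
  simp only [finrank_euclideanSpace, Fintype.card_fin]
  push_cast
  rw [div_self (two_ne_zero), Complex.cpow_one, Complex.I_sq]
  have : (-1 * (‖ξ‖ : ℂ) ^ 2 / (4 * (1 / 4))) = -(‖ξ‖ : ℂ) ^ 2 := by ring
  rw [this]
  field_simp

/-- The hypothesis on the characteristic function forces N to have the density `gaussDensity`; the
rest is translation invariance and Tonelli. -/
lemma lintegral_conv_gaussian {N ρ : Measure Plane} [IsProbabilityMeasure N] [IsFiniteMeasure ρ]
    (hN : ∀ ξ, charFun N ξ = Real.exp (-‖ξ‖ ^ 2)) {F : Plane → ℝ≥0∞} (hF : Measurable F) :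
    ∫⁻ x, F x ∂(N ∗ ρ) = ∫⁻ x, F x * ENNReal.ofReal (∫ y, gaussDensity (x - y) ∂ρ) := by
  have hm : Measurable fun q : Plane × Plane => ENNReal.ofReal (gaussDensity (q.1 - q.2)) :=
    (measurable_gaussDensity.comp (by fun_prop)).ennreal_ofReal
  rw [Measure.conv_comm, Measure.lintegral_conv hF]
  have h1 : ∀ y : Plane, ∫⁻ x, F (y + x) ∂N
      = ∫⁻ x, ENNReal.ofReal (gaussDensity (x - y)) * F x := by
    intro y
    rw [eq_withDensity_gaussDensity hN, lintegral_withDensity_eq_lintegral_mul _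
      measurable_gaussDensity.ennreal_ofReal (by fun_prop)]
    have := lintegral_add_left_eq_self (μ := (volume : Measure Plane))
      (fun x => ENNReal.ofReal (gaussDensity (x - y)) * F x) y
    rw [← this]
    simp
  simp_rw [h1]
  rw [lintegral_lintegral_swap (by
    exact ((hm.comp (measurable_swap)).mul (hF.comp measurable_snd)).aemeasurable)]
  refine lintegral_congr fun x => ?_
  have hm' : Measurable fun y => gaussDensity (x - y) :=
    measurable_gaussDensity.comp (measurable_const.sub measurable_id)
  have hi : Integrable (fun y => gaussDensity (x - y)) ρ := by
    refine (integrable_const (4 * Real.pi)⁻¹).mono' hm'.aestronglyMeasurable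
      (ae_of_all _ fun y => ?_)
    rw [Real.norm_of_nonneg (gaussDensity_nonneg _)]
    exact gaussDensity_le _
  rw [lintegral_mul_const _ hm'.ennreal_ofReal, mul_comm,
    ofReal_integral_eq_lintegral_ofReal hi (ae_of_all _ fun y => gaussDensity_nonneg _)]

lemma integral_gaussDensity_sub (ρ : Measure Plane) [IsFiniteMeasure ρ] (x : Plane) :
    ((∫ y, gaussDensity (x - y) ∂ρ : ℝ) : ℂ) = ((4 * Real.pi ^ 2)⁻¹ : ℝ) *
      ∫ ξ : Plane, Complex.exp (-(inner ℝ x ξ) * Complex.I) *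
        (Complex.exp (-(‖ξ‖ : ℂ) ^ 2) * charFun ρ ξ) := by
  have h1 : ∀ y : Plane, (gaussDensity (x - y) : ℂ) = ((4 * Real.pi ^ 2)⁻¹ : ℝ) *
      ∫ ξ : Plane, Complex.exp (-(inner ℝ x ξ) * Complex.I) * (Complex.exp (-(‖ξ‖ : ℂ) ^ 2) *
        Complex.exp (inner ℝ y ξ * Complex.I)) := by
    intro y
    have : gaussDensity (x - y) = gaussDensity (y - x) := by
      unfold gaussDensity; rw [norm_sub_rev]
    rw [this, gaussDensity_eq_fourier]
    congr 1
    refine integral_congr_ae (ae_of_all _ fun ξ => ?_)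
    simp only
    rw [inner_sub_left, ← Complex.exp_add, ← Complex.exp_add, ← Complex.exp_add]
    congr 1
    push_cast; ring
  have h2 : ((∫ y, gaussDensity (x - y) ∂ρ : ℝ) : ℂ) = ∫ y, (gaussDensity (x - y) : ℂ) ∂ρ :=
    integral_ofReal.symm
  rw [h2]
  simp_rw [h1]
  rw [integral_const_mul, integral_integral_swap]
  · congr 1
    refine integral_congr_ae (ae_of_all _ fun ξ => ?_)
    simp only
    rw [integral_const_mul, integral_const_mul, charFun_apply]
  · have : Integrable (fun p : Plane × Plane => (1 : ℝ) * Real.exp (-1 * ‖p.2‖ ^ 2))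
        (ρ.prod volume) :=
      (integrable_const (1 : ℝ)).mul_prod (integrable_exp_neg_mul_normSq one_pos)
    refine this.mono' (by fun_prop) (ae_of_all _ fun p => ?_)
    simp only [Function.uncurry, norm_mul]
    rw [Complex.norm_exp_ofReal_mul_I]
    have e1 : ‖Complex.exp (-(inner ℝ x p.2 : ℝ) * Complex.I)‖ = 1 := by
      have := Complex.norm_exp_ofReal_mul_I (-(inner ℝ x p.2 : ℝ))
      push_cast at this; exact this
    have e2 : ‖Complex.exp (-(‖p.2‖ : ℂ) ^ 2)‖ = Real.exp (-1 * ‖p.2‖ ^ 2) := by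
      rw [Complex.norm_exp]; congr 1
      have : (-(‖p.2‖ : ℂ) ^ 2) = ((-1 * ‖p.2‖ ^ 2 : ℝ) : ℂ) := by push_cast; ring
      rw [this, Complex.ofReal_re]
    rw [e1, e2]; simp

end KR

end


/-! ### Local limit bounds for convolution powers of a step law. -/

noncomputable section

namespace KR

open scoped ENNReal

/-- A step law of the difference walk: it has a real characteristic function `f`, contains `γ` times
the Gaussian law with covariance `2 I`, and `exp (-(1+τ)|ξ|²/γ) ≤ f(ξ) ≤ exp (-(1-τ)|ξ|²/γ)` for
`|ξ|² ≤ s₀`. -/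
structure IsStepLaw (γ τ s₀ : ℝ) (μ : Measure Plane) : Prop where
  isProbabilityMeasure : IsProbabilityMeasure μ
  minorized : ∃ N : Measure Plane, IsProbabilityMeasure N ∧
    (∀ ξ, charFun N ξ = Real.exp (-‖ξ‖ ^ 2)) ∧ ENNReal.ofReal γ • N ≤ μ
  im_charFun : ∀ ξ, (charFun μ ξ).im = 0
  upper : ∀ ξ, ‖ξ‖ ^ 2 ≤ s₀ → (charFun μ ξ).re ≤ Real.exp (-((1 - τ) / γ) * ‖ξ‖ ^ 2)
  lower : ∀ ξ, ‖ξ‖ ^ 2 ≤ s₀ → Real.exp (-((1 + τ) / γ) * ‖ξ‖ ^ 2) ≤ (charFun μ ξ).re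

/-- The coefficient of the exponentially small error in the local limit bounds. -/
def tailCoeff (γ s₀ : ℝ) (n : ℕ) : ℝ :=
  -- The first summand bounds the power of the remainder where |ξ|² ≤ s₀, the second the difference
  -- of the powers where |ξ|² > s₀. Both are coefficients of exp(-|ξ|²).
  (1 - γ) ^ n * Real.exp s₀ + n * (1 - γ + γ * Real.exp (-s₀)) ^ (n - 1)

/-- The error term in the local limit bounds. -/
def lltError (γ τ s₀ R : ℝ) (n : ℕ) : ℝ :=
  -- Three sources of error, each integrated over ξ: replacing the cosine by 1 when |x| ≤ R, of
  -- order n⁻²; the part bounded by `tailCoeff`; and the part of the comparison Gaussian with |ξ|² >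
  -- s₀.
  (R ^ 2 / 2 * (2 / ((1 - τ) / γ * n)) * (2 * Real.pi / ((1 - τ) / γ * n))
    + tailCoeff γ s₀ n * Real.pi
    + Real.exp (-((1 + τ) / γ * s₀)) ^ (n - 1) * (Real.pi / ((1 + τ) / γ))) / (4 * Real.pi ^ 2)

section scalar

variable {γ s₀ b c f q s : ℝ} {n : ℕ}

lemma tailCoeff_nonneg (hγ : γ ∈ Set.Ioo (0 : ℝ) 1) : 0 ≤ tailCoeff γ s₀ n := by
  have h1 : 0 < 1 - γ := by linarith [hγ.2]
  have h2 : 0 < γ := hγ.1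
  unfold tailCoeff; positivity

/-- Here f and q stand for the characteristic functions of the step law and of its remainder, and s
for |ξ|². Although f^n need not decay at infinity, f^n - q^n contains the factor f - q = γ exp(-s),
and beyond s₀ both bases are at most 1 - γ + γ exp(-s₀). -/
lemma abs_pow_sub_pow_le_of_lt (hγ : γ ∈ Set.Ioo (0 : ℝ) 1) (h : s₀ < s)
    (hf : f = γ * Real.exp (-s) + q) (hq : |q| ≤ 1 - γ) :
    |f ^ n - q ^ n| ≤ tailCoeff γ s₀ n * Real.exp (-s) := by
  obtain ⟨h0, h1⟩ := hγ
  have h2 : 0 < 1 - γ := by linarith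
  have hs : Real.exp (-s) ≤ Real.exp (-s₀) := Real.exp_le_exp.2 (by linarith)
  have hq2 : |q| ≤ 1 - γ + γ * Real.exp (-s₀) := by
    have : 0 < γ * Real.exp (-s₀) := by positivity
    linarith
  have hf2 : |f| ≤ 1 - γ + γ * Real.exp (-s₀) := by
    rw [hf]
    refine (abs_add_le _ _).trans ?_
    rw [abs_of_nonneg (by positivity : 0 ≤ γ * Real.exp (-s))]
    nlinarith
  have e := abs_pow_sub_pow_le f q n
  have e1 : |f - q| = γ * Real.exp (-s) := by
    rw [hf, add_sub_cancel_right, abs_of_nonneg (by positivity)]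
  have e2 : max |f| |q| ^ (n - 1) ≤ (1 - γ + γ * Real.exp (-s₀)) ^ (n - 1) :=
    pow_le_pow_left₀ (le_max_of_le_left (abs_nonneg _)) (max_le hf2 hq2) _
  rw [e1] at e
  have e3 : γ * Real.exp (-s) * n * max |f| |q| ^ (n - 1)
      ≤ 1 * Real.exp (-s) * n * (1 - γ + γ * Real.exp (-s₀)) ^ (n - 1) := by
    gcongr
  have e5 : 0 ≤ (1 - γ) ^ n * Real.exp s₀ * Real.exp (-s) := by positivity
  unfold tailCoeff
  nlinarith

/-- Below s₀ the Gaussian bound on f applies and q^n is at most (1-γ)^n; the factor exp(s₀ - s) ≥ 1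
brings the latter into the integrable form used beyond s₀. -/
lemma abs_pow_sub_pow_le_gaussian (hγ : γ ∈ Set.Ioo (0 : ℝ) 1) (hn : 1 ≤ n)
    (hf : f = γ * Real.exp (-s) + q) (hq : |q| ≤ 1 - γ)
    (hup : s ≤ s₀ → f ≤ Real.exp (-b * s)) (hf0 : s ≤ s₀ → 0 ≤ f) :
    |f ^ n - q ^ n| ≤ Real.exp (-(b * n) * s) + tailCoeff γ s₀ n * Real.exp (-s) := by
  obtain ⟨h0, h1⟩ := hγ
  have h2 : 0 < 1 - γ := by linarith
  rcases le_or_gt s s₀ with h | h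
  · have e1 : |f ^ n| ≤ Real.exp (-(b * n) * s) := by
      rw [abs_of_nonneg (pow_nonneg (hf0 h) _)]
      calc f ^ n ≤ Real.exp (-b * s) ^ n := pow_le_pow_left₀ (hf0 h) (hup h) _
        _ = _ := by rw [← Real.exp_nat_mul]; congr 1; ring
    have e2 : |q ^ n| ≤ (1 - γ) ^ n := by
      rw [abs_pow]; exact pow_le_pow_left₀ (abs_nonneg _) hq _
    have e3 : (1 - γ) ^ n ≤ tailCoeff γ s₀ n * Real.exp (-s) := by
      unfold tailCoeff
      have : 1 ≤ Real.exp s₀ * Real.exp (-s) := by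
        rw [← Real.exp_add]; exact Real.one_le_exp (by linarith)
      have h3 : 0 ≤ n * (1 - γ + γ * Real.exp (-s₀)) ^ (n - 1) * Real.exp (-s) := by positivity
      have h4 : 0 < (1 - γ) ^ n := by positivity
      nlinarith
    have := abs_sub (f ^ n) (q ^ n)
    linarith
  · have e4 : 0 ≤ Real.exp (-(b * n) * s) := (Real.exp_pos _).le
    linarith [abs_pow_sub_pow_le_of_lt (n := n) ⟨h0, h1⟩ h hf hq]

/-- The pointwise bound behind the lower local limit estimate; c stands for cos⟨x,ξ⟩. The three
subtracted terms pay for c < 1, for q^n together with the region beyond s₀, and for extending the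
Gaussian exp(-b'ns) to all s. -/
lemma gaussian_le_mul_pow_sub_pow {b' κ : ℝ} (hγ : γ ∈ Set.Ioo (0 : ℝ) 1) (hn : 1 ≤ n)
    (hs : 0 ≤ s) (hb : 0 < b) (hb' : 0 < b') (hκ : 0 ≤ κ)
    (hf : f = γ * Real.exp (-s) + q) (hq : |q| ≤ 1 - γ)
    (hup : s ≤ s₀ → f ≤ Real.exp (-b * s)) (hlow : s ≤ s₀ → Real.exp (-b' * s) ≤ f)
    (hc : |c| ≤ 1) (hcs : 1 - c ≤ κ * s) :
    Real.exp (-(b' * n) * s) - κ * (2 / (b * n)) * Real.exp (-(b * n / 2) * s)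
        - tailCoeff γ s₀ n * Real.exp (-s) - Real.exp (-(b' * s₀)) ^ (n - 1) * Real.exp (-b' * s)
      ≤ c * (f ^ n - q ^ n) := by
  have hf0 : s ≤ s₀ → 0 ≤ f := fun h => (Real.exp_pos _).le.trans (hlow h)
  have habs := abs_pow_sub_pow_le_gaussian hγ hn hf hq hup hf0
  obtain ⟨h0, h1⟩ := hγ
  have h2 : 0 < 1 - γ := by linarith
  have hn0 : (0 : ℝ) < n := by exact_mod_cast hn
  -- Half of the exponent absorbs the factor s, by u ≤ exp u with u = bns/2. This produces the extra
  -- 1/n that makes the cosine error summable.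
  have hmid : s * Real.exp (-(b * n) * s) ≤ 2 / (b * n) * Real.exp (-(b * n / 2) * s) := by
    have hu : b * n / 2 * s ≤ Real.exp (b * n / 2 * s) := by
      linarith [Real.add_one_le_exp (b * n / 2 * s)]
    have : s ≤ 2 / (b * n) * Real.exp (b * n / 2 * s) := by
      calc s = 2 / (b * n) * (b * n / 2 * s) := by field_simp
        _ ≤ _ := by gcongr
    calc s * Real.exp (-(b * n) * s)
        ≤ 2 / (b * n) * Real.exp (b * n / 2 * s) * Real.exp (-(b * n) * s) := by gcongr
      _ = _ := by rw [mul_assoc, ← Real.exp_add]; congr 2; ring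
  rcases le_or_gt s s₀ with h | h
  · have e1 : Real.exp (-(b' * n) * s) ≤ f ^ n := by
      calc _ = Real.exp (-b' * s) ^ n := by rw [← Real.exp_nat_mul]; congr 1; ring
        _ ≤ _ := pow_le_pow_left₀ (Real.exp_pos _).le (hlow h) _
    have e1' : f ^ n ≤ Real.exp (-(b * n) * s) := by
      calc f ^ n ≤ Real.exp (-b * s) ^ n := pow_le_pow_left₀ (hf0 h) (hup h) _
        _ = _ := by rw [← Real.exp_nat_mul]; congr 1; ring
    have e2 : |c * q ^ n| ≤ (1 - γ) ^ n := by
      rw [abs_mul, abs_pow]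
      calc |c| * |q| ^ n ≤ 1 * (1 - γ) ^ n := by gcongr
        _ = _ := one_mul _
    have e3 : (1 - γ) ^ n ≤ tailCoeff γ s₀ n * Real.exp (-s) := by
      unfold tailCoeff
      have : 1 ≤ Real.exp s₀ * Real.exp (-s) := by
        rw [← Real.exp_add]; exact Real.one_le_exp (by linarith)
      have h3 : 0 ≤ n * (1 - γ + γ * Real.exp (-s₀)) ^ (n - 1) * Real.exp (-s) := by positivity
      have h4 : 0 < (1 - γ) ^ n := by positivity
      nlinarith
    have e4 : (1 - c) * f ^ n ≤ κ * (2 / (b * n)) * Real.exp (-(b * n / 2) * s) := by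
      calc (1 - c) * f ^ n ≤ (κ * s) * Real.exp (-(b * n) * s) := by
            have := pow_nonneg (hf0 h) n
            gcongr
        _ = κ * (s * Real.exp (-(b * n) * s)) := by ring
        _ ≤ κ * (2 / (b * n) * Real.exp (-(b * n / 2) * s)) := by gcongr
        _ = _ := by ring
    have e5 := (abs_le.1 e2).2
    have e6 : 0 ≤ Real.exp (-(b' * s₀)) ^ (n - 1) * Real.exp (-b' * s) := by positivity
    nlinarith
  · have e1 : Real.exp (-(b' * n) * s)
        ≤ Real.exp (-(b' * s₀)) ^ (n - 1) * Real.exp (-b' * s) := by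
      rw [← Real.exp_nat_mul, ← Real.exp_add]
      apply Real.exp_le_exp.2
      have : ((n - 1 : ℕ) : ℝ) = n - 1 := by push_cast [hn]; ring
      rw [this]
      have : (0 : ℝ) ≤ n - 1 := by rw [← this]; positivity
      have := mul_nonneg (mul_nonneg hb'.le this) (sub_nonneg.2 h.le)
      nlinarith
    have hup' := abs_pow_sub_pow_le_of_lt (n := n) ⟨h0, h1⟩ h hf hq
    have hk : 0 ≤ κ * (2 / (b * n)) * Real.exp (-(b * n / 2) * s) := by positivity
    have e2 : |c * (f ^ n - q ^ n)| ≤ |f ^ n - q ^ n| := by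
      rw [abs_mul]
      calc _ ≤ 1 * |f ^ n - q ^ n| := by gcongr
        _ = _ := one_mul _
    have e3 := (abs_le.1 e2).1
    linarith

end scalar

lemma norm_charFun_le_of_add {μ G Q : Measure Plane} [IsProbabilityMeasure μ] [IsFiniteMeasure Q]
    (h : μ = G + Q) (ξ : Plane) :
    ‖charFun Q ξ‖ ≤ 1 - G.real Set.univ := by
  have hG : IsFiniteMeasure G := by
    refine ⟨lt_of_le_of_lt ?_ (measure_lt_top μ Set.univ)⟩
    rw [h]; simp
  refine (norm_charFun_le ξ).trans (le_of_eq ?_)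
  have : μ.real Set.univ = 1 := by simp
  rw [h, measureReal_add_apply] at this
  linarith

/-- The density of the part of the convolution power that contains a Gaussian factor. -/
def powDensity (γ : ℝ) (μ Q : Measure Plane) (n : ℕ) (x : Plane) : ℝ :=
  γ * ∫ y, gaussDensity (x - y) ∂(gaussCofactor μ Q n)

section density

variable {γ τ s₀ : ℝ} {μ N Q : Measure Plane} [IsProbabilityMeasure μ] [IsProbabilityMeasure N]
  [IsFiniteMeasure Q]

/-- By `charFun_gaussCofactor`, the Gaussian factor γ exp(-|ξ|²) times the characteristic function
of the cofactor is exactly f^n - q^n. Since f and q are real, taking real parts turns the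
exponential into a cosine. -/
lemma powDensity_eq_fourier (hγ : 0 < γ) (hN : ∀ ξ, charFun N ξ = Real.exp (-‖ξ‖ ^ 2))
    (hμ : μ = ENNReal.ofReal γ • N + Q) (him : ∀ ξ, (charFun μ ξ).im = 0)
    {n : ℕ} {H : Plane → ℝ} (hH : Integrable H)
    (hle : ∀ ξ, |(charFun μ ξ).re ^ n - ((charFun μ ξ).re - γ * Real.exp (-‖ξ‖ ^ 2)) ^ n| ≤ H ξ)
    (x : Plane) :
    Integrable (fun ξ : Plane => Real.cos (inner ℝ x ξ) *
      ((charFun μ ξ).re ^ n - ((charFun μ ξ).re - γ * Real.exp (-‖ξ‖ ^ 2)) ^ n)) ∧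
    powDensity γ μ Q n x = (4 * Real.pi ^ 2)⁻¹ * ∫ ξ : Plane, Real.cos (inner ℝ x ξ) *
      ((charFun μ ξ).re ^ n - ((charFun μ ξ).re - γ * Real.exp (-‖ξ‖ ^ 2)) ^ n) := by
  have hN' : IsFiniteMeasure (ENNReal.ofReal γ • N) := N.smul_finite ENNReal.ofReal_ne_top
  set D : Plane → ℝ := fun ξ =>
    (charFun μ ξ).re ^ n - ((charFun μ ξ).re - γ * Real.exp (-‖ξ‖ ^ 2)) ^ n with hD
  have hDm : Measurable D := by
    have := (measurable_charFun (μ := μ)).re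
    fun_prop
  have hre : ∀ ξ, charFun μ ξ = ((charFun μ ξ).re : ℂ) := fun ξ => by
    apply Complex.ext <;> simp [him]
  have hGN : ∀ ξ, charFun (ENNReal.ofReal γ • N) ξ = ((γ * Real.exp (-‖ξ‖ ^ 2) : ℝ) : ℂ) := by
    intro ξ
    rw [charFun_apply, integral_smul_measure, ← charFun_apply, hN,
      ENNReal.toReal_ofReal hγ.le, Complex.real_smul]
    push_cast; rfl
  have hsub : ∀ ξ, charFun μ ξ - charFun Q ξ = ((γ * Real.exp (-‖ξ‖ ^ 2) : ℝ) : ℂ) := by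
    intro ξ
    rw [← hGN, hμ, charFun_add_measure]; ring
  have hQ : ∀ ξ, charFun Q ξ = (((charFun μ ξ).re - γ * Real.exp (-‖ξ‖ ^ 2) : ℝ) : ℂ) := by
    intro ξ
    have := hsub ξ
    rw [Complex.ofReal_sub, ← hre, ← this]; ring
  have hDeq : ∀ ξ, (γ : ℂ) * (Complex.exp (-(‖ξ‖ : ℂ) ^ 2) * charFun (gaussCofactor μ Q n) ξ)
      = (D ξ : ℂ) := by
    intro ξ
    have h := charFun_gaussCofactor (μ := μ) (Q := Q) n ξ
    rw [hsub] at h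
    have : (D ξ : ℂ) = charFun μ ξ ^ n - charFun Q ξ ^ n := by
      rw [hQ, hre ξ, hD]; push_cast; simp
    rw [this, ← h]; push_cast; ring
  have hint : Integrable (fun ξ : Plane => Complex.exp (-(inner ℝ x ξ) * Complex.I) * (D ξ : ℂ)) := by
    refine hH.mono' ?_ (ae_of_all _ fun ξ => ?_)
    · have : Measurable fun ξ => (D ξ : ℂ) := Complex.measurable_ofReal.comp hDm
      exact (Measurable.mul (by fun_prop) this).aestronglyMeasurable
    · rw [norm_mul]
      have e1 : ‖Complex.exp (-(inner ℝ x ξ : ℝ) * Complex.I)‖ = 1 := by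
        have := Complex.norm_exp_ofReal_mul_I (-(inner ℝ x ξ : ℝ))
        push_cast at this; exact this
      rw [e1, one_mul, Complex.norm_real]
      exact hle ξ
  have hrep : ∀ ξ : Plane, (Complex.exp (-(inner ℝ x ξ) * Complex.I) * (D ξ : ℂ)).re
      = Real.cos (inner ℝ x ξ) * D ξ := by
    intro ξ
    rw [Complex.re_mul_ofReal]
    have : (-(inner ℝ x ξ : ℝ) * Complex.I : ℂ) = ((-(inner ℝ x ξ) : ℝ) : ℂ) * Complex.I := by
      push_cast; rfl
    rw [this, Complex.exp_ofReal_mul_I_re, Real.cos_neg]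
  have hcplx : (powDensity γ μ Q n x : ℂ) = ((4 * Real.pi ^ 2)⁻¹ : ℝ) *
      ∫ ξ : Plane, Complex.exp (-(inner ℝ x ξ) * Complex.I) * (D ξ : ℂ) := by
    rw [powDensity, Complex.ofReal_mul, integral_gaussDensity_sub]
    simp_rw [← hDeq]
    rw [mul_left_comm, ← integral_const_mul (γ : ℂ)]
    congr 1
    refine integral_congr_ae (ae_of_all _ fun ξ => ?_)
    simp only; ring
  refine ⟨?_, ?_⟩
  · have := hint.re
    refine this.congr (ae_of_all _ fun ξ => ?_)
    exact hrep ξ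
  · have h := congrArg Complex.re hcplx
    rw [Complex.ofReal_re, Complex.re_ofReal_mul] at h
    rw [h]
    congr 1
    have h2 := integral_re hint
    rw [← RCLike.re_eq_complex_re, ← h2]
    exact integral_congr_ae (ae_of_all _ fun ξ => hrep ξ)

lemma abs_re_charFun_sub_le (hγ : γ ∈ Set.Ioo (0 : ℝ) 1)
    (hN : ∀ ξ, charFun N ξ = Real.exp (-‖ξ‖ ^ 2)) (hμ : μ = ENNReal.ofReal γ • N + Q) (ξ : Plane) :
    |(charFun μ ξ).re - γ * Real.exp (-‖ξ‖ ^ 2)| ≤ 1 - γ := by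
  have hN' : IsFiniteMeasure (ENNReal.ofReal γ • N) := N.smul_finite ENNReal.ofReal_ne_top
  have h := norm_charFun_le_of_add hμ ξ
  have h1 : (ENNReal.ofReal γ • N).real Set.univ = γ := by
    simp [measureReal_ennreal_smul_apply, hγ.1.le]
  have h2 : charFun μ ξ = ((γ * Real.exp (-‖ξ‖ ^ 2) : ℝ) : ℂ) + charFun Q ξ := by
    rw [hμ, charFun_add_measure, charFun_apply (μ := ENNReal.ofReal γ • N), integral_smul_measure,
      ← charFun_apply, hN, ENNReal.toReal_ofReal hγ.1.le, Complex.real_smul]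
    push_cast; rfl
  rw [h2, Complex.add_re, Complex.ofReal_re, add_sub_cancel_left]
  rw [h1] at h
  exact (Complex.abs_re_le_norm _).trans h

end density

section bounds

variable {γ τ s₀ : ℝ} {μ N Q : Measure Plane} [IsProbabilityMeasure N] [IsFiniteMeasure Q] {n : ℕ}

/-- Integrate the two scalar bounds over ξ. The main term is (4π²)⁻¹ ∫ exp(-bn|ξ|²) dξ = 1/(4πbn)
with b = (1 ∓ τ)/γ. Only the lower bound needs |x| ≤ R, through 1 - cos⟨x,ξ⟩ ≤ R²|ξ|²/2. -/
lemma powDensity_bounds (hγ : γ ∈ Set.Ioo (0 : ℝ) 1) (hτ : τ ∈ Set.Ioo (0 : ℝ) 1)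
    (hstep : IsStepLaw γ τ s₀ μ) (hN : ∀ ξ, charFun N ξ = Real.exp (-‖ξ‖ ^ 2))
    (hμ : μ = ENNReal.ofReal γ • N + Q) (hn : 1 ≤ n) {R : ℝ} (x : Plane) :
    powDensity γ μ Q n x ≤ γ / (4 * Real.pi * n * (1 - τ)) + lltError γ τ s₀ R n ∧
    (‖x‖ ≤ R → γ / (4 * Real.pi * n * (1 + τ)) - lltError γ τ s₀ R n ≤ powDensity γ μ Q n x) := by
  have := hstep.isProbabilityMeasure
  obtain ⟨hτ0, hτ1⟩ := hτ
  obtain ⟨h0, h1⟩ := id hγ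
  have hn0 : (0 : ℝ) < n := by exact_mod_cast hn
  have hpi := Real.pi_pos
  have h1τ : 0 < 1 - τ := by linarith
  set b := (1 - τ) / γ with hb
  set b' := (1 + τ) / γ with hb'
  have hbpos : 0 < b := by positivity
  have hb'pos : 0 < b' := by positivity
  have hbn : 0 < b * n := by positivity
  have hK := tailCoeff_nonneg (s₀ := s₀) (n := n) hγ
  set K := tailCoeff γ s₀ n with hKdef
  set f : Plane → ℝ := fun ξ => (charFun μ ξ).re with hf
  set q : Plane → ℝ := fun ξ => (charFun μ ξ).re - γ * Real.exp (-‖ξ‖ ^ 2) with hq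
  have hle : ∀ ξ, |f ξ ^ n - q ξ ^ n|
      ≤ Real.exp (-(b * n) * ‖ξ‖ ^ 2) + K * Real.exp (-1 * ‖ξ‖ ^ 2) := by
    intro ξ
    rw [neg_one_mul]
    exact abs_pow_sub_pow_le_gaussian hγ hn (by simp only [hf, hq]; ring)
      (abs_re_charFun_sub_le hγ hN hμ ξ) (hstep.upper ξ)
      (fun h => (Real.exp_pos _).le.trans (hstep.lower ξ h))
  have i1 := integrable_exp_neg_mul_normSq hbn
  have i2 := (integrable_exp_neg_mul_normSq one_pos).const_mul K
  have iH := i1.add i2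
  obtain ⟨hint, hd⟩ := powDensity_eq_fourier (n := n) h0 hN hμ hstep.im_charFun iH hle x
  have e1 : 0 ≤ Real.exp (-(b' * s₀)) ^ (n - 1) * (Real.pi / b') := by positivity
  have e2 : 0 ≤ R ^ 2 / 2 * (2 / (b * n)) * (2 * Real.pi / (b * n)) := by positivity
  refine ⟨?_, fun hx => ?_⟩
  · have hup : ∫ ξ : Plane, Real.cos (inner ℝ x ξ) * (f ξ ^ n - q ξ ^ n)
        ≤ ∫ ξ : Plane, (Real.exp (-(b * n) * ‖ξ‖ ^ 2) + K * Real.exp (-1 * ‖ξ‖ ^ 2)) := by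
      refine integral_mono hint iH fun ξ => ?_
      refine (le_abs_self _).trans ?_
      rw [abs_mul]
      calc _ ≤ 1 * |f ξ ^ n - q ξ ^ n| := by
            gcongr; exact Real.abs_cos_le_one _
        _ ≤ _ := by rw [one_mul]; exact hle ξ
    rw [integral_add i1 i2, integral_const_mul, integral_exp_neg_mul_normSq hbn,
      integral_exp_neg_mul_normSq one_pos] at hup
    rw [hd]
    calc _ ≤ (4 * Real.pi ^ 2)⁻¹ * (Real.pi / (b * n) + K * (Real.pi / 1)) := by gcongr
      _ = γ / (4 * Real.pi * n * (1 - τ)) + K * Real.pi / (4 * Real.pi ^ 2) := by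
          rw [hb]; field_simp
      _ ≤ _ := by
          gcongr
          unfold lltError
          rw [← hb, ← hb', ← hKdef]
          gcongr
          linarith
  · have j1 := integrable_exp_neg_mul_normSq (show 0 < b' * n by positivity)
    have j2 := (integrable_exp_neg_mul_normSq (show 0 < b * n / 2 by positivity)).const_mul
      (R ^ 2 / 2 * (2 / (b * n)))
    have j3 := (integrable_exp_neg_mul_normSq hb'pos).const_mul (Real.exp (-(b' * s₀)) ^ (n - 1))
    have j12 : Integrable fun ξ : Plane => Real.exp (-(b' * n) * ‖ξ‖ ^ 2) -
        R ^ 2 / 2 * (2 / (b * n)) * Real.exp (-(b * n / 2) * ‖ξ‖ ^ 2) := j1.sub j2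
    have j123 : Integrable fun ξ : Plane => Real.exp (-(b' * n) * ‖ξ‖ ^ 2) -
        R ^ 2 / 2 * (2 / (b * n)) * Real.exp (-(b * n / 2) * ‖ξ‖ ^ 2)
        - K * Real.exp (-1 * ‖ξ‖ ^ 2) := j12.sub i2
    have hlow : ∫ ξ : Plane, (Real.exp (-(b' * n) * ‖ξ‖ ^ 2) -
        R ^ 2 / 2 * (2 / (b * n)) * Real.exp (-(b * n / 2) * ‖ξ‖ ^ 2)
        - K * Real.exp (-1 * ‖ξ‖ ^ 2) - Real.exp (-(b' * s₀)) ^ (n - 1) *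
          Real.exp (-b' * ‖ξ‖ ^ 2))
        ≤ ∫ ξ : Plane, Real.cos (inner ℝ x ξ) * (f ξ ^ n - q ξ ^ n) := by
      refine integral_mono (j123.sub j3) hint fun ξ => ?_
      simp only [neg_one_mul]
      refine gaussian_le_mul_pow_sub_pow (b := b) (b' := b') (κ := R ^ 2 / 2) hγ hn (by positivity) hbpos
        hb'pos (by positivity) (by simp only [hf, hq]; ring)
        (abs_re_charFun_sub_le hγ hN hμ ξ) (hstep.upper ξ) (hstep.lower ξ)
        (Real.abs_cos_le_one _) ?_
      have c1 := Real.one_sub_sq_div_two_le_cos (x := inner ℝ x ξ)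
      have c2 : (inner ℝ x ξ) ^ 2 ≤ R ^ 2 * ‖ξ‖ ^ 2 := by
        rw [← mul_pow, ← sq_abs]
        refine pow_le_pow_left₀ (abs_nonneg _) ((abs_real_inner_le_norm x ξ).trans ?_) 2
        gcongr
      linarith
    rw [integral_sub j123 j3, integral_sub j12 i2, integral_sub j1 j2,
      integral_const_mul, integral_const_mul, integral_const_mul,
      integral_exp_neg_mul_normSq one_pos, integral_exp_neg_mul_normSq hb'pos,
      integral_exp_neg_mul_normSq (show 0 < b' * n by positivity),
      integral_exp_neg_mul_normSq (show 0 < b * n / 2 by positivity)] at hlow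
    rw [hd]
    refine le_trans (le_of_eq ?_) (mul_le_mul_of_nonneg_left hlow (by positivity))
    have e3 : γ / (4 * Real.pi * n * (1 + τ)) = (4 * Real.pi ^ 2)⁻¹ * (Real.pi / (b' * n)) := by
      rw [hb']; field_simp
    rw [e3]
    unfold lltError
    rw [← hb, ← hb', ← hKdef]
    field_simp
    ring

/-- The part with a Gaussian factor sees the Lebesgue integral of F. The power of the remainder, of
mass (1-γ)^n, may be singular and sees only the supremum of F. -/
theorem IsStepLaw.lintegral_convPow_le (hγ : γ ∈ Set.Ioo (0 : ℝ) 1) (hτ : τ ∈ Set.Ioo (0 : ℝ) 1)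
    (hstep : IsStepLaw γ τ s₀ μ) (hn : 1 ≤ n) (R : ℝ) {F : Plane → ℝ≥0∞} (hF : Measurable F)
    {c : ℝ≥0∞} (hc : ∀ x, F x ≤ c) :
    ∫⁻ x, F x ∂(convPow μ n) ≤
      ENNReal.ofReal (γ / (4 * Real.pi * n * (1 - τ)) + lltError γ τ s₀ R n) * (∫⁻ x, F x)
        + ENNReal.ofReal ((1 - γ) ^ n) * c := by
  obtain ⟨N, hNp, hN, hNle⟩ := hstep.minorized
  have := hstep.isProbabilityMeasure
  have hN' : IsFiniteMeasure (ENNReal.ofReal γ • N) := N.smul_finite ENNReal.ofReal_ne_top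
  set Q := μ - ENNReal.ofReal γ • N with hQ
  have hμ : μ = ENNReal.ofReal γ • N + Q := by
    rw [add_comm, hQ, Measure.sub_add_cancel_of_le hNle]
  have hQuniv : Q Set.univ = ENNReal.ofReal (1 - γ) := by
    rw [hQ, Measure.sub_apply MeasurableSet.univ hNle]
    simp [ENNReal.ofReal_sub _ hγ.1.le]
  rw [convPow_eq_add hμ, lintegral_add_measure]
  refine add_le_add ?_ ?_
  · rw [Measure.conv_smul_left, lintegral_smul_measure, lintegral_conv_gaussian hN hF,
      smul_eq_mul, ← lintegral_const_mul' _ _ ENNReal.ofReal_ne_top,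
      ← lintegral_const_mul' _ _ ENNReal.ofReal_ne_top]
    refine lintegral_mono fun x => ?_
    rw [mul_left_comm, ← ENNReal.ofReal_mul hγ.1.le, mul_comm (ENNReal.ofReal _) (F x)]
    gcongr
    exact (powDensity_bounds hγ hτ hstep hN hμ hn x).1
  · calc ∫⁻ x, F x ∂(convPow Q n) ≤ ∫⁻ _, c ∂(convPow Q n) := lintegral_mono hc
      _ = _ := by
        rw [lintegral_const, convPow_univ, hQuniv, mul_comm, ENNReal.ofReal_pow (by linarith [hγ.2])]

/-- The power of the remainder is nonnegative and is dropped. -/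
theorem IsStepLaw.le_lintegral_convPow (hγ : γ ∈ Set.Ioo (0 : ℝ) 1) (hτ : τ ∈ Set.Ioo (0 : ℝ) 1)
    (hstep : IsStepLaw γ τ s₀ μ) (hn : 1 ≤ n) {R : ℝ} {F : Plane → ℝ≥0∞} (hF : Measurable F)
    (hR : ∀ x, R < ‖x‖ → F x = 0) :
    ENNReal.ofReal (γ / (4 * Real.pi * n * (1 + τ)) - lltError γ τ s₀ R n) * ∫⁻ x, F x
      ≤ ∫⁻ x, F x ∂(convPow μ n) := by
  obtain ⟨N, hNp, hN, hNle⟩ := hstep.minorized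
  have := hstep.isProbabilityMeasure
  have hN' : IsFiniteMeasure (ENNReal.ofReal γ • N) := N.smul_finite ENNReal.ofReal_ne_top
  set Q := μ - ENNReal.ofReal γ • N with hQ
  have hμ : μ = ENNReal.ofReal γ • N + Q := by
    rw [add_comm, hQ, Measure.sub_add_cancel_of_le hNle]
  rw [convPow_eq_add hμ, lintegral_add_measure]
  refine le_trans ?_ le_self_add
  rw [Measure.conv_smul_left, lintegral_smul_measure, lintegral_conv_gaussian hN hF,
    smul_eq_mul, ← lintegral_const_mul' _ _ ENNReal.ofReal_ne_top,
    ← lintegral_const_mul' _ _ ENNReal.ofReal_ne_top]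
  refine lintegral_mono fun x => ?_
  rcases lt_or_ge R ‖x‖ with h | h
  · simp [hR x h]
  rw [mul_left_comm, ← ENNReal.ofReal_mul hγ.1.le, mul_comm (ENNReal.ofReal _) (F x)]
  gcongr
  exact (powDensity_bounds hγ hτ hstep hN hμ hn x).2 h

end bounds

lemma lltError_nonneg {γ τ s₀ R : ℝ} (hγ : γ ∈ Set.Ioo (0 : ℝ) 1) (hτ : τ ∈ Set.Ioo (0 : ℝ) 1)
    (n : ℕ) : 0 ≤ lltError γ τ s₀ R n := by
  have h1 : 0 < 1 - τ := by linarith [hτ.2]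
  have h2 := hγ.1
  have h3 := hτ.1
  have := tailCoeff_nonneg (s₀ := s₀) (n := n) hγ
  unfold lltError; positivity

/-- Summability means that the errors add up to O(1) over all gaps, while the main terms γ/(4πn) add
up to a multiple of log N. -/
lemma summable_lltError {γ τ s₀ R : ℝ} (hγ : γ ∈ Set.Ioo (0 : ℝ) 1) (hτ : τ ∈ Set.Ioo (0 : ℝ) 1)
    (hs₀ : 0 < s₀) : Summable (lltError γ τ s₀ R) := by
  have h1 : 0 < 1 - τ := by linarith [hτ.2]
  have h2 := hγ.1
  have h2' : 0 < 1 - γ := by linarith [hγ.2]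
  have h3 := hτ.1
  have hexp : Real.exp (-s₀) < 1 := Real.exp_lt_one_iff.2 (by linarith)
  have hρ0 : 0 < 1 - γ + γ * Real.exp (-s₀) := by positivity
  have hρ1 : 1 - γ + γ * Real.exp (-s₀) < 1 := by nlinarith
  have s1 : Summable fun n : ℕ =>
      R ^ 2 / 2 * (2 / ((1 - τ) / γ * n)) * (2 * Real.pi / ((1 - τ) / γ * n)) := by
    have := (Real.summable_one_div_nat_pow.2 (by norm_num : 1 < 2)).mul_left
      (R ^ 2 / 2 * (2 / ((1 - τ) / γ)) * (2 * Real.pi / ((1 - τ) / γ)))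
    refine this.congr fun n => ?_
    rcases eq_or_ne n 0 with rfl | hn
    · simp
    · field_simp
  have s2 : Summable fun n : ℕ => (n : ℝ) * (1 - γ + γ * Real.exp (-s₀)) ^ (n - 1) := by
    rw [← summable_nat_add_iff 1]
    have a1 := summable_pow_mul_geometric_of_norm_lt_one (R := ℝ) 1
      (r := 1 - γ + γ * Real.exp (-s₀)) (by rwa [Real.norm_of_nonneg hρ0.le])
    have a2 := summable_geometric_of_lt_one hρ0.le hρ1
    refine (a1.add a2).congr fun n => ?_
    push_cast
    simp only [pow_one]
    ring
  have s3 : Summable (tailCoeff γ s₀) :=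
    ((summable_geometric_of_lt_one h2'.le (by linarith)).mul_right _).add s2
  have s4 : Summable fun n : ℕ => Real.exp (-((1 + τ) / γ * s₀)) ^ (n - 1) := by
    rw [← summable_nat_add_iff 1]
    simp only [add_tsub_cancel_right]
    refine summable_geometric_of_lt_one (Real.exp_pos _).le (Real.exp_lt_one_iff.2 ?_)
    have : 0 < (1 + τ) / γ * s₀ := by positivity
    linarith
  exact ((s1.add (s3.mul_right _)).add (s4.mul_right _)).div_const _

end KR

end


/-! ### Walks with iid blocks: shifted differences and independence. -/

noncomputable section

namespace KR

open scoped ENNReal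

section blocks

variable {Ω : Type*}

/-- The first walk after `n` blocks. -/
def posX (b : ℕ → Ω → Plane × Plane) (n : ℕ) (ω : Ω) : Plane := ∑ i ∈ Finset.range n, (b i ω).1

/-- The second walk after `n` blocks. -/
def posY (b : ℕ → Ω → Plane × Plane) (n : ℕ) (ω : Ω) : Plane := ∑ i ∈ Finset.range n, (b i ω).2

/-- The difference of the first walk after `k + d` blocks and the second walk after `k` blocks. -/
def shiftedDiff (b : ℕ → Ω → Plane × Plane) (k : ℕ) (d : ℤ) (ω : Ω) : Plane :=
  posX b ((k : ℤ) + d).toNat ω - posY b k ω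

/-- The sum of the differences of the blocks `i` with `m ≤ i < n`. -/
def diffSum (b : ℕ → Ω → Plane × Plane) (m n : ℕ) (ω : Ω) : Plane :=
  ∑ i ∈ Finset.Ico m n, ((b i ω).1 - (b i ω).2)

/-- The sigma-algebra generated by the blocks with index in `S`. -/
abbrev blockSigma (b : ℕ → Ω → Plane × Plane) (S : Set ℕ) : MeasurableSpace Ω :=
  ⨆ i ∈ S, MeasurableSpace.comap (b i) inferInstance

lemma measurable_block {b : ℕ → Ω → Plane × Plane} {S : Set ℕ} {i : ℕ} (hi : i ∈ S) :
    Measurable[blockSigma b S] (b i) := by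
  refine Measurable.mono (comap_measurable (b i)) ?_ le_rfl
  exact le_iSup₂ (f := fun i (_ : i ∈ S) => MeasurableSpace.comap (b i) inferInstance) i hi

lemma blockSigma_mono {b : ℕ → Ω → Plane × Plane} {S T : Set ℕ} (h : S ⊆ T) :
    blockSigma b S ≤ blockSigma b T :=
  biSup_mono h

lemma blockSigma_le [m : MeasurableSpace Ω] {b : ℕ → Ω → Plane × Plane} (hb : ∀ i, Measurable (b i))
    (S : Set ℕ) : blockSigma b S ≤ m :=
  iSup₂_le fun i _ => (hb i).comap_le

lemma measurable_posX {b : ℕ → Ω → Plane × Plane} {S : Set ℕ} {n : ℕ} (h : ∀ i < n, i ∈ S) :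
    Measurable[blockSigma b S] (posX b n) := by
  refine @Finset.measurable_fun_sum _ _ _ _ _ _ (blockSigma b S) _ _ fun i hi => ?_
  exact measurable_fst.comp (measurable_block (h i (Finset.mem_range.1 hi)))

lemma measurable_posY {b : ℕ → Ω → Plane × Plane} {S : Set ℕ} {n : ℕ} (h : ∀ i < n, i ∈ S) :
    Measurable[blockSigma b S] (posY b n) := by
  refine @Finset.measurable_fun_sum _ _ _ _ _ _ (blockSigma b S) _ _ fun i hi => ?_
  exact measurable_snd.comp (measurable_block (h i (Finset.mem_range.1 hi)))

lemma measurable_diffSum {b : ℕ → Ω → Plane × Plane} {S : Set ℕ} {m n : ℕ}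
    (h : ∀ i, m ≤ i → i < n → i ∈ S) :
    Measurable[blockSigma b S] (diffSum b m n) := by
  refine @Finset.measurable_fun_sum _ _ _ _ _ _ (blockSigma b S) _ _ fun i hi => ?_
  have := measurable_block (b := b) (h i (Finset.mem_Ico.1 hi).1 (Finset.mem_Ico.1 hi).2)
  exact (measurable_fst.comp this).sub (measurable_snd.comp this)

lemma measurable_shiftedDiff {b : ℕ → Ω → Plane × Plane} {S : Set ℕ} {k : ℕ} {d : ℤ} (hd : d ≤ 1)
    (h : ∀ i ≤ k, i ∈ S) : Measurable[blockSigma b S] (shiftedDiff b k d) := by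
  have h1 : Measurable[blockSigma b S] (posX b ((k : ℤ) + d).toNat) :=
    measurable_posX fun i hi => h i (by omega)
  have h2 : Measurable[blockSigma b S] (posY b k) := measurable_posY fun i hi => h i hi.le
  exact h1.sub h2

variable {b : ℕ → Ω → Plane × Plane}

/-- The contribution of the last two blocks before a shifted time. -/
def endPart (b : ℕ → Ω → Plane × Plane) (k : ℕ) (d : ℤ) (ω : Ω) : Plane :=
  ((b (k - 1) ω).1 - (b (k - 1) ω).2) +
    if d = 1 then (b k ω).1 else if d = 0 then 0 else -(b (k - 1) ω).1

lemma posX_sub_posY (m : ℕ) (ω : Ω) : posX b m ω - posY b m ω = diffSum b 0 m ω := by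
  simp [posX, posY, diffSum, Finset.sum_sub_distrib]

/-- For all three shifts the dependence beyond the unshifted walk is confined to the blocks k - 1
and k. -/
lemma shiftedDiff_eq {d : ℤ} (hd : d = -1 ∨ d = 0 ∨ d = 1) {k : ℕ} (hk : 1 ≤ k) (ω : Ω) :
    shiftedDiff b k d ω = diffSum b 0 (k - 1) ω + endPart b k d ω := by
  obtain ⟨k, rfl⟩ : ∃ j, k = j + 1 := ⟨k - 1, by omega⟩
  have h0 : diffSum b 0 (k + 1) ω = diffSum b 0 k ω + ((b k ω).1 - (b k ω).2) := by
    simp only [diffSum]; rw [Finset.sum_Ico_succ_top (by omega)]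
  have h1 := posX_sub_posY (b := b) (k + 1) ω
  simp only [add_tsub_cancel_right, endPart]
  rw [← add_assoc, ← h0, ← h1]
  rcases hd with rfl | rfl | rfl
  · have e : (((k + 1 : ℕ) : ℤ) + -1).toNat = k := by omega
    have e2 : posX b (k + 1) ω = posX b k ω + (b k ω).1 := Finset.sum_range_succ _ _
    simp only [shiftedDiff, e, e2]
    norm_num
    abel
  · simp [shiftedDiff]
  · have e : (((k + 1 : ℕ) : ℤ) + 1).toNat = k + 1 + 1 := by omega
    have e2 : posX b (k + 1 + 1) ω = posX b (k + 1) ω + (b (k + 1) ω).1 := Finset.sum_range_succ _ _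
    simp only [shiftedDiff, e, e2, if_true]
    abel

/-- With K the previous index and m the gap, the m - 2 ≥ 1 blocks K+1, …, K+m-2 lie strictly between
those that the shifts at K and at K + m can touch. Their sum is independent of everything else in
the formula, and the local limit bounds are applied to it. -/
lemma shiftedDiff_add_eq {d : ℤ} (hd : d = -1 ∨ d = 0 ∨ d = 1) {K m : ℕ} (hm : 3 ≤ m) (ω : Ω) :
    shiftedDiff b (K + m) d ω
      = (diffSum b 0 (K + 1) ω + endPart b (K + m) d ω) + diffSum b (K + 1) (K + 1 + (m - 2)) ω := by
  rw [shiftedDiff_eq hd (by omega)]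
  have : diffSum b 0 (K + m - 1) ω
      = diffSum b 0 (K + 1) ω + diffSum b (K + 1) (K + 1 + (m - 2)) ω := by
    simp only [diffSum]
    rw [Finset.sum_Ico_consecutive _ (by omega) (by omega)]
    congr 2; omega
  rw [this]; abel

lemma measurable_endPart {S : Set ℕ} {k : ℕ} {d : ℤ} (h1 : k - 1 ∈ S) (h2 : k ∈ S) :
    Measurable[blockSigma b S] (endPart b k d) := by
  have m1 := measurable_block (b := b) h1
  have m2 := measurable_block (b := b) h2
  have h3 : Measurable[blockSigma b S] fun ω => (b (k - 1) ω).1 - (b (k - 1) ω).2 :=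
    (measurable_fst.comp m1).sub (measurable_snd.comp m1)
  have h4 : Measurable[blockSigma b S] fun ω =>
      if d = 1 then (b k ω).1 else if d = 0 then 0 else -(b (k - 1) ω).1 := by
    split_ifs
    · exact measurable_fst.comp m2
    · exact measurable_const
    · exact (measurable_fst.comp m1).neg
  exact h3.add h4

variable [MeasurableSpace Ω] {P : Measure Ω}

lemma indepFun_of_blockSigma {A B : Type*} [MeasurableSpace A] [MeasurableSpace B]
    (hb : ∀ i, Measurable (b i)) (hind : iIndepFun b P) {S T : Set ℕ} (hST : Disjoint S T)
    {f : Ω → A} {g : Ω → B} (hf : Measurable[blockSigma b S] f)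
    (hg : Measurable[blockSigma b T] g) : IndepFun f g P := by
  have h := indep_iSup_of_disjoint (fun i => (hb i).comap_le) hind.iIndep hST
  exact indep_of_indep_of_le_left (indep_of_indep_of_le_right h hg.comap_le) hf.comap_le

variable [IsProbabilityMeasure P]

lemma lintegral_eq_of_indepFun {A B : Type*} [MeasurableSpace A] [MeasurableSpace B]
    {f : Ω → A} {g : Ω → B} (hf : Measurable f) (hg : Measurable g) (h : IndepFun f g P)
    {F : A → B → ℝ≥0∞} (hF : Measurable (Function.uncurry F)) :
    ∫⁻ ω, F (f ω) (g ω) ∂P = ∫⁻ ω, ∫⁻ z, F (f ω) z ∂(P.map g) ∂P := by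
  have : IsProbabilityMeasure (P.map g) := Measure.isProbabilityMeasure_map hg.aemeasurable
  have e := (indepFun_iff_map_prod_eq_prod_map_map hf.aemeasurable hg.aemeasurable).1 h
  have e1 : ∫⁻ ω, F (f ω) (g ω) ∂P
      = ∫⁻ q, Function.uncurry F q ∂(P.map fun ω => (f ω, g ω)) := by
    rw [lintegral_map hF (hf.prodMk hg)]; rfl
  rw [e1, e, lintegral_prod _ hF.aemeasurable, lintegral_map (by fun_prop) hf]
  rfl

lemma map_diffSum (hb : ∀ i, Measurable (b i)) (hind : iIndepFun b P) {μ : Measure Plane}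
    (hμ : ∀ i, P.map (fun ω => (b i ω).1 - (b i ω).2) = μ) (m n : ℕ) :
    P.map (diffSum b m (m + n)) = convPow μ n := by
  induction n with
  | zero =>
    have : diffSum b m (m + 0) = fun _ => 0 := by ext1 ω; simp [diffSum]
    rw [this, convPow, Measure.map_const]; simp
  | succ n ih =>
    have e : diffSum b m (m + (n + 1))
        = (fun ω => (b (m + n) ω).1 - (b (m + n) ω).2) + diffSum b m (m + n) := by
      ext1 ω
      simp only [diffSum, Pi.add_apply]
      rw [← add_assoc, Finset.sum_Ico_succ_top (by omega), add_comm]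
    have hv : Measurable[blockSigma b {m + n}] fun ω => (b (m + n) ω).1 - (b (m + n) ω).2 := by
      have := measurable_block (b := b) (Set.mem_singleton (m + n))
      exact (measurable_fst.comp this).sub (measurable_snd.comp this)
    have hs : Measurable[blockSigma b (Set.Ico m (m + n))] (diffSum b m (m + n)) :=
      measurable_diffSum fun i h1 h2 => ⟨h1, h2⟩
    have hi := indepFun_of_blockSigma hb hind (by simp) hv hs
    rw [e, hi.map_add_eq_map_conv_map (hv.mono (blockSigma_le hb _) le_rfl)
      (hs.mono (blockSigma_le hb _) le_rfl), hμ, ih, convPow]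

end blocks

end KR

end


/-! ### Bounds for the expectation along one tuple, by induction on its length. -/

noncomputable section

namespace KR

open scoped ENNReal

/-- The index `n 0 + … + n i` reached after the gaps `n 0, …, n i`. -/
def gapSum {p : ℕ} (n : Fin p → ℕ) (i : Fin p) : ℕ := ∑ j, if j ≤ i then n j else 0

lemma gapSum_castSucc {p : ℕ} (n : Fin (p + 1) → ℕ) (i : Fin p) :
    gapSum n i.castSucc = gapSum (Fin.init n) i := by
  simp only [gapSum, Fin.sum_univ_castSucc, Fin.castSucc_le_castSucc_iff, Fin.init]
  rw [if_neg (by simp [Fin.le_def])]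
  simp

lemma gapSum_last {p : ℕ} (n : Fin (p + 1) → ℕ) :
    gapSum n (Fin.last p) = (∑ j, Fin.init n j) + n (Fin.last p) := by
  simp [gapSum, Fin.sum_univ_castSucc, Fin.init, Fin.le_last]

lemma gapSum_le_sum {p : ℕ} (n : Fin p → ℕ) (i : Fin p) : gapSum n i ≤ ∑ j, n j :=
  Finset.sum_le_sum fun j _ => by split_ifs <;> simp

lemma measurable_snoc {p : ℕ} :
    Measurable fun q : (Fin p → Plane) × Plane => (Fin.snoc q.1 q.2 : Fin (p + 1) → Plane) := by
  refine measurable_pi_lambda _ fun i => ?_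
  refine Fin.lastCases ?_ (fun j => ?_) i
  · simpa using measurable_snd
  · simp only [Fin.snoc_castSucc]
    exact (measurable_pi_apply j).comp measurable_fst

/-- The vector of shifted differences along the tuple with gaps `n`. -/
def shiftedVec {Ω : Type*} (b : ℕ → Ω → Plane × Plane) {p : ℕ} (n : Fin p → ℕ) (δ : Fin p → ℤ)
    (ω : Ω) : Fin p → Plane := fun i => shiftedDiff b (gapSum n i) (δ i) ω

lemma shiftedVec_succ {Ω : Type*} (b : ℕ → Ω → Plane × Plane) {p : ℕ} (n : Fin (p + 1) → ℕ)
    (δ : Fin (p + 1) → ℤ) (ω : Ω) :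
    shiftedVec b n δ ω = Fin.snoc (shiftedVec b (Fin.init n) (Fin.init δ) ω)
      (shiftedDiff b ((∑ j, Fin.init n j) + n (Fin.last p)) (δ (Fin.last p)) ω) := by
  ext1 i
  refine Fin.lastCases ?_ (fun j => ?_) i
  · rw [Fin.snoc_last, shiftedVec, gapSum_last]
  · rw [Fin.snoc_castSucc, shiftedVec, gapSum_castSucc, shiftedVec]; rfl

lemma measurable_shiftedVec {Ω : Type*} {b : ℕ → Ω → Plane × Plane} {p : ℕ} (n : Fin p → ℕ)
    {δ : Fin p → ℤ} (hδ : ∀ i, δ i = -1 ∨ δ i = 0 ∨ δ i = 1) {S : Set ℕ}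
    (hS : ∀ i ≤ ∑ j, n j, i ∈ S) : Measurable[blockSigma b S] (shiftedVec b n δ) := by
  refine @measurable_pi_lambda _ _ _ (blockSigma b S) _ _ fun i => ?_
  refine measurable_shiftedDiff ?_ fun j hj => hS j (hj.trans (gapSum_le_sum n i))
  rcases hδ i with h | h | h <;> omega

section upper

variable {Ω : Type*} [MeasurableSpace Ω] {P : Measure Ω} [IsProbabilityMeasure P]
  {b : ℕ → Ω → Plane × Plane} {μ : Measure Plane}

/-- One step of the upper bound: the last coordinate is integrated out, at the cost of the
factor `B`, or replaced by a supremum, at the cost of the factor `l`. -/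
lemma lintegral_snoc_le (hb : ∀ i, Measurable (b i)) (hind : iIndepFun b P)
    (hμ : ∀ i, P.map (fun ω => (b i ω).1 - (b i ω).2) = μ) {p K m : ℕ} {d : ℤ}
    (hd : d = -1 ∨ d = 0 ∨ d = 1) {U : Ω → Fin p → Plane}
    (hU : Measurable[blockSigma b (Set.Iic K)] U) {B l : ℝ≥0∞}
    (hstep : 3 ≤ m → ∀ (F : Plane → ℝ≥0∞) (c : ℝ≥0∞), Measurable F → (∀ x, F x ≤ c) →
      ∫⁻ x, F x ∂(convPow μ (m - 2)) ≤ B * (∫⁻ x, F x) + l * c)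
    (hl : m < 3 → 1 ≤ l) {F : (Fin (p + 1) → Plane) → ℝ≥0∞} (hF : Measurable F)
    {F₂ : (Fin p → Plane) → ℝ≥0∞} (hF₂ : Measurable F₂) (hle : ∀ x y, F (Fin.snoc x y) ≤ F₂ x) :
    ∫⁻ ω, F (Fin.snoc (U ω) (shiftedDiff b (K + m) d ω)) ∂P ≤
      B * (∫⁻ ω, (∫⁻ y, F (Fin.snoc (U ω) y)) ∂P) + l * ∫⁻ ω, F₂ (U ω) ∂P := by
  have hU' : Measurable U := hU.mono (blockSigma_le hb _) le_rfl
  -- A gap below 3 leaves no free block in the middle, so the last coordinate is replaced by its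
  -- supremum.
  rcases lt_or_ge m 3 with hm | hm
  · refine le_trans ?_ le_add_self
    calc _ ≤ ∫⁻ ω, F₂ (U ω) ∂P := lintegral_mono fun ω => hle _ _
      _ ≤ _ := le_mul_of_one_le_left' (hl hm)
  have hFs : Measurable fun q : (Fin p → Plane) × Plane => F (Fin.snoc q.1 q.2) :=
    hF.comp measurable_snoc
  set S : Set ℕ := Set.Iic K ∪ {K + m - 1, K + m} with hS
  set T : Set ℕ := Set.Ico (K + 1) (K + 1 + (m - 2)) with hT
  have hST : Disjoint S T := by
    rw [Set.disjoint_left]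
    rintro i hi ⟨h1, h2⟩
    simp only [hS, Set.mem_union, Set.mem_Iic, Set.mem_insert_iff, Set.mem_singleton_iff] at hi
    omega
  set V : Ω → Plane := fun ω => diffSum b 0 (K + 1) ω + endPart b (K + m) d ω with hV
  have hVm : Measurable[blockSigma b S] V := by
    have h1 : Measurable[blockSigma b S] (diffSum b 0 (K + 1)) :=
      measurable_diffSum fun i _ hi => Or.inl (Nat.lt_succ_iff.1 hi)
    have h2 : Measurable[blockSigma b S] (endPart b (K + m) d) :=
      measurable_endPart (Or.inr (by simp)) (Or.inr (by simp))
    exact h1.add h2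
  have hUV : Measurable[blockSigma b S] fun ω => (U ω, V ω) :=
    (hU.mono (blockSigma_mono Set.subset_union_left) le_rfl).prodMk hVm
  have hZ : Measurable[blockSigma b T] (diffSum b (K + 1) (K + 1 + (m - 2))) :=
    measurable_diffSum fun i h1 h2 => ⟨h1, h2⟩
  have hi := indepFun_of_blockSigma hb hind hST hUV hZ
  have key := lintegral_eq_of_indepFun (P := P)
    (F := fun (q : (Fin p → Plane) × Plane) z => F (Fin.snoc q.1 (q.2 + z)))
    (hUV.mono (blockSigma_le hb _) le_rfl) (hZ.mono (blockSigma_le hb _) le_rfl) hi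
    (hFs.comp (by fun_prop : Measurable fun r : ((Fin p → Plane) × Plane) × Plane =>
      (r.1.1, r.1.2 + r.2)))
  simp_rw [shiftedDiff_add_eq hd hm]
  rw [key, map_diffSum hb hind hμ]
  have hmeas1 : Measurable fun ω => ∫⁻ y, F (Fin.snoc (U ω) y) :=
    (Measurable.lintegral_prod_right' hFs).comp hU'
  -- With the other blocks frozen, the last coordinate is V plus an independent sum with law
  -- `convPow μ (m - 2)`. Translation invariance removes V from the integral over the plane.
  calc _ ≤ ∫⁻ ω, (B * (∫⁻ y, F (Fin.snoc (U ω) y)) + l * F₂ (U ω)) ∂P := by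
        refine lintegral_mono fun ω => ?_
        refine (hstep hm _ (F₂ (U ω)) (hFs.comp (by fun_prop :
          Measurable fun z => (U ω, V ω + z))) fun z => hle _ _).trans (le_of_eq ?_)
        congr 2
        exact lintegral_add_left_eq_self (μ := (volume : Measure Plane))
          (fun y => F (Fin.snoc (U ω) y)) (V ω)
    _ = _ := by
        rw [lintegral_add_left (hmeas1.const_mul B), lintegral_const_mul _ hmeas1,
          lintegral_const_mul (f := fun ω => F₂ (U ω)) _ (hF₂.comp hU')]

/-- The coordinates that are integrated. -/
def integrated {p : ℕ} (J : Fin p → Bool) : Finset (Fin p) := Finset.univ.filter (J · = false)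

lemma integrated_snoc_true {p : ℕ} (J : Fin p → Bool) :
    integrated (Fin.snoc J true : Fin (p + 1) → Bool) = (integrated J).image Fin.castSucc := by
  ext i
  refine Fin.lastCases ?_ (fun j => ?_) i
  · simp [integrated, Fin.castSucc_ne_last]
  · simp [integrated]

lemma integrated_snoc_false {p : ℕ} (J : Fin p → Bool) :
    integrated (Fin.snoc J false : Fin (p + 1) → Bool)
      = insert (Fin.last p) ((integrated J).image Fin.castSucc) := by
  ext i
  refine Fin.lastCases ?_ (fun j => ?_) i
  · simp [integrated]
  · simp [integrated, Fin.castSucc_ne_last]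

lemma lmarginal_castSucc {p : ℕ} (s : Finset (Fin p)) {f : (Fin p → Plane) → ℝ≥0∞}
    (hf : Measurable f) (x : Fin (p + 1) → Plane) :
    lmarginal (fun _ => volume) (s.image Fin.castSucc) (fun z => f (Fin.init z)) x
      = lmarginal (fun _ => volume) s f (Fin.init x) :=
  lmarginal_image (X := fun _ : Fin (p + 1) => Plane) (μ := fun _ => volume)
    (Fin.castSucc_injective p) s hf x

/-- The expectation of a function along a tuple with given gaps is bounded in terms of integrals of
functions that dominate its partial suprema. -/
theorem lintegral_shiftedVec_le (hb : ∀ i, Measurable (b i)) (hind : iIndepFun b P)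
    (hμ : ∀ i, P.map (fun ω => (b i ω).1 - (b i ω).2) = μ) {B l : ℕ → ℝ≥0∞}
    (hstep : ∀ m, 3 ≤ m → ∀ (F : Plane → ℝ≥0∞) (c : ℝ≥0∞), Measurable F → (∀ x, F x ≤ c) →
      ∫⁻ x, F x ∂(convPow μ (m - 2)) ≤ B m * (∫⁻ x, F x) + l m * c)
    (hl : ∀ m < 3, 1 ≤ l m) {p : ℕ} (n : Fin p → ℕ) {δ : Fin p → ℤ}
    (hδ : ∀ i, δ i = -1 ∨ δ i = 0 ∨ δ i = 1)
    {F : (Fin p → Plane) → ℝ≥0∞} (hF : Measurable F)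
    {H : (Fin p → Bool) → (Fin p → Plane) → ℝ≥0∞} (hH : ∀ J, Measurable (H J))
    (hFH : ∀ J x, F x ≤ H J x) (hdep : ∀ J, DependsOn (H J) {i | J i = false})
    {C : (Fin p → Bool) → ℝ≥0∞}
    (hC : ∀ J x, lmarginal (fun _ => volume) (integrated J) (H J) x ≤ C J) :
    ∫⁻ ω, F (shiftedVec b n δ ω) ∂P ≤
      ∑ J, (∏ i, if J i then l (n i) else B (n i)) * C J := by
  induction p with
  | zero =>
    have hJ := hC default default
    have e : integrated (default : Fin 0 → Bool) = ∅ := by ext i; exact i.elim0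
    rw [e, lmarginal_empty] at hJ
    simp only [Fintype.sum_unique, Finset.univ_eq_empty, Finset.prod_empty, one_mul]
    calc _ ≤ ∫⁻ _, C default ∂P := by
          refine lintegral_mono fun ω => ?_
          rw [Subsingleton.elim (shiftedVec b n δ ω) default]
          exact (hFH _ _).trans hJ
      _ = _ := by
        rw [lintegral_const, measure_univ, mul_one]
        exact congrArg C (Subsingleton.elim _ _)
  | succ p ih =>
    set F₁ : (Fin p → Plane) → ℝ≥0∞ := fun x => ∫⁻ y, F (Fin.snoc x y) with hF₁
    -- The induction hypothesis asks for one function below all majorants whose last flag is `true`,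
    -- hence the infimum over `J`. These majorants do not depend on the last coordinate, so the
    -- value 0 inserted there is arbitrary.
    set F₂ : (Fin p → Plane) → ℝ≥0∞ := fun x =>
      ⨅ J : Fin p → Bool, H (Fin.snoc J true) (Fin.snoc x 0) with hF₂
    have hsnoc0 : Measurable fun x : Fin p → Plane => (Fin.snoc x 0 : Fin (p + 1) → Plane) :=
      measurable_snoc.comp (measurable_id.prodMk measurable_const)
    have hF₁m : Measurable F₁ := Measurable.lintegral_prod_right' (hF.comp measurable_snoc)
    have hF₂m : Measurable F₂ := Measurable.iInf fun J => (hH _).comp hsnoc0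
    have htrue : ∀ (J : Fin p → Bool) x y y',
        H (Fin.snoc J true) (Fin.snoc x y) = H (Fin.snoc J true) (Fin.snoc x y') := by
      intro J x y y'
      refine hdep _ fun i hi => ?_
      revert hi
      refine Fin.lastCases ?_ (fun j => ?_) i
      · simp
      · simp
    have hle : ∀ x y, F (Fin.snoc x y) ≤ F₂ x := fun x y =>
      le_iInf fun J => (hFH _ _).trans (htrue J x y 0).le
    have h1 := ih (Fin.init n) (δ := Fin.init δ) (fun i => hδ _) hF₁m
      (H := fun J x => ∫⁻ y, H (Fin.snoc J false) (Fin.snoc x y))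
      (fun J => Measurable.lintegral_prod_right' ((hH _).comp measurable_snoc))
      (fun J x => lintegral_mono fun y => hFH _ _)
      (fun J x x' hx => by
        refine lintegral_congr fun y => hdep _ fun i hi => ?_
        revert hi
        refine Fin.lastCases ?_ (fun j => ?_) i
        · simp
        · intro hj
          simpa using hx j (by simpa using hj))
      (C := fun J => C (Fin.snoc J false))
      (fun J x => by
        refine le_trans (le_of_eq ?_) (hC (Fin.snoc J false) (Fin.snoc x 0))
        rw [integrated_snoc_false, lmarginal_insert' _ (hH _) (by simp [Fin.castSucc_ne_last])]
        have : (fun z : Fin (p + 1) → Plane => ∫⁻ y, H (Fin.snoc J false)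
            (Function.update z (Fin.last p) y)) = fun z => (fun x => ∫⁻ y, H (Fin.snoc J false)
            (Fin.snoc x y)) (Fin.init z) := by
          ext1 z
          refine lintegral_congr fun y => ?_
          rw [← Fin.snoc_init_self z, Fin.update_snoc_last, Fin.init_snoc]
        rw [this, lmarginal_castSucc (f := fun x => ∫⁻ y, H (Fin.snoc J false) (Fin.snoc x y)) _
          (Measurable.lintegral_prod_right' ((hH _).comp measurable_snoc)), Fin.init_snoc])
    have h2 := ih (Fin.init n) (δ := Fin.init δ) (fun i => hδ _) hF₂m
      (H := fun J x => H (Fin.snoc J true) (Fin.snoc x 0))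
      (fun J => (hH _).comp hsnoc0) (fun J x => iInf_le _ J)
      (fun J x x' hx => by
        refine hdep _ fun i hi => ?_
        revert hi
        refine Fin.lastCases ?_ (fun j => ?_) i
        · simp
        · intro hj
          simpa using hx j (by simpa using hj))
      (C := fun J => C (Fin.snoc J true))
      (fun J x => by
        refine le_trans (le_of_eq ?_) (hC (Fin.snoc J true) (Fin.snoc x 0))
        rw [integrated_snoc_true]
        have : H (Fin.snoc J true) = fun z => (fun x => H (Fin.snoc J true)
            (Fin.snoc x 0)) (Fin.init z) := by
          ext1 z
          conv_lhs => rw [← Fin.snoc_init_self z]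
          exact htrue _ _ _ _
        conv_rhs => rw [this]
        rw [lmarginal_castSucc (f := fun x => H (Fin.snoc J true) (Fin.snoc x 0)) _
          ((hH _).comp hsnoc0), Fin.init_snoc])
    have hmain := lintegral_snoc_le hb hind hμ (K := ∑ j, Fin.init n j) (hδ (Fin.last p))
      (measurable_shiftedVec (b := b) (Fin.init n) (δ := Fin.init δ) (fun i => hδ _)
        (S := Set.Iic _) fun i hi => hi) (hstep (n (Fin.last p))) (hl (n (Fin.last p))) hF hF₂m hle
    simp_rw [shiftedVec_succ]
    refine hmain.trans ?_
    refine (add_le_add (mul_le_mul_right h1 _) (mul_le_mul_right h2 _)).trans (le_of_eq ?_)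
    -- A choice for p + 1 coordinates is a choice for the last one (supremum or integral) together
    -- with one for the first p.
    rw [← (Fin.snocEquiv (fun _ : Fin (p + 1) => Bool)).sum_comp, Fintype.sum_prod_type]
    simp only [Fintype.sum_bool, Fin.snocEquiv, Equiv.coe_fn_mk, Fin.prod_univ_castSucc,
      Fin.snoc_castSucc, Fin.snoc_last, Finset.mul_sum, Fin.init]
    rw [add_comm]
    congr 1
    · refine Finset.sum_congr rfl fun J _ => ?_
      simp only [if_true]; ring
    · refine Finset.sum_congr rfl fun J _ => ?_
      simp only [Bool.false_eq_true, if_false]; ring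

end upper

section lower

variable {Ω : Type*}

/-- The indicator function of blocks of size at most `R`. -/
def smallBlock (R : ℝ) (x : Plane × Plane) : ℝ≥0∞ :=
  Set.indicator (Metric.closedBall 0 R) (fun _ => 1) x

lemma measurable_smallBlock (R : ℝ) : Measurable (smallBlock R) :=
  measurable_const.indicator measurableSet_closedBall

lemma smallBlock_le_one (R : ℝ) (x : Plane × Plane) : smallBlock R x ≤ 1 :=
  Set.indicator_le_self' (by simp) x

lemma norm_le_of_smallBlock_ne_zero {R : ℝ} {x : Plane × Plane} (h : smallBlock R x ≠ 0) :
    ‖x.1‖ ≤ R ∧ ‖x.2‖ ≤ R := by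
  have : x ∈ Metric.closedBall (0 : Plane × Plane) R := by
    by_contra hx
    exact h (Set.indicator_of_notMem hx _)
  rw [mem_closedBall_zero_iff, Prod.norm_def] at this
  exact ⟨(le_max_left _ _).trans this, (le_max_right _ _).trans this⟩

variable {b : ℕ → Ω → Plane × Plane}

lemma norm_endPart_le {R : ℝ} {k : ℕ} {d : ℤ} {ω : Ω} (h1 : smallBlock R (b (k - 1) ω) ≠ 0)
    (h2 : smallBlock R (b k ω) ≠ 0) : ‖endPart b k d ω‖ ≤ 3 * R := by
  obtain ⟨a1, a2⟩ := norm_le_of_smallBlock_ne_zero h1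
  obtain ⟨c1, c2⟩ := norm_le_of_smallBlock_ne_zero h2
  have hR : 0 ≤ R := (norm_nonneg _).trans a1
  have e1 := norm_sub_le (b (k - 1) ω).1 (b (k - 1) ω).2
  refine (norm_add_le _ _).trans ?_
  split_ifs
  · linarith
  · rw [norm_zero]; linarith
  · rw [norm_neg]; linarith

/-- The unshifted difference after k + 1 blocks differs from the shifted one at k by at most three
block components. This carries the localization from one index of the tuple to the next. -/
lemma norm_diffSum_le {R L : ℝ} {k : ℕ} (hk : 1 ≤ k) {d : ℤ} (hd : d = -1 ∨ d = 0 ∨ d = 1) {ω : Ω}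
    (h1 : smallBlock R (b (k - 1) ω) ≠ 0) (h2 : smallBlock R (b k ω) ≠ 0)
    (hL : ‖shiftedDiff b k d ω‖ ≤ L) : ‖diffSum b 0 (k + 1) ω‖ ≤ L + 3 * R := by
  obtain ⟨a1, a2⟩ := norm_le_of_smallBlock_ne_zero h1
  obtain ⟨c1, c2⟩ := norm_le_of_smallBlock_ne_zero h2
  have hR : 0 ≤ R := (norm_nonneg _).trans a1
  have e0 : diffSum b 0 (k + 1) ω = diffSum b 0 (k - 1) ω
      + ((b (k - 1) ω).1 - (b (k - 1) ω).2) + ((b k ω).1 - (b k ω).2) := by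
    obtain ⟨j, rfl⟩ : ∃ j, k = j + 1 := ⟨k - 1, by omega⟩
    simp only [diffSum, add_tsub_cancel_right]
    rw [Finset.sum_Ico_succ_top (by omega), Finset.sum_Ico_succ_top (by omega)]
  have e1 : diffSum b 0 (k + 1) ω = shiftedDiff b k d ω +
      (((b k ω).1 - (b k ω).2) -
        if d = 1 then (b k ω).1 else if d = 0 then 0 else -(b (k - 1) ω).1) := by
    rw [shiftedDiff_eq hd hk, e0, endPart]; abel
  rw [e1]
  have e2 := norm_sub_le (b k ω).1 (b k ω).2
  refine (norm_add_le _ _).trans (add_le_add hL ?_)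
  refine (norm_sub_le _ _).trans ?_
  split_ifs
  · linarith
  · rw [norm_zero]; linarith
  · rw [norm_neg]; linarith

variable [MeasurableSpace Ω] {P : Measure Ω} [IsProbabilityMeasure P] {μ : Measure Plane}

/-- A lower bound for the expectation of a compactly supported function along a tuple with given
gaps, on the event that the blocks next to the tuple are small. -/
theorem exists_weight_le_lintegral_shiftedVec (hb : ∀ i, Measurable (b i)) (hind : iIndepFun b P)
    (hμ : ∀ i, P.map (fun ω => (b i ω).1 - (b i ω).2) = μ) {R L : ℝ} (hR : 0 ≤ R) (hL : 0 ≤ L)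
    {π : ℝ≥0∞} (hπ : ∀ i, ∫⁻ ω, smallBlock R (b i ω) ∂P = π) {β : ℕ → ℝ≥0∞}
    (hβ : ∀ m, β m ≠ ∞)
    (hstep : ∀ m, 3 ≤ m → ∀ F : Plane → ℝ≥0∞, Measurable F →
      (∀ x, 2 * L + 6 * R < ‖x‖ → F x = 0) → β m * ∫⁻ x, F x ≤ ∫⁻ x, F x ∂(convPow μ (m - 2)))
    {p : ℕ} (n : Fin p → ℕ) (hn : ∀ i, 3 ≤ n i) {δ : Fin p → ℤ}
    (hδ : ∀ i, δ i = -1 ∨ δ i = 0 ∨ δ i = 1) :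
    ∃ g : Ω → ℝ≥0∞, Measurable[blockSigma b (Set.Iic (∑ i, n i))] g ∧ (∀ ω, g ω ≤ 1) ∧
      (∀ ω, g ω ≠ 0 → (∀ i, ‖shiftedVec b n δ ω i‖ ≤ L) →
        ‖diffSum b 0 (∑ i, n i + 1) ω‖ ≤ L + 3 * R) ∧
      ∀ F : (Fin p → Plane) → ℝ≥0∞, Measurable F → (∀ x i, L < ‖x i‖ → F x = 0) →
        (∏ i, β (n i)) * π ^ (2 * p + 1) * ∫⁻ x, F x ≤
          ∫⁻ ω, g ω * F (shiftedVec b n δ ω) ∂P := by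
  induction p with
  | zero =>
    -- The weight is a product of indicators of small blocks: block 0 here and two more for each
    -- index of the tuple. This accounts for the exponent 2p + 1 of π.
    refine ⟨fun ω => smallBlock R (b 0 ω), ?_, fun ω => smallBlock_le_one _ _, fun ω hω _ => ?_,
      fun F hF _ => ?_⟩
    · exact (measurable_smallBlock R).comp (measurable_block (by simp))
    · obtain ⟨a1, a2⟩ := norm_le_of_smallBlock_ne_zero hω
      simp only [Finset.univ_eq_empty, Finset.sum_empty, zero_add, diffSum, Nat.Ico_zero_eq_range,
        Finset.range_one, Finset.sum_singleton]
      refine (norm_sub_le _ _).trans ?_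
      linarith
    · have : ∀ ω, F (shiftedVec b n δ ω) = F default := fun ω =>
        congrArg F (Subsingleton.elim _ _)
      simp_rw [this]
      rw [lintegral_mul_const (f := fun ω => smallBlock R (b 0 ω)) _
        ((measurable_smallBlock R).comp (hb 0)), hπ]
      have h2 : ∫⁻ x : Fin 0 → Plane, F x = F default := by
        rw [lintegral_unique]
        have : (volume : Measure (Fin 0 → Plane)) Set.univ = 1 := by
          rw [volume_pi, Measure.pi_univ]; simp
        rw [this, mul_one]
        exact congrArg F (Subsingleton.elim _ _)
      rw [h2]; simp
  | succ p ih =>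
    obtain ⟨g, hgm, hg1, hgd, hgF⟩ := ih (Fin.init n) (fun i => hn _) (δ := Fin.init δ)
      (fun i => hδ _)
    set K := ∑ i, Fin.init n i with hK
    set m := n (Fin.last p) with hm
    set d := δ (Fin.last p) with hd
    have hm3 : 3 ≤ m := hn _
    have hKm : ∑ i, n i = K + m := by rw [Fin.sum_univ_castSucc]; rfl
    have hdd := hδ (Fin.last p)
    set e : Ω → ℝ≥0∞ := fun ω => smallBlock R (b (K + m - 1) ω) * smallBlock R (b (K + m) ω) with he
    set U := shiftedVec b (Fin.init n) (Fin.init δ) with hUdef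
    rw [hKm]
    have hem : Measurable[blockSigma b {K + m - 1, K + m}] e := by
      have a1 : Measurable[blockSigma b {K + m - 1, K + m}] fun ω =>
          smallBlock R (b (K + m - 1) ω) :=
        (measurable_smallBlock R).comp (measurable_block (by simp))
      have a2 : Measurable[blockSigma b {K + m - 1, K + m}] fun ω =>
          smallBlock R (b (K + m) ω) :=
        (measurable_smallBlock R).comp (measurable_block (by simp))
      exact a1.mul a2
    have heint : ∫⁻ ω, e ω ∂P = π ^ 2 := by
      have a1 : Measurable[blockSigma b {K + m - 1}] fun ω => smallBlock R (b (K + m - 1) ω) :=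
        (measurable_smallBlock R).comp (measurable_block (by simp))
      have a2 : Measurable[blockSigma b {K + m}] fun ω => smallBlock R (b (K + m) ω) :=
        (measurable_smallBlock R).comp (measurable_block (by simp))
      have hdis : Disjoint ({K + m - 1} : Set ℕ) {K + m} := by
        rw [Set.disjoint_singleton]; omega
      have := lintegral_mul_eq_lintegral_mul_lintegral_of_indepFun
        (a1.mono (blockSigma_le hb _) le_rfl) (a2.mono (blockSigma_le hb _) le_rfl)
        (indepFun_of_blockSigma hb hind hdis a1 a2)
      simp only [Pi.mul_apply] at this
      rw [he, this, hπ, hπ, sq]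
    set S : Set ℕ := Set.Iic K ∪ {K + m - 1, K + m} with hS
    set T : Set ℕ := Set.Ico (K + 1) (K + 1 + (m - 2)) with hT
    have hST : Disjoint S T := by
      rw [Set.disjoint_left]
      rintro i hi ⟨h1, h2⟩
      simp only [hS, Set.mem_union, Set.mem_Iic, Set.mem_insert_iff, Set.mem_singleton_iff] at hi
      omega
    set V : Ω → Plane := fun ω => diffSum b 0 (K + 1) ω + endPart b (K + m) d ω with hV
    have hVm : Measurable[blockSigma b S] V := by
      have h1 : Measurable[blockSigma b S] (diffSum b 0 (K + 1)) :=
        measurable_diffSum fun i _ hi => Or.inl (Nat.lt_succ_iff.1 hi)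
      have h2 : Measurable[blockSigma b S] (endPart b (K + m) d) :=
        measurable_endPart (Or.inr (by simp)) (Or.inr (by simp))
      exact h1.add h2
    have hUm : Measurable[blockSigma b (Set.Iic K)] U :=
      measurable_shiftedVec (b := b) (Fin.init n) (δ := Fin.init δ) (fun i => hδ _)
        (S := Set.Iic _) fun i hi => hi
    have hU' : Measurable U := hUm.mono (blockSigma_le hb _) le_rfl
    have hg' : Measurable g := hgm.mono (blockSigma_le hb _) le_rfl
    have he' : Measurable e := hem.mono (blockSigma_le hb _) le_rfl
    have hgS : Measurable[blockSigma b S] g :=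
      hgm.mono (blockSigma_mono Set.subset_union_left) le_rfl
    have heS : Measurable[blockSigma b S] e :=
      hem.mono (blockSigma_mono Set.subset_union_right) le_rfl
    have hge : Measurable[blockSigma b S] fun ω => g ω * e ω := hgS.mul heS
    refine ⟨fun ω => g ω * e ω, hge.mono (blockSigma_mono ?_) le_rfl, fun ω => ?_,
      fun ω hω hx => ?_, fun F hF hFL => ?_⟩
    · rintro i (hi | hi | hi)
      · exact Set.mem_Iic.2 (le_trans (Set.mem_Iic.1 hi) (by omega))
      · rw [hi]; exact Nat.sub_le _ _
      · rw [Set.mem_singleton_iff.1 hi]; exact Set.mem_Iic.2 le_rfl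
    · exact mul_le_one' (hg1 ω) (mul_le_one' (smallBlock_le_one _ _) (smallBlock_le_one _ _))
    · have h2 := right_ne_zero_of_mul hω
      refine norm_diffSum_le (by omega) hdd (left_ne_zero_of_mul h2) (right_ne_zero_of_mul h2) ?_
      have := hx (Fin.last p)
      rwa [shiftedVec_succ, Fin.snoc_last] at this
    · have hFs : Measurable fun q : (Fin p → Plane) × Plane => F (Fin.snoc q.1 q.2) :=
        hF.comp measurable_snoc
      have hUV : Measurable[blockSigma b S] fun ω => ((U ω, V ω), g ω * e ω) :=
        ((hUm.mono (blockSigma_mono Set.subset_union_left) le_rfl).prodMk hVm).prodMk hge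
      have hZ : Measurable[blockSigma b T] (diffSum b (K + 1) (K + 1 + (m - 2))) :=
        measurable_diffSum fun i h1 h2 => ⟨h1, h2⟩
      have hi := indepFun_of_blockSigma hb hind hST hUV hZ
      have key := lintegral_eq_of_indepFun (P := P)
        (F := fun (q : ((Fin p → Plane) × Plane) × ℝ≥0∞) z => q.2 * F (Fin.snoc q.1.1 (q.1.2 + z)))
        (hUV.mono (blockSigma_le hb _) le_rfl) (hZ.mono (blockSigma_le hb _) le_rfl) hi
        ((by fun_prop : Measurable fun r : (((Fin p → Plane) × Plane) × ℝ≥0∞) × Plane =>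
          r.1.2).mul (hFs.comp (by fun_prop : Measurable fun r :
          (((Fin p → Plane) × Plane) × ℝ≥0∞) × Plane => (r.1.1.1, r.1.1.2 + r.2))))
      set F₁ : (Fin p → Plane) → ℝ≥0∞ := fun x => ∫⁻ y, F (Fin.snoc x y) with hF₁
      have hF₁m : Measurable F₁ := Measurable.lintegral_prod_right' hFs
      have hF₁L : ∀ x i, L < ‖x i‖ → F₁ x = 0 := by
        intro x i hx
        have : ∀ y, F (Fin.snoc x y) = 0 := fun y =>
          hFL _ i.castSucc (by rwa [Fin.snoc_castSucc])
        simp [hF₁, this]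
      have hF₁int : ∫⁻ x, F x = ∫⁻ x, F₁ x := by
        have hmp := (volume_preserving_piFinSuccAbove (fun _ : Fin (p + 1) => Plane)
          (Fin.last p)).symm
        rw [← hmp.lintegral_comp hF, Measure.volume_eq_prod, lintegral_prod_symm _ (by
          exact (hF.comp hmp.measurable).aemeasurable)]
        refine lintegral_congr fun x => lintegral_congr fun y => ?_
        simp only [MeasurableEquiv.piFinSuccAbove]
        congr 1
        simp [Fin.insertNthEquiv]
      have hvec : ∀ ω, shiftedVec b n δ ω = Fin.snoc (U ω)
          (V ω + diffSum b (K + 1) (K + 1 + (m - 2)) ω) := fun ω => by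
        rw [shiftedVec_succ, ← shiftedDiff_add_eq hdd hm3]
      simp_rw [hvec]
      rw [key, map_diffSum hb hind hμ]
      have hsplit : ∫⁻ ω, g ω * F₁ (U ω) * e ω ∂P = (∫⁻ ω, g ω * F₁ (U ω) ∂P) * π ^ 2 := by
        have hf1 : Measurable[blockSigma b (Set.Iic K)] fun ω => g ω * F₁ (U ω) :=
          hgm.mul (hF₁m.comp hUm)
        have hdis : Disjoint (Set.Iic K) {K + m - 1, K + m} := by
          rw [Set.disjoint_left]
          rintro i hi hi'
          simp only [Set.mem_Iic, Set.mem_insert_iff, Set.mem_singleton_iff] at hi hi'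
          omega
        have := lintegral_mul_eq_lintegral_mul_lintegral_of_indepFun
          (hf1.mono (blockSigma_le hb _) le_rfl) he' (indepFun_of_blockSigma hb hind hdis hf1 hem)
        simp only [Pi.mul_apply] at this
        rw [this, heint]
      calc (∏ i, β (n i)) * π ^ (2 * (p + 1) + 1) * ∫⁻ x, F x
          = β m * (((∏ i, β (Fin.init n i)) * π ^ (2 * p + 1) * ∫⁻ x, F₁ x) * π ^ 2) := by
            rw [Fin.prod_univ_castSucc, hF₁int]
            simp only [Fin.init, hm]
            ring
        _ ≤ β m * ((∫⁻ ω, g ω * F₁ (U ω) ∂P) * π ^ 2) := by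
            gcongr
            exact hgF F₁ hF₁m hF₁L
        _ = ∫⁻ ω, β m * (g ω * F₁ (U ω) * e ω) ∂P := by
            rw [← hsplit, lintegral_const_mul' _ _ (hβ m)]
        _ ≤ _ := by
            refine lintegral_mono fun ω => ?_
            simp only
            rw [lintegral_const_mul (f := fun z => F (Fin.snoc (U ω) (V ω + z))) _ (hFs.comp (by fun_prop : Measurable fun z =>
              (U ω, V ω + z)))]
            have : β m * (g ω * F₁ (U ω) * e ω) = g ω * e ω * (β m * F₁ (U ω)) := by ring
            rw [this]
            -- Where the weight vanishes there is nothing to prove. Elsewhere, if the earlier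
            -- coordinates are at most L, then |V| ≤ (L + 3R) + 3R. Hence F(U, V + z) ≠ 0 forces |z|
            -- ≤ 2L + 6R, the radius in `hstep`.
            by_cases hω : g ω * e ω = 0
            · rw [hω, zero_mul, zero_mul]
            gcongr
            have hgω := left_ne_zero_of_mul hω
            have heω := right_ne_zero_of_mul hω
            by_cases hUL : ∀ i, ‖U ω i‖ ≤ L
            · have hs := hgd ω hgω hUL
              have hend := norm_endPart_le (d := d) (left_ne_zero_of_mul heω)
                (right_ne_zero_of_mul heω)
              have hVn : ‖V ω‖ ≤ L + 6 * R := (norm_add_le _ _).trans (by linarith)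
              refine le_trans (le_of_eq ?_) (hstep m hm3 (fun z => F (Fin.snoc (U ω) (V ω + z)))
                (hFs.comp (by fun_prop : Measurable fun z => (U ω, V ω + z))) fun z hz => ?_)
              · congr 1
                exact (lintegral_add_left_eq_self (μ := (volume : Measure Plane))
                  (fun y => F (Fin.snoc (U ω) y)) (V ω)).symm
              · refine hFL _ (Fin.last p) ?_
                rw [Fin.snoc_last]
                have := norm_sub_le (V ω + z) (V ω)
                rw [add_sub_cancel_left] at this
                linarith
            · push Not at hUL
              obtain ⟨i, hi⟩ := hUL
              rw [hF₁L _ i hi, mul_zero]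
              exact bot_le

end lower

end KR

end


/-! ### Summation over the gaps. -/

noncomputable section

namespace KR

open scoped ENNReal

section combinatorics

lemma gapSum_injective {p : ℕ} : Function.Injective (gapSum : (Fin p → ℕ) → Fin p → ℕ) := by
  induction p with
  | zero => exact fun _ _ _ => Subsingleton.elim _ _
  | succ p ih =>
    intro n n' h
    have h1 : Fin.init n = Fin.init n' := by
      apply ih
      ext1 i
      rw [← gapSum_castSucc, ← gapSum_castSucc, h]
    have h2 := congrFun h (Fin.last p)
    rw [gapSum_last, gapSum_last, h1] at h2
    rw [← Fin.snoc_init_self n, ← Fin.snoc_init_self n', h1]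
    congr 1
    omega

lemma gapSum_strictMono {p : ℕ} {n : Fin p → ℕ} (hn : ∀ i, 1 ≤ n i) : StrictMono (gapSum n) := by
  intro i j hij
  refine Finset.sum_lt_sum (fun l _ => ?_) ⟨j, Finset.mem_univ _, ?_⟩
  · by_cases h : l ≤ i
    · rw [if_pos h, if_pos (h.trans hij.le)]
    · rw [if_neg h]; exact Nat.zero_le _
  · rw [if_neg (not_le.2 hij), if_pos le_rfl]; exact hn j

lemma le_gapSum {p : ℕ} (n : Fin p → ℕ) (i : Fin p) : n i ≤ gapSum n i := by
  have := Finset.single_le_sum (f := fun j => if j ≤ i then n j else 0)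
    (fun j _ => Nat.zero_le _) (Finset.mem_univ i)
  simpa [gapSum] using this

lemma mem_increasingTuples {p N : ℕ} {k : Fin p → ℕ} :
    k ∈ increasingTuples p N ↔ (∀ i, 1 ≤ k i ∧ k i ≤ N) ∧ StrictMono k := by
  simp [increasingTuples, Fintype.mem_piFinset]

lemma exists_gapSum_eq {p : ℕ} {k : Fin p → ℕ} (hk1 : ∀ i, 1 ≤ k i) (hk : StrictMono k) :
    ∃ n : Fin p → ℕ, (∀ i, 1 ≤ n i) ∧ gapSum n = k := by
  induction p with
  | zero => exact ⟨k, fun i => i.elim0, Subsingleton.elim _ _⟩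
  | succ p ih =>
    obtain ⟨n, hn, hnk⟩ := ih (k := Fin.init k) (fun i => hk1 _)
      (fun i j hij => hk (Fin.castSucc_lt_castSucc_iff.2 hij))
    have hlt : ∑ i, n i < k (Fin.last p) := by
      rcases Nat.eq_zero_or_pos p with rfl | hp
      · rw [Finset.univ_eq_empty, Finset.sum_empty]; exact hk1 _
      · obtain ⟨q, rfl⟩ : ∃ q, p = q + 1 := ⟨p - 1, by omega⟩
        have h1 : gapSum n (Fin.last q) = ∑ i, n i := by simp [gapSum, Fin.le_last]
        rw [← h1, hnk]
        exact hk (Fin.castSucc_lt_last _)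
    refine ⟨Fin.snoc n (k (Fin.last p) - ∑ i, n i), fun i => ?_, ?_⟩
    · refine Fin.lastCases ?_ (fun j => ?_) i
      · rw [Fin.snoc_last]; omega
      · rw [Fin.snoc_castSucc]; exact hn j
    · ext1 i
      refine Fin.lastCases ?_ (fun j => ?_) i
      · rw [gapSum_last, Fin.snoc_last, Fin.init_snoc]; omega
      · rw [gapSum_castSucc, Fin.init_snoc, hnk]; rfl

/-- Each index is at most N, hence so is each gap. Dropping the constraint on the sum of the gaps
makes the sum factorize. -/
lemma sum_increasingTuples_le {p N : ℕ} (f : (Fin p → ℕ) → ℝ≥0∞) :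
    ∑ k ∈ increasingTuples p N, f k
      ≤ ∑ n ∈ Fintype.piFinset fun _ : Fin p => Finset.Icc 1 N, f (gapSum n) := by
  classical
  rw [← Finset.sum_image (f := f) (g := gapSum) (gapSum_injective.injOn)]
  refine Finset.sum_le_sum_of_subset fun k hk => ?_
  obtain ⟨h1, h2⟩ := mem_increasingTuples.1 hk
  obtain ⟨n, hn, rfl⟩ := exists_gapSum_eq (fun i => (h1 i).1) h2
  refine Finset.mem_image.2 ⟨n, Fintype.mem_piFinset.2 fun i => Finset.mem_Icc.2 ⟨hn i, ?_⟩, rfl⟩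
  exact (le_gapSum n i).trans (h1 i).2

/-- Gaps of size at most N/(p+1) add up to at most N, so a full box of gaps yields admissible
tuples. Gaps start at 3, where the local limit bounds become available. -/
lemma le_sum_increasingTuples {p N : ℕ} (f : (Fin p → ℕ) → ℝ≥0∞) :
    ∑ n ∈ Fintype.piFinset fun _ : Fin p => Finset.Icc 3 (N / (p + 1)), f (gapSum n)
      ≤ ∑ k ∈ increasingTuples p N, f k := by
  classical
  rw [← Finset.sum_image (f := f) (g := gapSum) (gapSum_injective.injOn)]
  refine Finset.sum_le_sum_of_subset fun k hk => ?_
  obtain ⟨n, hn, rfl⟩ := Finset.mem_image.1 hk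
  have hn' := fun i => Finset.mem_Icc.1 (Fintype.mem_piFinset.1 hn i)
  refine mem_increasingTuples.2 ⟨fun i => ⟨?_, ?_⟩, gapSum_strictMono fun i => by
    have := (hn' i).1; omega⟩
  · have := (hn' i).1
    have := le_gapSum n i
    omega
  · calc gapSum n i ≤ ∑ j, n j := gapSum_le_sum n i
      _ ≤ ∑ _j : Fin p, N / (p + 1) := Finset.sum_le_sum fun j _ => (hn' j).2
      _ = p * (N / (p + 1)) := by simp
      _ ≤ (p + 1) * (N / (p + 1)) := Nat.mul_le_mul_right _ (Nat.le_succ p)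
      _ ≤ N := Nat.mul_div_le _ _

lemma sum_Icc_ite_eq {α : Type*} [CommSemiring α] (c : α) (h : ℕ → α) (N : ℕ) :
    ∑ m ∈ Finset.Icc 1 (N + 2), (if m < 3 then c else h (m - 2))
      = 2 * c + ∑ j ∈ Finset.Icc 1 N, h j := by
  induction N with
  | zero =>
    have : Finset.Icc 1 (0 + 2) = {1, 2} := rfl
    rw [this]; simp [two_mul]
  | succ N ih =>
    rw [show N + 1 + 2 = (N + 2) + 1 from rfl, Finset.sum_Icc_succ_top (by omega), ih,
      Finset.sum_Icc_succ_top (by omega), if_neg (by omega), add_assoc]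
    congr 1

lemma sum_Icc_ite_le (c : ℝ≥0∞) (h : ℕ → ℝ≥0∞) (N : ℕ) :
    ∑ m ∈ Finset.Icc 1 N, (if m < 3 then c else h (m - 2))
      ≤ 2 * c + ∑ j ∈ Finset.Icc 1 N, h j := by
  rw [← sum_Icc_ite_eq]
  exact Finset.sum_le_sum_of_subset (Finset.Icc_subset_Icc_right (by omega))

end combinatorics

lemma sum_one_div_le (N : ℕ) : ∑ j ∈ Finset.Icc 1 N, (1 : ℝ) / j ≤ 1 + Real.log N := by
  have := harmonic_le_one_add_log N
  rw [harmonic_eq_sum_Icc] at this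
  push_cast at this
  simpa [one_div] using this

lemma log_add_one_le_sum (N : ℕ) : Real.log (N + 1) ≤ ∑ j ∈ Finset.Icc 1 N, (1 : ℝ) / j := by
  have := log_add_one_le_harmonic N
  rw [harmonic_eq_sum_Icc] at this
  push_cast at this
  simpa [one_div] using this

/-- The expected sum of `G` over increasing tuples, as an extended nonnegative number. -/
def tupleExpectation {Ω : Type*} [MeasurableSpace Ω] (P : Measure Ω) (b : ℕ → Ω → Plane × Plane)
    {p : ℕ} (G : (Fin p → Plane) → ℝ) (δ : Fin p → ℤ) (N : ℕ) : ℝ≥0∞ :=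
  ∑ k ∈ increasingTuples p N,
    ∫⁻ ω, ENNReal.ofReal (G fun i => shiftedDiff b (k i) (δ i) ω) ∂P

section fixed

variable {Ω : Type*} [MeasurableSpace Ω] {P : Measure Ω} [IsProbabilityMeasure P]
  {b : ℕ → Ω → Plane × Plane} {μ : Measure Plane} {γ τ s₀ : ℝ}

/-- The bound for the sum over one gap. -/
def gapBound (γ τ s₀ x : ℝ) : ℝ :=
  γ / (4 * Real.pi * (1 - τ)) * (1 + x) + ∑' n, lltError γ τ s₀ 0 n

lemma gapBound_nonneg (hγ : γ ∈ Set.Ioo (0 : ℝ) 1) (hτ : τ ∈ Set.Ioo (0 : ℝ) 1) {x : ℝ}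
    (hx : 0 ≤ x) : 0 ≤ gapBound γ τ s₀ x := by
  have h1 : 0 < 1 - τ := by linarith [hτ.2]
  have h2 := hγ.1
  have : 0 ≤ ∑' n, lltError γ τ s₀ 0 n := tsum_nonneg fun n => lltError_nonneg hγ hτ n
  have h3 := Real.pi_pos
  unfold gapBound; positivity

/-- After summation over the gaps, an integrated coordinate contributes `gapBound`, linear in the
bound x for log N. A coordinate replaced by its supremum contributes at most 2 + 1/γ: the two gaps
below 3, plus a geometric series. -/
theorem tupleExpectation_le (hγ : γ ∈ Set.Ioo (0 : ℝ) 1) (hτ : τ ∈ Set.Ioo (0 : ℝ) 1)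
    (hs₀ : 0 < s₀) (hb : ∀ i, Measurable (b i)) (hind : iIndepFun b P)
    (hμ : ∀ i, P.map (fun ω => (b i ω).1 - (b i ω).2) = μ) (hstep : IsStepLaw γ τ s₀ μ)
    {p : ℕ} {δ : Fin p → ℤ} (hδ : ∀ i, δ i = -1 ∨ δ i = 0 ∨ δ i = 1)
    {G : (Fin p → Plane) → ℝ} (hG : Measurable G) {C : (Fin p → Bool) → ℝ} (hC0 : ∀ J, 0 ≤ C J)
    (hC : ∀ J, ∃ H : (Fin p → Plane) → ℝ≥0∞, Measurable H ∧ (∀ x, ENNReal.ofReal (G x) ≤ H x) ∧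
      DependsOn H {i | J i = false} ∧
      ∀ x, lmarginal (fun _ => volume) (integrated J) H x ≤ ENNReal.ofReal (C J))
    {N : ℕ} {x : ℝ} (hx0 : 0 ≤ x) (hx : Real.log N ≤ x) :
    tupleExpectation P b G δ N ≤ ENNReal.ofReal (∑ J : Fin p → Bool,
      (∏ i, if J i then 2 + γ⁻¹ else gapBound γ τ s₀ x) * C J) := by
  choose H hHm hGH hdep hHC using hC
  have h1γ : 0 < 1 - γ := by linarith [hγ.2]
  have h1τ : 0 < 1 - τ := by linarith [hτ.2]
  have hγ0 := hγ.1
  have hpi := Real.pi_pos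
  have herr := fun n => lltError_nonneg (s₀ := s₀) (R := 0) hγ hτ n
  set h : ℕ → ℝ := fun j => γ / (4 * Real.pi * j * (1 - τ)) + lltError γ τ s₀ 0 j with hh
  have hh0 : ∀ j, 0 ≤ h j := fun j => add_nonneg (by positivity) (herr j)
  -- A gap m uses m - 2 free blocks; for m < 3 all the weight goes to the supremum.
  set B : ℕ → ℝ≥0∞ := fun m => if m < 3 then 0 else ENNReal.ofReal (h (m - 2)) with hB
  set l : ℕ → ℝ≥0∞ := fun m => if m < 3 then 1 else ENNReal.ofReal ((1 - γ) ^ (m - 2)) with hl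
  have hBsum : ∑ m ∈ Finset.Icc 1 N, B m ≤ ENNReal.ofReal (gapBound γ τ s₀ x) := by
    refine (sum_Icc_ite_le 0 (fun j => ENNReal.ofReal (h j)) N).trans ?_
    rw [mul_zero, zero_add, ← ENNReal.ofReal_sum_of_nonneg fun j _ => hh0 j]
    refine ENNReal.ofReal_le_ofReal ?_
    rw [hh, Finset.sum_add_distrib]
    refine add_le_add ?_ ((summable_lltError hγ hτ hs₀).sum_le_tsum _ fun n _ => herr n)
    have : ∀ j : ℕ, γ / (4 * Real.pi * j * (1 - τ)) = γ / (4 * Real.pi * (1 - τ)) * (1 / j) := by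
      intro j
      rw [div_mul_div_comm, mul_one]; congr 1; ring
    simp_rw [this]
    rw [← Finset.mul_sum]
    have := sum_one_div_le N
    gcongr
    linarith
  have hlsum : ∑ m ∈ Finset.Icc 1 N, l m ≤ ENNReal.ofReal (2 + γ⁻¹) := by
    refine (sum_Icc_ite_le 1 (fun j => ENNReal.ofReal ((1 - γ) ^ j)) N).trans ?_
    rw [mul_one, ← ENNReal.ofReal_sum_of_nonneg fun j _ => by positivity,
      ENNReal.ofReal_add (by norm_num) (by positivity)]
    refine add_le_add (by norm_num) (ENNReal.ofReal_le_ofReal ?_)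
    have e := tsum_geometric_of_lt_one h1γ.le (by linarith : 1 - γ < 1)
    rw [sub_sub_cancel] at e
    rw [← e]
    exact (summable_geometric_of_lt_one h1γ.le (by linarith)).sum_le_tsum _
      fun n _ => by positivity
  have hsingle : ∀ n : Fin p → ℕ, ∫⁻ ω, ENNReal.ofReal (G (shiftedVec b n δ ω)) ∂P ≤
      ∑ J : Fin p → Bool, (∏ i, if J i then l (n i) else B (n i)) * ENNReal.ofReal (C J) := by
    intro n
    refine lintegral_shiftedVec_le (F := fun x => ENNReal.ofReal (G x)) hb hind hμ
      (fun m hm F c hF hc => ?_) (fun m hm => ?_) n hδ hG.ennreal_ofReal hHm hGH hdep hHC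
    -- The upper local limit bound holds at every point of the plane, so the localization radius can
    -- be taken to be 0.
    · have := hstep.lintegral_convPow_le hγ hτ (n := m - 2) (by omega) 0 hF hc
      simp only [hB, hl, if_neg (not_lt.2 hm)]
      exact this
    · simp only [hl, if_pos hm]; exact le_rfl
  calc tupleExpectation P b G δ N
      ≤ ∑ n ∈ Fintype.piFinset fun _ : Fin p => Finset.Icc 1 N,
          ∫⁻ ω, ENNReal.ofReal (G (shiftedVec b n δ ω)) ∂P :=
        sum_increasingTuples_le fun k =>
          ∫⁻ ω, ENNReal.ofReal (G fun i => shiftedDiff b (k i) (δ i) ω) ∂P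
    _ ≤ ∑ n ∈ Fintype.piFinset fun _ : Fin p => Finset.Icc 1 N, ∑ J : Fin p → Bool,
          (∏ i, if J i then l (n i) else B (n i)) * ENNReal.ofReal (C J) :=
        Finset.sum_le_sum fun n _ => hsingle n
    _ = ∑ J : Fin p → Bool, (∏ i, ∑ m ∈ Finset.Icc 1 N, if J i then l m else B m) *
          ENNReal.ofReal (C J) := by
        rw [Finset.sum_comm]
        refine Finset.sum_congr rfl fun J _ => ?_
        rw [← Finset.sum_mul, Finset.prod_univ_sum]
    _ ≤ ∑ J : Fin p → Bool, (∏ i, ENNReal.ofReal (if J i then 2 + γ⁻¹ else gapBound γ τ s₀ x)) *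
          ENNReal.ofReal (C J) := by
        gcongr with J _ i _
        split_ifs
        · exact hlsum
        · exact hBsum
    _ = _ := by
        have hpos : ∀ (J : Fin p → Bool) i,
            0 ≤ if J i then 2 + γ⁻¹ else gapBound γ τ s₀ x := by
          intro J i
          split_ifs
          · positivity
          · exact gapBound_nonneg hγ hτ hx0
        rw [ENNReal.ofReal_sum_of_nonneg fun J _ =>
          mul_nonneg (Finset.prod_nonneg fun i _ => hpos J i) (hC0 J)]
        refine Finset.sum_congr rfl fun J _ => ?_
        rw [ENNReal.ofReal_mul (Finset.prod_nonneg fun i _ => hpos J i),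
          ENNReal.ofReal_prod_of_nonneg fun i _ => hpos J i]

/-- The function is cut off to the coordinates of norm at most L, and the tuple is restricted to a
box of gaps. The sum over each gap is then a harmonic sum minus the total local limit error at
radius 2L + 6R. -/
theorem le_tupleExpectation (hγ : γ ∈ Set.Ioo (0 : ℝ) 1) (hτ : τ ∈ Set.Ioo (0 : ℝ) 1)
    (hs₀ : 0 < s₀) (hb : ∀ i, Measurable (b i)) (hind : iIndepFun b P)
    (hμ : ∀ i, P.map (fun ω => (b i ω).1 - (b i ω).2) = μ) (hstep : IsStepLaw γ τ s₀ μ)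
    {R L : ℝ} (hR : 0 ≤ R) (hL : 0 ≤ L) {π' : ℝ≥0∞}
    (hπ' : ∀ i, ∫⁻ ω, smallBlock R (b i ω) ∂P = π') {π : ℝ} (hπ0 : 0 ≤ π)
    (hπ : ENNReal.ofReal π ≤ π') {p : ℕ} {δ : Fin p → ℤ}
    (hδ : ∀ i, δ i = -1 ∨ δ i = 0 ∨ δ i = 1)
    {G : (Fin p → Plane) → ℝ} (hG : Measurable G) {A' : ℝ}
    (hA' : ENNReal.ofReal A' ≤ ∫⁻ x in {x | ∀ i, ‖x i‖ ≤ L}, ENNReal.ofReal (G x))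
    {N : ℕ} {x : ℝ} (hx : x ≤ Real.log ((N / (p + 1) - 2 : ℕ) + 1))
    (hx0 : 0 ≤ γ / (4 * Real.pi * (1 + τ)) * x - ∑' n, lltError γ τ s₀ (2 * L + 6 * R) n) :
    ENNReal.ofReal ((γ / (4 * Real.pi * (1 + τ)) * x
        - ∑' n, lltError γ τ s₀ (2 * L + 6 * R) n) ^ p * π ^ (2 * p + 1) * A')
      ≤ tupleExpectation P b G δ N := by
  have hγ0 := hγ.1
  have hτ0 := hτ.1
  have hpi := Real.pi_pos
  have herr := fun n => lltError_nonneg (s₀ := s₀) (R := 2 * L + 6 * R) hγ hτ n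
  set h : ℕ → ℝ := fun j => γ / (4 * Real.pi * j * (1 + τ)) - lltError γ τ s₀ (2 * L + 6 * R) j
    with hh
  set β : ℕ → ℝ≥0∞ := fun m => ENNReal.ofReal (h (m - 2)) with hβ
  set y := γ / (4 * Real.pi * (1 + τ)) * x - ∑' n, lltError γ τ s₀ (2 * L + 6 * R) n with hy
  set D : Set (Fin p → Plane) := {x | ∀ i, ‖x i‖ ≤ L} with hD
  have hDm : MeasurableSet D := by
    have : D = ⋂ i, {x | ‖x i‖ ≤ L} := by ext; simp [hD]
    rw [this]
    exact MeasurableSet.iInter fun i => measurableSet_le (by fun_prop) measurable_const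
  have hβsum : ENNReal.ofReal y ≤ ∑ m ∈ Finset.Icc 3 (N / (p + 1)), β m := by
    have e : ∑ m ∈ Finset.Icc 3 (N / (p + 1)), β m
        = ∑ j ∈ Finset.Icc 1 (N / (p + 1) - 2), ENNReal.ofReal (h j) := by
      refine Finset.sum_nbij' (fun m => m - 2) (fun j => j + 2) ?_ ?_ ?_ ?_ ?_
      all_goals simp only [Finset.mem_Icc, hβ]
      all_goals intros
      all_goals first | omega | rfl | trivial
    rw [e]
    -- Individual h j may be negative; truncating each of them at 0 only increases the sum.
    have e2 : ENNReal.ofReal (∑ j ∈ Finset.Icc 1 (N / (p + 1) - 2), h j)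
        ≤ ∑ j ∈ Finset.Icc 1 (N / (p + 1) - 2), ENNReal.ofReal (h j) := by
      refine ENNReal.ofReal_le_of_le_toReal ?_
      rw [ENNReal.toReal_sum fun j _ => ENNReal.ofReal_ne_top]
      refine Finset.sum_le_sum fun j _ => ?_
      rw [ENNReal.toReal_ofReal']
      exact le_max_left _ _
    refine le_trans (ENNReal.ofReal_le_ofReal ?_) e2
    rw [hh, Finset.sum_sub_distrib, hy]
    refine sub_le_sub ?_ ((summable_lltError hγ hτ hs₀).sum_le_tsum _ fun n _ => herr n)
    have : ∀ j : ℕ, γ / (4 * Real.pi * j * (1 + τ)) = γ / (4 * Real.pi * (1 + τ)) * (1 / j) := by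
      intro j
      rw [div_mul_div_comm, mul_one]; congr 1; ring
    simp_rw [this]
    rw [← Finset.mul_sum]
    have := log_add_one_le_sum (N / (p + 1) - 2)
    gcongr
    linarith
  have hsingle : ∀ n : Fin p → ℕ, (∀ i, 3 ≤ n i) → (∏ i, β (n i)) * π' ^ (2 * p + 1) *
      (∫⁻ x in D, ENNReal.ofReal (G x)) ≤ ∫⁻ ω, ENNReal.ofReal (G (shiftedVec b n δ ω)) ∂P := by
    intro n hn
    obtain ⟨g, -, hg1, -, hgF⟩ := exists_weight_le_lintegral_shiftedVec hb hind hμ hR hL hπ'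
      (β := β) (fun m => ENNReal.ofReal_ne_top)
      (fun m hm F hF hFL => hstep.le_lintegral_convPow hγ hτ (n := m - 2) (by omega) hF hFL) n hn hδ
    have := hgF (D.indicator fun x => ENNReal.ofReal (G x)) (hG.ennreal_ofReal.indicator hDm)
      (fun x i hi => Set.indicator_of_notMem (fun hx : x ∈ D => absurd (hx i) (not_le.2 hi)) _)
    rw [lintegral_indicator hDm] at this
    refine this.trans (lintegral_mono fun ω => ?_)
    refine (mul_le_of_le_one_left' (hg1 ω)).trans ?_
    exact Set.indicator_le_self' (f := fun x => ENNReal.ofReal (G x)) (fun _ _ => bot_le) _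
  calc ENNReal.ofReal (y ^ p * π ^ (2 * p + 1) * A')
      = ENNReal.ofReal y ^ p * ENNReal.ofReal π ^ (2 * p + 1) * ENNReal.ofReal A' := by
        rw [ENNReal.ofReal_mul (by positivity), ENNReal.ofReal_mul (by positivity),
          ENNReal.ofReal_pow hx0, ENNReal.ofReal_pow hπ0]
    _ ≤ (∑ m ∈ Finset.Icc 3 (N / (p + 1)), β m) ^ p * π' ^ (2 * p + 1) *
          (∫⁻ x in D, ENNReal.ofReal (G x)) := by gcongr
    _ = ∑ n ∈ Fintype.piFinset fun _ : Fin p => Finset.Icc 3 (N / (p + 1)),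
          (∏ i, β (n i)) * π' ^ (2 * p + 1) * (∫⁻ x in D, ENNReal.ofReal (G x)) := by
        rw [← Finset.sum_mul, ← Finset.sum_mul,
          ← Finset.prod_univ_sum (fun _ : Fin p => Finset.Icc 3 (N / (p + 1))) fun _ m => β m]
        simp
    _ ≤ ∑ n ∈ Fintype.piFinset fun _ : Fin p => Finset.Icc 3 (N / (p + 1)),
          ∫⁻ ω, ENNReal.ofReal (G (shiftedVec b n δ ω)) ∂P :=
        Finset.sum_le_sum fun n hn => hsingle n fun i =>
          (Finset.mem_Icc.1 (Fintype.mem_piFinset.1 hn i)).1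
    _ ≤ _ := le_sum_increasingTuples fun k =>
          ∫⁻ ω, ENNReal.ofReal (G fun i => shiftedDiff b (k i) (δ i) ω) ∂P

end fixed

end KR

end


/-! ### Admissible families, the time horizon, and the limit for walks with iid blocks. -/

noncomputable section

namespace KR

open scoped ENNReal

section admissible

variable {p : ℕ} {G : ℝ → (Fin p → Plane) → ℝ} {A : ℝ}

lemma IsAdmissible.lintegral_eq {ι : Type} [Fintype ι] {H : ℝ → (ι → Plane) → ℝ} {B : ℝ}
    (hH : IsAdmissible H B) {ε : ℝ} (hε : ε ∈ Set.Ioo (0 : ℝ) 1) :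
    ∫⁻ x, ENNReal.ofReal (H ε x) = ENNReal.ofReal B := by
  rw [← hH.norm_eq ε hε, ofReal_integral_eq_lintegral_ofReal (hH.integrable ε hε).norm
    (ae_of_all _ fun _ => norm_nonneg _)]
  refine lintegral_congr fun x => ?_
  rw [Real.norm_of_nonneg (hH.nonneg ε hε x)]

lemma IsAdmissible.const_nonneg {ι : Type} [Fintype ι] {H : ℝ → (ι → Plane) → ℝ} {B : ℝ}
    (hH : IsAdmissible H B) : 0 ≤ B := by
  rw [← hH.norm_eq (1 / 2) (by norm_num)]
  exact integral_nonneg fun _ => norm_nonneg _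

lemma le_partialSup {g : (Fin p → Plane) → ℝ} {c : ℝ} (hc : ∀ x, g x ≤ c) (J : Finset (Fin p))
    (x : Fin p → Plane) : g x ≤ partialSup g J fun i => x i := by
  have hb : BddAbove (Set.range fun y : {i : Fin p // i ∈ J} → Plane =>
      g fun i => if h : i ∈ J then y ⟨i, h⟩ else x i) := ⟨c, by rintro _ ⟨y, rfl⟩; exact hc _⟩
  have := le_ciSup hb fun i => x i
  simpa [partialSup] using this

/-- When every coordinate is integrated, G is its own majorant. This gives the sharp constant A,
instead of the constant of the majorant supplied for the empty set. All other choices of flags need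
only some finite constant, uniform in ε. -/
lemma exists_dominating_constants (hG : IsAdmissible G A)
    (hdom : ∀ J : Finset (Fin p), ∃ (H : ℝ → ({i : Fin p // i ∉ J} → Plane) → ℝ) (B : ℝ),
      IsAdmissible H B ∧ ∀ ε ∈ Set.Ioo (0 : ℝ) 1, ∀ x, partialSup (G ε) J x ≤ H ε x) :
    ∃ C : (Fin p → Bool) → ℝ, (∀ J, 0 ≤ C J) ∧ (C fun _ => false) = A ∧
      ∀ ε ∈ Set.Ioo (0 : ℝ) 1, ∀ J, ∃ H : (Fin p → Plane) → ℝ≥0∞, Measurable H ∧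
        (∀ x, ENNReal.ofReal (G ε x) ≤ H x) ∧ DependsOn H {i | J i = false} ∧
        ∀ x, lmarginal (fun _ => volume) (integrated J) H x ≤ ENNReal.ofReal (C J) := by
  classical
  choose H B hH hGH using hdom
  refine ⟨fun J => if J = fun _ => false then A else B (Finset.univ.filter (J · = true)),
    fun J => ?_, by simp, fun ε hε J => ?_⟩
  · dsimp only
    split_ifs
    · exact hG.const_nonneg
    · exact (hH _).const_nonneg
  by_cases hJ : J = fun _ => false
  · refine ⟨fun x => ENNReal.ofReal (G ε x), (hG.measurable ε hε).ennreal_ofReal, fun x => le_rfl,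
      ?_, fun x => ?_⟩
    · rw [hJ]; simpa using dependsOn_univ _
    · have : integrated J = Finset.univ := by rw [hJ]; simp [integrated]
      simp only [if_pos hJ]
      rw [this, lmarginal_univ, ← volume_pi, hG.lintegral_eq hε]
  · set S : Finset (Fin p) := Finset.univ.filter (J · = true) with hS
    obtain ⟨c, hc⟩ := hG.bounded ε hε
    have hr : Measurable fun (x : Fin p → Plane) (i : {i : Fin p // i ∉ S}) => x i :=
      measurable_pi_lambda _ fun i => measurable_pi_apply _
    refine ⟨fun x => ENNReal.ofReal (H S ε fun i => x i),
      (((hH S).measurable ε hε).comp hr).ennreal_ofReal,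
      fun x => ENNReal.ofReal_le_ofReal ((le_partialSup hc S x).trans (hGH S ε hε _)), ?_,
      fun x => ?_⟩
    · intro x y hxy
      have : (fun i : {i : Fin p // i ∉ S} => x i) =
          fun i : {i : Fin p // i ∉ S} => y i := by
        ext1 i
        refine hxy _ ?_
        have := i.2
        simpa [hS] using this
      simp only [this]
    · have himg : integrated J = (Finset.univ : Finset {i : Fin p // i ∉ S}).image
          Subtype.val := by
        ext i
        simp [integrated, hS]
      have key := lmarginal_image (X := fun _ : Fin p => Plane) (μ := fun _ => volume)
        (e := (Subtype.val : {i : Fin p // i ∉ S} → Fin p)) Subtype.val_injective Finset.univ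
        ((hH S).measurable ε hε).ennreal_ofReal x
      simp only [if_neg hJ]
      rw [himg]
      refine le_of_eq (key.trans ?_)
      rw [lmarginal_univ, ← (hH S).lintegral_eq hε]
      rfl

/-- The uniform tail condition gives one radius that works for all ε. A point with some coordinate
larger than L has Euclidean norm at least L, so it lies in the tail region. -/
lemma exists_radius (hG : IsAdmissible G A) {κ : ℝ} (hκ : 0 < κ) :
    ∃ L : ℝ, 0 ≤ L ∧ ∀ ε ∈ Set.Ioo (0 : ℝ) 1, ENNReal.ofReal (A - κ) ≤
      ∫⁻ x in {x | ∀ i, ‖x i‖ ≤ L}, ENNReal.ofReal (G ε x) := by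
  obtain ⟨L, hL, hL0⟩ := ((hG.tail.eventually (gt_mem_nhds hκ)).and (eventually_ge_atTop 0)).exists
  refine ⟨L, hL0, fun ε hε => ?_⟩
  set D : Set (Fin p → Plane) := {x | ∀ i, ‖x i‖ ≤ L} with hD
  set E : Set (Fin p → Plane) := {x | L ≤ √(∑ i, ‖x i‖ ^ 2)} with hE
  have hDm : MeasurableSet D := by
    have : D = ⋂ i, {x | ‖x i‖ ≤ L} := by ext; simp [hD]
    rw [this]
    exact MeasurableSet.iInter fun i => measurableSet_le (by fun_prop) measurable_const
  have hsub : Dᶜ ⊆ E := by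
    intro x hx
    simp only [hD, Set.mem_compl_iff, Set.mem_ofPred_eq, not_forall, not_le] at hx
    obtain ⟨i, hi⟩ := hx
    refine Real.le_sqrt_of_sq_le ?_
    calc L ^ 2 ≤ ‖x i‖ ^ 2 := by gcongr
      _ ≤ _ := Finset.single_le_sum (f := fun i => ‖x i‖ ^ 2) (fun j _ => by positivity)
        (Finset.mem_univ i)
  have hint := hG.integrable ε hε
  have hnn := hG.nonneg ε hε
  have hA : ∀ ε ∈ Set.Ioo (0 : ℝ) 1, ∫ x, G ε x = A := by
    intro ε hε
    rw [← hG.norm_eq ε hε]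
    exact integral_congr_ae (ae_of_all _ fun x => (Real.norm_of_nonneg (hG.nonneg ε hε x)).symm)
  have htail : ∫ x in E, G ε x < κ := by
    refine lt_of_le_of_lt ?_ hL
    -- A real supremum controls its terms only when it is bounded above; the common L¹-norm A is
    -- such a bound.
    refine le_ciSup (f := fun ε : Set.Ioo (0 : ℝ) 1 => ∫ x in E, G ε x) ⟨A, ?_⟩ ⟨ε, hε⟩
    rintro _ ⟨ε', rfl⟩
    dsimp only
    rw [← hA ε' ε'.2]
    exact setIntegral_le_integral (hG.integrable _ ε'.2) (ae_of_all _ (hG.nonneg _ ε'.2))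
  have hcompl : ∫ x in Dᶜ, G ε x ≤ ∫ x in E, G ε x :=
    setIntegral_mono_set hint.integrableOn (ae_of_all _ hnn) (ae_of_all _ hsub)
  have hadd := integral_add_compl hDm hint
  rw [hA ε hε] at hadd
  rw [← ofReal_integral_eq_lintegral_ofReal hint.integrableOn (ae_of_all _ hnn)]
  exact ENNReal.ofReal_le_ofReal (by linarith)

end admissible

section horizon

variable {M : ℝ → ℝ}

lemma tendsto_log_one_div : Tendsto (fun ε : ℝ => Real.log (1 / ε)) (𝓝[>] 0) atTop := by
  simp only [one_div]
  exact Real.tendsto_log_atTop.comp tendsto_inv_nhdsGT_zero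

/-- The limit 2 comes from ε⁻² and turns the local limit constant γ/(4π) into γ/(2π); M contributes
nothing on this scale. -/
lemma tendsto_log_horizon_div (hMpos : ∀ ε ∈ Set.Ioo (0 : ℝ) 1, 0 < M ε)
    (hM : Tendsto (fun ε => Real.log (M ε) / Real.log (1 / ε)) (𝓝[>] 0) (𝓝 0)) :
    Tendsto (fun ε => Real.log (M ε / ε ^ 2) / Real.log (1 / ε)) (𝓝[>] 0) (𝓝 2) := by
  have h : Tendsto (fun ε => Real.log (M ε) / Real.log (1 / ε) + 2) (𝓝[>] 0) (𝓝 (0 + 2)) :=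
    hM.add_const 2
  rw [zero_add] at h
  refine h.congr' ?_
  filter_upwards [Ioo_mem_nhdsGT (zero_lt_one' ℝ)] with ε hε
  have h1 : 0 < Real.log (1 / ε) := Real.log_pos (by rw [one_div]; exact (one_lt_inv₀ hε.1).2 hε.2)
  have hpos := hMpos ε hε
  have hε0 := hε.1
  rw [Real.log_div hpos.ne' (by positivity), Real.log_pow]
  have h2 : Real.log ε = -Real.log (1 / ε) := by rw [one_div, Real.log_inv, neg_neg]
  rw [h2]
  field_simp
  push_cast; ring

lemma tendsto_log_horizon (hMpos : ∀ ε ∈ Set.Ioo (0 : ℝ) 1, 0 < M ε)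
    (hM : Tendsto (fun ε => Real.log (M ε) / Real.log (1 / ε)) (𝓝[>] 0) (𝓝 0)) :
    Tendsto (fun ε => Real.log (M ε / ε ^ 2)) (𝓝[>] 0) atTop := by
  refine ((tendsto_log_horizon_div hMpos hM).pos_mul_atTop two_pos tendsto_log_one_div).congr' ?_
  filter_upwards [tendsto_log_one_div.eventually_gt_atTop 0] with ε hε
  field_simp

lemma eventually_log_floor (q : ℕ) (hMpos : ∀ ε ∈ Set.Ioo (0 : ℝ) 1, 0 < M ε)
    (hM : Tendsto (fun ε => Real.log (M ε) / Real.log (1 / ε)) (𝓝[>] 0) (𝓝 0)) :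
    ∀ᶠ ε in 𝓝[>] (0 : ℝ), Real.log ⌊M ε / ε ^ 2⌋₊ ≤ Real.log (M ε / ε ^ 2) ∧
      Real.log (M ε / ε ^ 2) - Real.log (2 * (q + 1)) ≤
        Real.log ((⌊M ε / ε ^ 2⌋₊ / (q + 1) - 2 : ℕ) + 1) := by
  -- Rounding loses less than 1 + 2(q+1) in x = M/ε². The condition x ≥ 2 + 4(q+1) makes this at
  -- most x/2, whence the factor 2 in log(2(q+1)).
  filter_upwards [Ioo_mem_nhdsGT (zero_lt_one' ℝ),
    (tendsto_log_horizon hMpos hM).eventually_ge_atTop (Real.log (2 + 4 * (q + 1)))] with ε hε hx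
  have hε0 := hε.1
  have hpos := hMpos ε hε
  set x := M ε / ε ^ 2 with hxdef
  have hx0 : 0 < x := by positivity
  have hxge : 2 + 4 * ((q : ℝ) + 1) ≤ x := (Real.log_le_log_iff (by positivity) hx0).1 hx
  have hx1 : 1 ≤ x := by
    have : (0 : ℝ) ≤ q := by positivity
    linarith
  have hfl : 1 ≤ ⌊x⌋₊ := Nat.one_le_floor_iff _ |>.2 hx1
  constructor
  · exact Real.log_le_log (by exact_mod_cast hfl) (Nat.floor_le hx0.le)
  · rw [← Real.log_div hx0.ne' (by positivity)]
    refine Real.log_le_log (by positivity) ?_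
    have h1 : x - 1 < ⌊x⌋₊ := Nat.sub_one_lt_floor x
    have h2 : (⌊x⌋₊ : ℝ) < (q + 1) * ((⌊x⌋₊ / (q + 1) : ℕ) + 1) := by
      exact_mod_cast Nat.lt_mul_div_succ ⌊x⌋₊ (Nat.succ_pos q)
    have h3 : ((⌊x⌋₊ / (q + 1) : ℕ) : ℝ) - 2 ≤ (⌊x⌋₊ / (q + 1) - 2 : ℕ) := by
      have : ⌊x⌋₊ / (q + 1) ≤ (⌊x⌋₊ / (q + 1) - 2) + 2 := by omega
      rw [sub_le_iff_le_add]
      exact_mod_cast this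
    rw [div_le_iff₀ (by positivity)]
    have hq : (0 : ℝ) < q + 1 := by positivity
    have h4 : ((q : ℝ) + 1) * ((⌊x⌋₊ / (q + 1) : ℕ) + 1)
        ≤ (q + 1) * (((⌊x⌋₊ / (q + 1) - 2 : ℕ) : ℝ) + 3) :=
      mul_le_mul_of_nonneg_left (by linarith) hq.le
    nlinarith

end horizon

section limit

variable {Ω : Type*} [MeasurableSpace Ω] {P : Measure Ω} [IsProbabilityMeasure P]
  {b : ℝ → ℕ → Ω → Plane × Plane} {μ : ℝ → Measure Plane} {γ : ℝ}

/-- The asymptotics of the expected sum over increasing tuples for walks with iid blocks whose step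
laws are asymptotically Gaussian near the origin of Fourier space. -/
theorem tendsto_tupleExpectation (hγ : γ ∈ Set.Ioo (0 : ℝ) 1)
    (hb : ∀ᶠ ε in 𝓝[>] (0 : ℝ), (∀ i, Measurable (b ε i)) ∧ iIndepFun (b ε) P ∧
      ∀ i, P.map (fun ω => (b ε i ω).1 - (b ε i ω).2) = μ ε)
    (hstep : ∀ τ ∈ Set.Ioo (0 : ℝ) 1, ∃ s₀ : ℝ, 0 < s₀ ∧
      ∀ᶠ ε in 𝓝[>] (0 : ℝ), IsStepLaw γ τ s₀ (μ ε))
    (htight : ∀ t ∈ Set.Ioo (0 : ℝ) 1, ∃ R : ℝ, 0 ≤ R ∧ ∀ᶠ ε in 𝓝[>] (0 : ℝ),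
      ∃ π' : ℝ≥0∞, ENNReal.ofReal (1 - t) ≤ π' ∧ ∀ i, ∫⁻ ω, smallBlock R (b ε i ω) ∂P = π')
    {p : ℕ} {G : ℝ → (Fin p → Plane) → ℝ} {A : ℝ} (hG : IsAdmissible G A)
    (hdom : ∀ J : Finset (Fin p), ∃ (H : ℝ → ({i : Fin p // i ∉ J} → Plane) → ℝ) (B : ℝ),
      IsAdmissible H B ∧ ∀ ε ∈ Set.Ioo (0 : ℝ) 1, ∀ x, partialSup (G ε) J x ≤ H ε x)
    {δ : Fin p → ℤ} (hδ : ∀ i, δ i = -1 ∨ δ i = 0 ∨ δ i = 1)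
    {M : ℝ → ℝ} (hMpos : ∀ ε ∈ Set.Ioo (0 : ℝ) 1, 0 < M ε)
    (hM : Tendsto (fun ε => Real.log (M ε) / Real.log (1 / ε)) (𝓝[>] 0) (𝓝 0)) :
    Tendsto (fun ε => (tupleExpectation P (b ε) (G ε) δ ⌊M ε / ε ^ 2⌋₊).toReal /
      (γ / (2 * Real.pi) * Real.log (1 / ε)) ^ p) (𝓝[>] 0) (𝓝 A) := by
  have hγ0 := hγ.1
  have hpi := Real.pi_pos
  obtain ⟨C, hC0, hCA, hC⟩ := exists_dominating_constants hG hdom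
  have hlog1 := tendsto_log_one_div
  have hratio := tendsto_log_horizon_div hMpos hM
  have hlog := tendsto_log_horizon hMpos hM
  have hfloor := eventually_log_floor p hMpos hM
  set x : ℝ → ℝ := fun ε => Real.log (M ε / ε ^ 2) with hx
  set L : ℝ → ℝ := fun ε => γ / (2 * Real.pi) * Real.log (1 / ε) with hL
  have hLtop : Tendsto L (𝓝[>] 0) atTop := hlog1.const_mul_atTop (by positivity)
  have hxL : Tendsto (fun ε => x ε / L ε) (𝓝[>] 0) (𝓝 (4 * Real.pi / γ)) := by
    have h := hratio.const_mul (2 * Real.pi / γ)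
    have e : 2 * Real.pi / γ * 2 = 4 * Real.pi / γ := by ring
    rw [e] at h
    refine h.congr fun ε => ?_
    simp only [hL, hx]
    rw [div_mul_div_comm, mul_comm (2 * Real.pi), ← div_div_eq_mul_div]
    field_simp
  have hconst : ∀ c : ℝ, Tendsto (fun ε => c / L ε) (𝓝[>] 0) (𝓝 0) := fun c =>
    hLtop.const_div_atTop c
  -- The upper bound divided by the p-th power of `L`, which supplies one factor `L` per coordinate.
  have hup : ∀ τ ∈ Set.Ioo (0 : ℝ) 1, ∃ u : ℝ → ℝ,
      Tendsto u (𝓝[>] 0) (𝓝 ((1 / (1 - τ)) ^ p * A)) ∧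
      ∀ᶠ ε in 𝓝[>] (0 : ℝ), tupleExpectation P (b ε) (G ε) δ ⌊M ε / ε ^ 2⌋₊
        ≤ ENNReal.ofReal (u ε * L ε ^ p) ∧ 0 ≤ u ε := by
    intro τ hτ
    have h1τ : 0 < 1 - τ := by linarith [hτ.2]
    obtain ⟨s₀, hs₀, hst⟩ := hstep τ hτ
    refine ⟨fun ε => ∑ J : Fin p → Bool,
      (∏ i, (if J i then 2 + γ⁻¹ else gapBound γ τ s₀ (x ε)) / L ε) * C J, ?_, ?_⟩
    · have hlim : ∀ (J : Fin p → Bool) (i : Fin p), Tendsto (fun ε =>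
          (if J i then 2 + γ⁻¹ else gapBound γ τ s₀ (x ε)) / L ε) (𝓝[>] 0)
          (𝓝 (if J i then 0 else 1 / (1 - τ))) := by
        intro J i
        by_cases h : J i
        · simp only [h, if_true]; exact hconst _
        · simp only [h, Bool.false_eq_true, if_false, gapBound]
          have e : (1 : ℝ) / (1 - τ) = γ / (4 * Real.pi * (1 - τ)) * (0 + 4 * Real.pi / γ) + 0 := by
            field_simp; ring
          rw [e]
          refine ((((hconst 1).add hxL).const_mul (γ / (4 * Real.pi * (1 - τ)))).add
            (hconst (∑' n, lltError γ τ s₀ 0 n))).congr fun ε => ?_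
          ring
      have hsum : Tendsto (fun ε => ∑ J : Fin p → Bool,
          (∏ i, (if J i then 2 + γ⁻¹ else gapBound γ τ s₀ (x ε)) / L ε) * C J) (𝓝[>] 0)
          (𝓝 (∑ J : Fin p → Bool, (∏ i, if J i then (0 : ℝ) else 1 / (1 - τ)) * C J)) :=
        tendsto_finsetSum _ fun J _ => (tendsto_finsetProd _ fun i _ => hlim J i).mul_const _
      convert! hsum using 2
      -- A coordinate replaced by its supremum contributes a bounded factor divided by `L`, which
      -- tends to 0. Only the fully integrated term survives.
      rw [Finset.sum_eq_single fun _ => false]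
      · simp [hCA]
      · intro J _ hJ
        obtain ⟨i, hi⟩ : ∃ i, J i = true := by
          by_contra h
          push Not at h
          exact hJ (funext fun i => by simpa using h i)
        rw [Finset.prod_eq_zero (Finset.mem_univ i) (by simp [hi]), zero_mul]
      · simp
    · filter_upwards [hb, hst, hfloor, hlog.eventually_ge_atTop 0, hLtop.eventually_gt_atTop 0,
        Ioo_mem_nhdsGT (zero_lt_one' ℝ)] with ε ⟨hb1, hb2, hb3⟩ hε hfl hx0 hL0 hε1
      have hE := tupleExpectation_le hγ hτ hs₀ hb1 hb2 hb3 hε hδ (hG.measurable ε hε1) hC0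
        (hC ε hε1) hx0 hfl.1
      refine ⟨hE.trans (le_of_eq ?_), ?_⟩
      · congr 1
        rw [Finset.sum_mul]
        refine Finset.sum_congr rfl fun J _ => ?_
        rw [Finset.prod_div_distrib]
        simp only [Finset.prod_const, Finset.card_univ, Fintype.card_fin]
        field_simp
      · refine Finset.sum_nonneg fun J _ => mul_nonneg (Finset.prod_nonneg fun i _ =>
          div_nonneg ?_ hL0.le) (hC0 J)
        split_ifs
        · positivity
        · exact gapBound_nonneg hγ hτ hx0
  -- One parameter t serves as the accuracy of the step law, as the probability allowed for a large
  -- block, and as the mass of G lost by the cutoff.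
  have hlow : ∀ t ∈ Set.Ioo (0 : ℝ) 1, ∃ v : ℝ → ℝ,
      Tendsto v (𝓝[>] 0) (𝓝 ((1 / (1 + t)) ^ p * (1 - t) ^ (2 * p + 1) * (A - t))) ∧
      ∀ᶠ ε in 𝓝[>] (0 : ℝ), ENNReal.ofReal (v ε * L ε ^ p) ≤
        tupleExpectation P (b ε) (G ε) δ ⌊M ε / ε ^ 2⌋₊ := by
    intro t ht
    have ht0 := ht.1
    obtain ⟨s₀, hs₀, hst⟩ := hstep t ht
    obtain ⟨R, hR0, hR⟩ := htight t ht
    obtain ⟨r, hr0, hr⟩ := exists_radius hG ht.1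
    set S := ∑' n, lltError γ t s₀ (2 * r + 6 * R) n with hS
    set y : ℝ → ℝ := fun ε => x ε - Real.log (2 * (p + 1)) with hy
    set z : ℝ → ℝ := fun ε => γ / (4 * Real.pi * (1 + t)) * y ε - S with hz
    have hzL : Tendsto (fun ε => z ε / L ε) (𝓝[>] 0) (𝓝 (1 / (1 + t))) := by
      have e : (1 : ℝ) / (1 + t) = γ / (4 * Real.pi * (1 + t)) * (4 * Real.pi / γ - 0) - 0 := by
        field_simp; ring
      rw [e]
      refine (((hxL.sub (hconst (Real.log (2 * (p + 1))))).const_mul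
        (γ / (4 * Real.pi * (1 + t)))).sub (hconst S)).congr fun ε => ?_
      simp only [hz, hy]; ring
    have hztop : ∀ᶠ ε in 𝓝[>] (0 : ℝ), 0 ≤ z ε := by
      have : Tendsto z (𝓝[>] 0) atTop :=
        tendsto_atTop_add_const_right _ (-S) ((tendsto_atTop_add_const_right _
          (-Real.log (2 * (p + 1))) hlog).const_mul_atTop (by positivity))
      exact this.eventually_ge_atTop 0
    refine ⟨fun ε => (z ε / L ε) ^ p * (1 - t) ^ (2 * p + 1) * (A - t),
      ((hzL.pow p).mul_const _).mul_const _, ?_⟩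
    filter_upwards [hb, hst, hR, hfloor, hztop, hLtop.eventually_gt_atTop 0,
      Ioo_mem_nhdsGT (zero_lt_one' ℝ)] with ε ⟨hb1, hb2, hb3⟩ hε ⟨π', hπ1, hπ2⟩ hfl hz0 hL0 hε1
    have hE := le_tupleExpectation hγ ht hs₀ hb1 hb2 hb3 hε hR0 hr0 hπ2
      (by linarith [ht.2] : 0 ≤ 1 - t) hπ1 hδ (hG.measurable ε hε1) (hr ε hε1) hfl.2 hz0
    refine le_trans (le_of_eq ?_) hE
    congr 1
    rw [div_pow]
    have hLp : L ε ^ p ≠ 0 := (pow_pos hL0 p).ne'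
    have e : z ε = γ / (4 * Real.pi * (1 + t)) *
        (Real.log (M ε / ε ^ 2) - Real.log (2 * (p + 1))) - S := rfl
    rw [← e, div_mul_eq_mul_div, div_mul_eq_mul_div, div_mul_eq_mul_div, div_eq_iff hLp]
  refine tendsto_order.2 ⟨fun a ha => ?_, fun a ha => ?_⟩
  · have hcont : Tendsto (fun t : ℝ => (1 / (1 + t)) ^ p * (1 - t) ^ (2 * p + 1) * (A - t))
        (𝓝[>] 0) (𝓝 A) := by
      have : ContinuousAt (fun t : ℝ => (1 / (1 + t)) ^ p * (1 - t) ^ (2 * p + 1) * (A - t)) 0 := by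
        have : (1 : ℝ) + 0 ≠ 0 := by norm_num
        fun_prop (disch := assumption)
      have h := this.tendsto
      simp only [add_zero, sub_zero, div_one, one_pow, one_mul] at h
      exact h.mono_left nhdsWithin_le_nhds
    obtain ⟨t, hta, ht⟩ := ((hcont.eventually (lt_mem_nhds ha)).and
      (Ioo_mem_nhdsGT (zero_lt_one' ℝ))).exists
    obtain ⟨v, hv, hvE⟩ := hlow t ht
    -- The upper bound enters the lower estimate only to make the expectation finite, so that
    -- `toReal` does not collapse to 0.
    obtain ⟨u, -, huE⟩ := hup t ht
    filter_upwards [hvE, huE, hv.eventually (lt_mem_nhds hta), hLtop.eventually_gt_atTop 0]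
      with ε h1 h2 h3 h4
    have hfin := ne_top_of_le_ne_top ENNReal.ofReal_ne_top h2.1
    rw [ENNReal.ofReal_le_iff_le_toReal hfin] at h1
    refine lt_of_lt_of_le h3 ?_
    rwa [le_div_iff₀ (by positivity)]
  · have hcont : Tendsto (fun t : ℝ => (1 / (1 - t)) ^ p * A) (𝓝[>] 0) (𝓝 A) := by
      have : ContinuousAt (fun t : ℝ => (1 / (1 - t)) ^ p * A) 0 := by
        have : (1 : ℝ) - 0 ≠ 0 := by norm_num
        fun_prop (disch := assumption)
      have h := this.tendsto
      simp only [sub_zero, div_one, one_pow, one_mul] at h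
      exact h.mono_left nhdsWithin_le_nhds
    obtain ⟨t, hta, ht⟩ := ((hcont.eventually (gt_mem_nhds ha)).and
      (Ioo_mem_nhdsGT (zero_lt_one' ℝ))).exists
    obtain ⟨u, hu, huE⟩ := hup t ht
    filter_upwards [huE, hu.eventually (gt_mem_nhds hta), hLtop.eventually_gt_atTop 0]
      with ε h2 h3 h4
    refine lt_of_le_of_lt ?_ h3
    rw [div_le_iff₀ (by positivity)]
    exact ENNReal.toReal_le_of_le_ofReal (by have := h2.2; positivity) h2.1

end limit

end KR

end


/-! ### The regenerative coupling as a Markov chain with a density; products over successive blocks.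
-/

noncomputable section

namespace KR

open scoped ENNReal

section coupling

variable {Ω : Type*}

/-- The displacements of a pair of paths over the unit time interval. -/
def displacement (z : Path × Path) : Plane × Plane := (z.1.at 1, z.2.at 1)

lemma measurable_path_at (t : unitInterval) : Measurable fun x : Path => x.at t :=
  (ContinuousEvalConst.continuous_eval_const (F := C(unitInterval, Plane)) t).measurable.comp
    measurable_subtype_coe

lemma measurable_displacement : Measurable displacement :=
  ((measurable_path_at 1).comp measurable_fst).prodMk ((measurable_path_at 1).comp measurable_snd)

/-- The sigma-algebra of the history up to step `n`. -/
abbrev historySigma (Z : ℕ → Ω → Path × Path) (η : ℕ → Ω → Bool) (n : ℕ) : MeasurableSpace Ω :=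
  MeasurableSpace.comap (history Z η n) inferInstance

variable {Z : ℕ → Ω → Path × Path} {η : ℕ → Ω → Bool}

lemma measurable_state_historySigma {j n : ℕ} (h : j ≤ n) :
    Measurable[historySigma Z η n] (Z j) := by
  have h1 : Measurable[historySigma Z η n] (history Z η n) := comap_measurable _
  exact (measurable_pi_apply (⟨j, by omega⟩ : Fin (n + 1))).comp (measurable_fst.comp h1)

lemma measurable_coin_historySigma {j n : ℕ} (h : j < n) :
    Measurable[historySigma Z η n] (η (j + 1)) := by
  have h1 : Measurable[historySigma Z η n] (history Z η n) := comap_measurable _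
  exact (measurable_pi_apply (⟨j, h⟩ : Fin n)).comp (measurable_snd.comp h1)

lemma historySigma_mono {m n : ℕ} (h : m ≤ n) :
    historySigma Z η m ≤ historySigma Z η n := by
  refine measurable_iff_comap_le.1 (?_ : Measurable[historySigma Z η n] (history Z η m))
  unfold history
  refine Measurable.prodMk (m := historySigma Z η n) ?_ ?_
  · exact @measurable_pi_lambda _ _ _ (historySigma Z η n) _ _ fun i =>
      measurable_state_historySigma (by omega)
  · exact @measurable_pi_lambda _ _ _ (historySigma Z η n) _ _ fun i =>
      measurable_coin_historySigma (by omega)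

/-- The indicator that the coin `η n` shows `v`. -/
def coinInd (η : ℕ → Ω → Bool) (v : Bool) (n : ℕ) (ω : Ω) : ℝ≥0∞ := if η n ω = v then 1 else 0

lemma measurable_coinInd_historySigma {j n : ℕ} (h : j < n) (v : Bool) :
    Measurable[historySigma Z η n] (coinInd η v (j + 1)) :=
  (measurable_of_countable fun c : Bool => if c = v then (1 : ℝ≥0∞) else 0).comp
    (measurable_coin_historySigma h)

/-- The indicator that the coins `η (t+1), …, η (t+l)` are failures. -/
def failInd (η : ℕ → Ω → Bool) (t l : ℕ) (ω : Ω) : ℝ≥0∞ :=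
  ∏ j ∈ Finset.range l, coinInd η false (t + j + 1) ω

/-- The total displacement over the steps `t, …, t + l`. -/
def excursion (Z : ℕ → Ω → Path × Path) (t l : ℕ) (ω : Ω) : Plane × Plane :=
  ∑ j ∈ Finset.range (l + 1), displacement (Z (t + j) ω)

lemma measurable_failInd_historySigma (t l : ℕ) :
    Measurable[historySigma Z η (t + l)] (failInd η t l) :=
  @Finset.measurable_fun_prod _ _ _ _ _ _ (historySigma Z η (t + l)) _ _ fun j hj =>
    measurable_coinInd_historySigma (by have := Finset.mem_range.1 hj; omega) _

lemma measurable_excursion_historySigma (t l : ℕ) :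
    Measurable[historySigma Z η (t + l)] (excursion Z t l) :=
  @Finset.measurable_fun_sum _ _ _ _ _ _ (historySigma Z η (t + l)) _ _ fun j hj =>
    measurable_displacement.comp
      (measurable_state_historySigma (by have := Finset.mem_range.1 hj; omega))

/-- The joint density of the coin and of the next state, given the present state. -/
def coinDensity (γ : ℝ) (k : (Path × Path) × (Path × Path) → ℝ≥0∞) (v : Bool)
    (q : (Path × Path) × (Path × Path)) : ℝ≥0∞ :=
  if v then ENNReal.ofReal γ else k q

lemma measurable_coinDensity {γ : ℝ} {k : (Path × Path) × (Path × Path) → ℝ≥0∞}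
    (hk : Measurable k) (v : Bool) : Measurable (coinDensity γ k v) := by
  cases v
  · exact hk
  · exact measurable_const

variable [mΩ : MeasurableSpace Ω] {P : Measure Ω}
  {κ : Path × Path → Measure (Path × Path)} {ν : Measure (Path × Path)}
  {γ : ℝ} {k : (Path × Path) × (Path × Path) → ℝ≥0∞}

lemma IsRegenerativeCoupling.measurable_history (hZ : IsRegenerativeCoupling P κ ν γ Z η) (n : ℕ) :
    Measurable (history Z η n) :=
  (measurable_pi_lambda _ fun _ => hZ.measurable_state _).prodMk
    (measurable_pi_lambda _ fun _ => hZ.measurable_coin _)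

lemma IsRegenerativeCoupling.historySigma_le (hZ : IsRegenerativeCoupling P κ ν γ Z η) (n : ℕ) :
    historySigma Z η n ≤ mΩ :=
  (hZ.measurable_history n).comap_le

lemma IsRegenerativeCoupling.measurable_coinInd (hZ : IsRegenerativeCoupling P κ ν γ Z η)
    (v : Bool) (n : ℕ) : Measurable (coinInd η v n) :=
  (measurable_of_countable fun c : Bool => if c = v then (1 : ℝ≥0∞) else 0).comp
    (hZ.measurable_coin n)

lemma IsRegenerativeCoupling.measurable_failInd (hZ : IsRegenerativeCoupling P κ ν γ Z η)
    (t l : ℕ) : Measurable (failInd η t l) :=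
  (measurable_failInd_historySigma (Z := Z) t l).mono (hZ.historySigma_le _) le_rfl

lemma IsRegenerativeCoupling.measurable_excursion (hZ : IsRegenerativeCoupling P κ ν γ Z η)
    (t l : ℕ) : Measurable (excursion Z t l) :=
  (measurable_excursion_historySigma (η := η) t l).mono (hZ.historySigma_le _) le_rfl

/-- The sum over the possible positions of the next `n` regenerations after step `t` of the product
of `F 0, …, F (n-1)` evaluated at the blocks. -/
def blockProduct (Z : ℕ → Ω → Path × Path) (η : ℕ → Ω → Bool) :
    ℕ → (ℕ → Plane × Plane → ℝ≥0∞) → ℕ → Ω → ℝ≥0∞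
  | 0, _, _, _ => 1
  | n + 1, F, t, ω => ∑' l, failInd η t l ω * coinInd η true (t + l + 1) ω *
      F 0 (excursion Z t l ω) * blockProduct Z η n (fun i => F (i + 1)) (t + l + 1) ω

lemma IsRegenerativeCoupling.measurable_blockProduct (hZ : IsRegenerativeCoupling P κ ν γ Z η)
    (n : ℕ) {F : ℕ → Plane × Plane → ℝ≥0∞} (hF : ∀ i, Measurable (F i)) (t : ℕ) :
    Measurable (blockProduct Z η n F t) := by
  induction n generalizing F t with
  | zero => exact measurable_const
  | succ n ih =>
    refine Measurable.tsum fun l => ?_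
    exact (((hZ.measurable_failInd t l).mul (hZ.measurable_coinInd _ _)).mul
      ((hF 0).comp (hZ.measurable_excursion t l))).mul (ih (fun i => hF (i + 1)) _)

/-- `a` is a weight that depends on the history up to step `t`, under which the state at step `t`
is a fresh sample of `ν`. -/
structure IsFreshAt (P : Measure Ω) (ν : Measure (Path × Path)) (Z : ℕ → Ω → Path × Path)
    (η : ℕ → Ω → Bool) (t : ℕ) (a : Ω → ℝ≥0∞) : Prop where
  measurable : Measurable[historySigma Z η t] a
  fresh : ∀ g : Path × Path → ℝ≥0∞, Measurable g →
    ∫⁻ ω, a ω * g (Z t ω) ∂P = (∫⁻ ω, a ω ∂P) * ∫⁻ z, g z ∂ν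

variable [IsProbabilityMeasure P]

lemma IsRegenerativeCoupling.isFreshAt_zero (hZ : IsRegenerativeCoupling P κ ν γ Z η) :
    IsFreshAt P ν Z η 0 fun _ => 1 where
  measurable := measurable_const
  fresh g hg := by
    rw [← hZ.initial, lintegral_map hg (hZ.measurable_state 0)]
    simp

variable [IsProbabilityMeasure ν]

/-- The defining identities of the coupling are statements about rectangles, and rectangles
determine a finite measure on the product. Here `k` is the density of (1 - γ) times the residual
transition probability. -/
lemma IsRegenerativeCoupling.map_history_state (hZ : IsRegenerativeCoupling P κ ν γ Z η)
    (hk : Measurable k)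
    (hres : ∀ z, ENNReal.ofReal (1 - γ) • residual κ ν γ z = ν.withDensity fun w => k (z, w))
    (n : ℕ) (v : Bool) :
    (P.restrict {ω | η (n + 1) ω = v}).map (fun ω => (history Z η n ω, Z (n + 1) ω)) =
      ((P.map (history Z η n)).prod ν).withDensity
        (fun q => coinDensity γ k v (q.1.1 (Fin.last n), q.2)) := by
  have hH := hZ.measurable_history n
  have hS := hZ.measurable_state (n + 1)
  have hlast : Measurable fun h : (Fin (n + 1) → Path × Path) × (Fin n → Bool) =>
      h.1 (Fin.last n) := (measurable_pi_apply _).comp measurable_fst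
  have hd := measurable_coinDensity (γ := γ) hk v
  have hd2 : Measurable fun q : ((Fin (n + 1) → Path × Path) × (Fin n → Bool)) × (Path × Path) =>
      coinDensity γ k v (q.1.1 (Fin.last n), q.2) :=
    hd.comp ((hlast.comp measurable_fst).prodMk measurable_snd)
  refine Measure.ext_prod fun {A B} hA hB => ?_
  have hpm : IsProbabilityMeasure (P.map (history Z η n)) :=
    Measure.isProbabilityMeasure_map hH.aemeasurable
  rw [Measure.map_apply (hH.prodMk hS) (hA.prod hB), Measure.restrict_apply
    ((hH.prodMk hS) (hA.prod hB)), withDensity_apply _ (hA.prod hB), ← Measure.prod_restrict,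
    lintegral_prod _ hd2.aemeasurable, Measure.restrict_map hH hA, lintegral_map
      hd2.lintegral_prod_right' hH]
  have hset : (fun ω => (history Z η n ω, Z (n + 1) ω)) ⁻¹' A ×ˢ B ∩ {ω | η (n + 1) ω = v} =
      {ω | history Z η n ω ∈ A ∧ η (n + 1) ω = v ∧ Z (n + 1) ω ∈ B} := by
    ext ω; simp; tauto
  rw [hset]
  cases v
  · rw [hZ.failure n A B hA hB, ← lintegral_const_mul' _ _ ENNReal.ofReal_ne_top]
    refine lintegral_congr fun ω => ?_
    have := congrArg (fun m => m B) (hres (Z n ω))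
    simp only [Measure.smul_apply, smul_eq_mul, withDensity_apply _ hB] at this
    rw [this]
    simp [coinDensity, history]
  · rw [hZ.success n A B hA hB]
    simp only [coinDensity, if_true, lintegral_const, Measure.restrict_apply MeasurableSet.univ,
      Set.univ_inter]
    have : P (history Z η n ⁻¹' A) = P {ω | history Z η n ω ∈ A} := rfl
    rw [this]
    ring

/-- The one-step rule: the joint law of the next coin and the next state, given the history. -/
lemma IsRegenerativeCoupling.lintegral_step (hZ : IsRegenerativeCoupling P κ ν γ Z η)
    (hk : Measurable k)
    (hres : ∀ z, ENNReal.ofReal (1 - γ) • residual κ ν γ z = ν.withDensity fun w => k (z, w))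
    (n : ℕ) (v : Bool) {a : Ω → ℝ≥0∞} (ha : Measurable[historySigma Z η n] a)
    {u : Ω → Plane × Plane} (hu : Measurable[historySigma Z η n] u)
    {φ : (Plane × Plane) × (Path × Path) → ℝ≥0∞} (hφ : Measurable φ) :
    ∫⁻ ω, a ω * (coinInd η v (n + 1) ω * φ (u ω, Z (n + 1) ω)) ∂P =
      ∫⁻ ω, a ω * ∫⁻ w, coinDensity γ k v (Z n ω, w) * φ (u ω, w) ∂ν ∂P := by
  obtain ⟨a', ha', rfl⟩ := ha.exists_eq_measurable_comp
  obtain ⟨u', hu', rfl⟩ := hu.exists_eq_measurable_comp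
  have hH := hZ.measurable_history n
  have hS := hZ.measurable_state (n + 1)
  have hpm : IsProbabilityMeasure (P.map (history Z η n)) :=
    Measure.isProbabilityMeasure_map hH.aemeasurable
  have hlast : Measurable fun h : (Fin (n + 1) → Path × Path) × (Fin n → Bool) =>
      h.1 (Fin.last n) := (measurable_pi_apply _).comp measurable_fst
  have hd := measurable_coinDensity (γ := γ) hk v
  have hd2 : Measurable fun q : ((Fin (n + 1) → Path × Path) × (Fin n → Bool)) × (Path × Path) =>
      coinDensity γ k v (q.1.1 (Fin.last n), q.2) :=
    hd.comp ((hlast.comp measurable_fst).prodMk measurable_snd)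
  have hφ2 : Measurable fun q : ((Fin (n + 1) → Path × Path) × (Fin n → Bool)) × (Path × Path) =>
      φ (u' q.1, q.2) := hφ.comp ((hu'.comp measurable_fst).prodMk measurable_snd)
  have hF : Measurable fun q : ((Fin (n + 1) → Path × Path) × (Fin n → Bool)) × (Path × Path) =>
      a' q.1 * φ (u' q.1, q.2) := (ha'.comp measurable_fst).mul hφ2
  have hv : MeasurableSet {ω | η (n + 1) ω = v} :=
    hZ.measurable_coin (n + 1) (measurableSet_singleton v)
  have key := congrArg (fun m => ∫⁻ q, a' q.1 * φ (u' q.1, q.2) ∂m)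
    (hZ.map_history_state hk hres n v)
  rw [lintegral_map hF (hH.prodMk hS), lintegral_withDensity_eq_lintegral_mul _ hd2 hF,
    lintegral_prod _ (hd2.mul hF).aemeasurable, lintegral_map
      (hd2.mul hF).lintegral_prod_right' hH,
    ← lintegral_indicator hv] at key
  refine Eq.trans (lintegral_congr fun ω => ?_) (key.trans (lintegral_congr fun ω => ?_))
  · by_cases h : η (n + 1) ω = v <;> simp [coinInd, h]
  · simp only [Pi.mul_apply, Function.comp_apply]
    rw [← lintegral_const_mul]
    · refine lintegral_congr fun w => ?_
      have : (history Z η n ω).1 (Fin.last n) = Z n ω := rfl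
      rw [this]
      ring
    · exact (hd.comp measurable_prodMk_left).mul (hφ.comp measurable_prodMk_left)

/-- The operator that averages over the next state of a chain with kernel `k` and adds up the
displacement. -/
def kernelStep (ν : Measure (Path × Path)) (k : (Path × Path) × (Path × Path) → ℝ≥0∞)
    (φ : (Plane × Plane) × (Path × Path) → ℝ≥0∞) (q : (Plane × Plane) × (Path × Path)) : ℝ≥0∞ :=
  ∫⁻ w, k (q.2, w) * φ (q.1 + displacement w, w) ∂ν

lemma measurable_kernelStep (hk : Measurable k) {φ : (Plane × Plane) × (Path × Path) → ℝ≥0∞}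
    (hφ : Measurable φ) : Measurable (kernelStep ν k φ) := by
  refine Measurable.lintegral_prod_right' (f := fun x : ((Plane × Plane) × (Path × Path)) ×
    (Path × Path) => k (x.1.2, x.2) * φ (x.1.1 + displacement x.2, x.2)) ?_
  have h := measurable_displacement
  refine (hk.comp (by fun_prop)).mul (hφ.comp ?_)
  exact (Measurable.add (by fun_prop) (h.comp measurable_snd)).prodMk measurable_snd

/-- On a success the next state is sampled from ν whatever the history, so any earlier weight may be
carried along. This is the regeneration property. -/
lemma IsRegenerativeCoupling.isFreshAt_succ (hZ : IsRegenerativeCoupling P κ ν γ Z η)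
    (hk : Measurable k)
    (hres : ∀ z, ENNReal.ofReal (1 - γ) • residual κ ν γ z = ν.withDensity fun w => k (z, w))
    {n : ℕ} {a : Ω → ℝ≥0∞} (ha : Measurable[historySigma Z η n] a) :
    IsFreshAt P ν Z η (n + 1) fun ω => a ω * coinInd η true (n + 1) ω := by
  have h (g : Path × Path → ℝ≥0∞) (hg : Measurable g) :
      ∫⁻ ω, a ω * coinInd η true (n + 1) ω * g (Z (n + 1) ω) ∂P =
        (∫⁻ ω, a ω ∂P) * (ENNReal.ofReal γ * ∫⁻ z, g z ∂ν) := by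
    have := hZ.lintegral_step hk hres n true ha (u := fun _ => 0) measurable_const
      (φ := fun q => g q.2) (hg.comp measurable_snd)
    simp only [coinDensity, if_true, ← mul_assoc] at this
    rw [this, lintegral_mul_const _ (ha.mono (hZ.historySigma_le n) le_rfl),
      lintegral_const_mul _ hg]
  refine ⟨(ha.mono (historySigma_mono (Nat.le_succ n)) le_rfl).mul
    (measurable_coinInd_historySigma (Nat.lt_succ_self n) _), fun g hg => ?_⟩
  have h1 := h (fun _ => 1) measurable_const
  simp only [mul_one, lintegral_const, measure_univ] at h1
  rw [h g hg, h1, mul_assoc]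

/-- Each failure applies `kernelStep` once. The displacement accumulated so far is carried as an
extra coordinate, so a function of the whole excursion stays a function of the current state of this
enlarged chain. -/
lemma IsRegenerativeCoupling.lintegral_failInd (hZ : IsRegenerativeCoupling P κ ν γ Z η)
    (hk : Measurable k)
    (hres : ∀ z, ENNReal.ofReal (1 - γ) • residual κ ν γ z = ν.withDensity fun w => k (z, w))
    {t : ℕ} {a : Ω → ℝ≥0∞} (ha : IsFreshAt P ν Z η t a) (l : ℕ)
    {φ : (Plane × Plane) × (Path × Path) → ℝ≥0∞} (hφ : Measurable φ) :
    ∫⁻ ω, a ω * failInd η t l ω * φ (excursion Z t l ω, Z (t + l) ω) ∂P =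
      (∫⁻ ω, a ω ∂P) * ∫⁻ z, (kernelStep ν k)^[l] φ (displacement z, z) ∂ν := by
  induction l generalizing φ with
  | zero =>
    have := ha.fresh (fun z => φ (displacement z, z))
      (hφ.comp (measurable_displacement.prodMk measurable_id))
    simpa [failInd, excursion] using this
  | succ l ih =>
    rw [Function.iterate_succ_apply, ← ih (measurable_kernelStep hk hφ)]
    have hm : Measurable[historySigma Z η (t + l)] fun ω => a ω * failInd η t l ω :=
      (ha.measurable.mono (historySigma_mono (Nat.le_add_right t l)) le_rfl).mul
        (measurable_failInd_historySigma t l)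
    have := hZ.lintegral_step hk hres (t + l) false hm
      (measurable_excursion_historySigma t l)
      (φ := fun q => φ (q.1 + displacement q.2, q.2))
      (hφ.comp ((measurable_fst.add (measurable_displacement.comp measurable_snd)).prodMk
        measurable_snd))
    simp only [coinDensity, Bool.false_eq_true, if_false] at this
    simp only [kernelStep]
    rw [← this]
    refine lintegral_congr fun ω => ?_
    have h1 : failInd η t (l + 1) ω = failInd η t l ω * coinInd η false (t + l + 1) ω :=
      Finset.prod_range_succ _ _
    have h2 : excursion Z t (l + 1) ω = excursion Z t l ω + displacement (Z (t + l + 1) ω) :=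
      Finset.sum_range_succ _ _
    rw [h1, h2]
    simp only [← add_assoc]
    ring

/-- The law of a block between consecutive regenerations, as a functional. -/
def blockFunctional (ν : Measure (Path × Path)) (γ : ℝ)
    (k : (Path × Path) × (Path × Path) → ℝ≥0∞) (F : Plane × Plane → ℝ≥0∞) : ℝ≥0∞ :=
  ∑' l, ENNReal.ofReal γ *
    ∫⁻ z, (kernelStep ν k)^[l] (fun q => F q.1) (displacement z, z) ∂ν

/-- Decomposing according to the length l of the first block keeps all times deterministic, so no
strong Markov property is needed. After l failures and a success the state is fresh again, and the
induction continues with the enlarged weight. -/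
lemma IsRegenerativeCoupling.lintegral_blockProduct (hZ : IsRegenerativeCoupling P κ ν γ Z η)
    (hk : Measurable k)
    (hres : ∀ z, ENNReal.ofReal (1 - γ) • residual κ ν γ z = ν.withDensity fun w => k (z, w))
    (n : ℕ) {F : ℕ → Plane × Plane → ℝ≥0∞} (hF : ∀ i, Measurable (F i))
    {t : ℕ} {a : Ω → ℝ≥0∞} (ha : IsFreshAt P ν Z η t a) :
    ∫⁻ ω, a ω * blockProduct Z η n F t ω ∂P =
      (∫⁻ ω, a ω ∂P) * ∏ i ∈ Finset.range n, blockFunctional ν γ k (F i) := by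
  induction n generalizing F t a with
  | zero => simp [blockProduct]
  | succ n ih =>
    have hmeas (l : ℕ) : Measurable[historySigma Z η (t + l)] fun ω =>
        a ω * failInd η t l ω * F 0 (excursion Z t l ω) :=
      ((ha.measurable.mono (historySigma_mono (Nat.le_add_right t l)) le_rfl).mul
        (measurable_failInd_historySigma t l)).mul
          ((hF 0).comp (measurable_excursion_historySigma t l))
    have hfr (l : ℕ) := hZ.isFreshAt_succ hk hres (hmeas l)
    have h1 (l : ℕ) : ∫⁻ ω, a ω * failInd η t l ω * F 0 (excursion Z t l ω) *
        coinInd η true (t + l + 1) ω ∂P = (∫⁻ ω, a ω ∂P) * (ENNReal.ofReal γ *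
          ∫⁻ z, (kernelStep ν k)^[l] (fun q => F 0 q.1) (displacement z, z) ∂ν) := by
      have hs := hZ.lintegral_step hk hres (t + l) true (hmeas l) (u := fun _ => 0)
        measurable_const (φ := fun _ => 1) measurable_const
      simp only [coinDensity, if_true, mul_one, lintegral_const, measure_univ] at hs
      rw [hs, lintegral_mul_const _ ((hmeas l).mono (hZ.historySigma_le _) le_rfl),
        hZ.lintegral_failInd hk hres ha l (φ := fun q => F 0 q.1) ((hF 0).comp measurable_fst)]
      ring
    calc ∫⁻ ω, a ω * blockProduct Z η (n + 1) F t ω ∂P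
        = ∑' l, ∫⁻ ω, a ω * failInd η t l ω * F 0 (excursion Z t l ω) *
            coinInd η true (t + l + 1) ω *
            blockProduct Z η n (fun i => F (i + 1)) (t + l + 1) ω ∂P := by
          refine Eq.trans (lintegral_congr fun ω => ?_) (lintegral_tsum fun l =>
            (((hfr l).measurable.mono (hZ.historySigma_le _) le_rfl).mul
              (hZ.measurable_blockProduct n (fun i => hF (i + 1)) (t + l + 1))).aemeasurable)
          rw [blockProduct, ← ENNReal.tsum_mul_left]
          exact tsum_congr fun l => by ring
      _ = ∑' l, (∫⁻ ω, a ω ∂P) * (ENNReal.ofReal γ *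
            ∫⁻ z, (kernelStep ν k)^[l] (fun q => F 0 q.1) (displacement z, z) ∂ν) *
            ∏ i ∈ Finset.range n, blockFunctional ν γ k (F (i + 1)) :=
          tsum_congr fun l => by rw [ih (fun i => hF (i + 1)) (hfr l), h1 l]
      _ = _ := by
          rw [ENNReal.tsum_mul_right, ENNReal.tsum_mul_left, Finset.prod_range_succ', mul_assoc,
            mul_comm (∏ i ∈ Finset.range n, _)]
          rfl

end coupling

end KR

end


/-! ### Regeneration times, and the iid property of the blocks. -/

noncomputable section

namespace KR

open scoped ENNReal

section times

/-- The sequence of coins shows infinitely many successes. -/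
def HasSuccesses (η : ℕ → Bool) : Prop := ∀ n, ∃ j, n < j ∧ η j = true

variable {η : ℕ → Bool}

lemma HasSuccesses.regTime_succ_mem (h : HasSuccesses η) (i : ℕ) :
    regTime η i < regTime η (i + 1) ∧ η (regTime η (i + 1)) = true :=
  Nat.sInf_mem (s := {j | regTime η i < j ∧ η j = true}) (h _)

lemma eq_false_of_lt_regTime_succ {i j : ℕ} (h1 : regTime η i < j) (h2 : j < regTime η (i + 1)) :
    η j = false := by
  by_contra h
  exact Nat.notMem_of_lt_sInf (s := {j | regTime η i < j ∧ η j = true}) h2 ⟨h1, by simpa using h⟩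

lemma HasSuccesses.strictMono_regTime (h : HasSuccesses η) : StrictMono (regTime η) :=
  strictMono_nat_of_lt_succ fun i => (h.regTime_succ_mem i).1

variable {Ω : Type*} {Z : ℕ → Ω → Path × Path} {η : ℕ → Ω → Bool}

/-- The total displacement between the `i`-th and the next regeneration. -/
def regBlock (Z : ℕ → Ω → Path × Path) (η : ℕ → Ω → Bool) (i : ℕ) (ω : Ω) : Plane × Plane :=
  ∑ j ∈ Finset.Ico (regTime (fun n => η n ω) i) (regTime (fun n => η n ω) (i + 1)),
    displacement (Z j ω)

/-- Started at a regeneration time, the series in `blockProduct` has a single nonzero term, namely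
the one whose l is the actual number of failures before the next success. -/
lemma blockProduct_regTime {ω : Ω} (h : HasSuccesses fun n => η n ω) (n : ℕ)
    (F : ℕ → Plane × Plane → ℝ≥0∞) (i : ℕ) :
    blockProduct Z η n F (regTime (fun n => η n ω) i) ω =
      ∏ j ∈ Finset.range n, F j (regBlock Z η (i + j) ω) := by
  induction n generalizing F i with
  | zero => simp [blockProduct]
  | succ n ih =>
    set T := regTime (fun n => η n ω) with hT
    have hlt : T i < T (i + 1) := (h.regTime_succ_mem i).1
    have htrue : η (T (i + 1)) ω = true := (h.regTime_succ_mem i).2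
    have hfalse (j : ℕ) (h1 : T i < j) (h2 : j < T (i + 1)) : η j ω = false :=
      eq_false_of_lt_regTime_succ h1 h2
    obtain ⟨l, hl⟩ : ∃ l, T (i + 1) = T i + l + 1 := ⟨T (i + 1) - T i - 1, by omega⟩
    rw [blockProduct, tsum_eq_single l]
    · have h1 : failInd η (T i) l ω = 1 := Finset.prod_eq_one fun j hj => by
        have hj' := Finset.mem_range.1 hj
        have : η (T i + j + 1) ω = false := hfalse _ (by omega) (by omega)
        simp [coinInd, this]
      have h2 : coinInd η true (T i + l + 1) ω = 1 := by
        rw [← hl]; simp [coinInd, htrue]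
      have h3 : excursion Z (T i) l ω = regBlock Z η i ω := by
        rw [excursion, regBlock, Finset.sum_Ico_eq_sum_range]
        have : T (i + 1) - T i = l + 1 := by omega
        rw [← hT, this]
      rw [h1, h2, h3, ← hl, ih, Finset.prod_range_succ']
      simp only [one_mul, add_zero]
      rw [mul_comm]
      congr 1
      refine Finset.prod_congr rfl fun j _ => ?_
      rw [show i + 1 + j = i + (j + 1) by ring]
    · intro m hm
      rcases lt_or_gt_of_ne hm with hlt' | hgt
      · have : η (T i + m + 1) ω = false := hfalse _ (by omega) (by omega)
        simp [coinInd, this]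
      · have : failInd η (T i) m ω = 0 := by
          refine Finset.prod_eq_zero (Finset.mem_range.2 hgt) ?_
          rw [← hl]; simp [coinInd, htrue]
        simp [this]

lemma gluedPath_natCast (x : ℕ → Path) (n : ℕ) :
    gluedPath x n = ∑ i ∈ Finset.range n, (x i).at 1 := by
  have h0 : (⟨Int.fract (n : ℝ), Int.fract_nonneg _, (Int.fract_lt_one _).le⟩ : unitInterval) = 0 :=
    Subtype.ext (Int.fract_natCast n)
  rw [gluedPath, h0]
  have : (x ⌊(n : ℝ)⌋₊).at 0 = 0 := (x ⌊(n : ℝ)⌋₊).2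
  rw [this, add_zero, Nat.floor_natCast]

lemma sum_regBlock {ω : Ω} (h : HasSuccesses fun n => η n ω) (k : ℕ) :
    ∑ i ∈ Finset.range k, regBlock Z η i ω =
      ∑ j ∈ Finset.range (regTime (fun n => η n ω) k), displacement (Z j ω) := by
  induction k with
  | zero => simp [regTime]
  | succ k ih =>
    rw [Finset.sum_range_succ, ih, regBlock, Finset.range_eq_Ico,
      Finset.sum_Ico_consecutive _ (Nat.zero_le _) (h.strictMono_regTime (Nat.lt_succ_self k)).le]
    rw [Finset.range_eq_Ico]

lemma increment_eq_shiftedDiff {ω : Ω} (h : HasSuccesses fun n => η n ω) (k : ℕ) (d : ℤ) :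
    increment (fun n => Z n ω) (fun n => η n ω) k d = shiftedDiff (regBlock Z η) k d ω := by
  have hX (m : ℕ) : gluedPath (fun n => (Z n ω).1) (regTime (fun n => η n ω) m : ℝ) =
      posX (regBlock Z η) m ω := by
    rw [gluedPath_natCast, posX, ← Prod.fst_sum, sum_regBlock h, Prod.fst_sum]
    rfl
  have hY (m : ℕ) : gluedPath (fun n => (Z n ω).2) (regTime (fun n => η n ω) m : ℝ) =
      posY (regBlock Z η) m ω := by
    rw [gluedPath_natCast, posY, ← Prod.snd_sum, sum_regBlock h, Prod.snd_sum]
    rfl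
  rw [increment, shiftedDiff, hX, hY]

variable [MeasurableSpace Ω]

lemma measurable_regTime (hη : ∀ n, Measurable (η n)) (i : ℕ) :
    Measurable fun ω => regTime (fun n => η n ω) i := by
  induction i with
  | zero => exact measurable_const
  | succ i ih =>
    set T := fun ω => regTime (fun n => η n ω) i with hT
    have hS (j : ℕ) : MeasurableSet {ω | T ω < j ∧ η j ω = true} :=
      (ih (measurableSet_Iio (a := j))).inter (hη j (measurableSet_singleton true))
    refine measurable_to_nat fun ω₀ => ?_
    -- The second set in the union accounts for the value 0 that `sInf` takes when no later success
    -- exists.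
    have hpre (m : ℕ) : (fun ω => regTime (fun n => η n ω) (i + 1)) ⁻¹' {m} =
        ({ω | T ω < m ∧ η m ω = true} ∩ ⋂ j ∈ Finset.range m, {ω | T ω < j ∧ η j ω = true}ᶜ) ∪
          {ω | m = 0} ∩ ⋂ j, {ω | T ω < j ∧ η j ω = true}ᶜ := by
      ext ω
      simp only [Set.mem_preimage, Set.mem_singleton_iff, Set.mem_union, Set.mem_inter_iff,
        Set.mem_iInter, Set.mem_compl_iff, Finset.mem_range]
      change sInf {j | T ω < j ∧ η j ω = true} = m ↔
        ((m ∈ {j | T ω < j ∧ η j ω = true}) ∧ ∀ j < m, j ∉ {j | T ω < j ∧ η j ω = true}) ∨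
          (m = 0 ∧ ∀ j, j ∉ {j | T ω < j ∧ η j ω = true})
      constructor
      · rintro rfl
        rcases Set.eq_empty_or_nonempty {j | T ω < j ∧ η j ω = true} with h | h
        · right; simp [h]
        · left; exact ⟨Nat.sInf_mem h, fun j hj => Nat.notMem_of_lt_sInf hj⟩
      · rintro (⟨h1, h2⟩ | ⟨h1, h2⟩)
        · refine le_antisymm (Nat.sInf_le h1) ?_
          by_contra hlt
          exact h2 _ (not_le.1 hlt) (Nat.sInf_mem ⟨m, h1⟩)
        · rw [Set.eq_empty_of_forall_notMem h2, h1, Nat.sInf_empty]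
    rw [hpre]
    exact ((hS _).inter (Finset.measurableSet_biInter _ fun j _ => (hS j).compl)).union
      ((MeasurableSet.const _).inter (MeasurableSet.iInter fun j => (hS j).compl))

lemma measurable_regBlock (hη : ∀ n, Measurable (η n)) (hZ : ∀ n, Measurable (Z n)) (i : ℕ) :
    Measurable (regBlock Z η i) := by
  have h : Measurable fun q : (ℕ × ℕ) × Ω =>
      ∑ j ∈ Finset.Ico q.1.1 q.1.2, displacement (Z j q.2) :=
    measurable_from_prod_countable_right fun x =>
      Finset.measurable_fun_sum (Finset.Ico x.1 x.2) fun j _ => measurable_displacement.comp (hZ j)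
  exact h.comp (((measurable_regTime hη i).prodMk (measurable_regTime hη (i + 1))).prodMk
    measurable_id)

variable {P : Measure Ω} [IsProbabilityMeasure P]
  {κ : Path × Path → Measure (Path × Path)} {ν : Measure (Path × Path)} [IsProbabilityMeasure ν]
  {γ : ℝ} {k : (Path × Path) × (Path × Path) → ℝ≥0∞}

/-- A run of l failures after any given step has probability (1-γ)^l. -/
lemma IsRegenerativeCoupling.ae_hasSuccesses (hZ : IsRegenerativeCoupling P κ ν γ Z η)
    (hγ : γ ∈ Set.Ioo (0 : ℝ) 1) (hk : Measurable k)
    (hres : ∀ z, ENNReal.ofReal (1 - γ) • residual κ ν γ z = ν.withDensity fun w => k (z, w))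
    (hkint : ∀ z, ∫⁻ w, k (z, w) ∂ν = ENNReal.ofReal (1 - γ)) :
    ∀ᵐ ω ∂P, HasSuccesses fun n => η n ω := by
  refine ae_all_iff.2 fun n => ?_
  have hfail (l : ℕ) : ∫⁻ ω, failInd η n l ω ∂P = ENNReal.ofReal (1 - γ) ^ l := by
    induction l with
    | zero => simp [failInd]
    | succ l ih =>
      have := hZ.lintegral_step hk hres (n + l) false
        (measurable_failInd_historySigma (Z := Z) n l) (u := fun _ => 0) measurable_const
        (φ := fun _ => 1) measurable_const
      simp only [coinDensity, Bool.false_eq_true, if_false, mul_one, hkint] at this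
      rw [lintegral_mul_const _ (hZ.measurable_failInd n l), ih] at this
      rw [pow_succ, ← this]
      refine lintegral_congr fun ω => ?_
      exact Finset.prod_range_succ _ _
  set B : Set Ω := {ω | ∀ j, η (n + j + 1) ω = false} with hB
  have hBm : MeasurableSet B := by
    have : B = ⋂ j, {ω | η (n + j + 1) ω = false} := by ext; simp [hB]
    rw [this]
    exact MeasurableSet.iInter fun j => hZ.measurable_coin _ (measurableSet_singleton false)
  have hsub (l : ℕ) : P B ≤ ENNReal.ofReal (1 - γ) ^ l := by
    rw [← hfail l, ← lintegral_indicator_one hBm]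
    refine lintegral_mono fun ω => ?_
    by_cases h : ω ∈ B
    · rw [Set.indicator_of_mem h]
      exact le_of_eq (Finset.prod_eq_one fun j _ => by simp [coinInd, h j]).symm
    · rw [Set.indicator_of_notMem h]; exact zero_le
  have hB0 : P B = 0 := by
    refine le_antisymm (ge_of_tendsto' (ENNReal.tendsto_pow_atTop_nhds_zero_of_lt_one ?_) hsub)
      zero_le
    rw [← ENNReal.ofReal_one]
    exact (ENNReal.ofReal_lt_ofReal_iff one_pos).2 (by linarith [hγ.1])
  refine measure_mono_null (t := B) (fun ω hω => ?_) hB0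
  intro j
  by_contra h
  exact hω ⟨n + j + 1, by omega, by simpa using h⟩

/-- This product formula contains both the independence of the blocks and their common law. -/
lemma IsRegenerativeCoupling.lintegral_prod_regBlock (hZ : IsRegenerativeCoupling P κ ν γ Z η)
    (hγ : γ ∈ Set.Ioo (0 : ℝ) 1) (hk : Measurable k)
    (hres : ∀ z, ENNReal.ofReal (1 - γ) • residual κ ν γ z = ν.withDensity fun w => k (z, w))
    (hkint : ∀ z, ∫⁻ w, k (z, w) ∂ν = ENNReal.ofReal (1 - γ)) (n : ℕ)
    {F : ℕ → Plane × Plane → ℝ≥0∞} (hF : ∀ i, Measurable (F i)) :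
    ∫⁻ ω, ∏ i ∈ Finset.range n, F i (regBlock Z η i ω) ∂P =
      ∏ i ∈ Finset.range n, blockFunctional ν γ k (F i) := by
  have := hZ.lintegral_blockProduct hk hres n hF hZ.isFreshAt_zero
  simp only [one_mul, lintegral_const, measure_univ] at this
  rw [← this]
  refine lintegral_congr_ae ?_
  filter_upwards [hZ.ae_hasSuccesses hγ hk hres hkint] with ω hω
  have := blockProduct_regTime (Z := Z) hω n F 0
  simpa [regTime] using this.symm

lemma IsRegenerativeCoupling.blockFunctional_one (hZ : IsRegenerativeCoupling P κ ν γ Z η)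
    (hγ : γ ∈ Set.Ioo (0 : ℝ) 1) (hk : Measurable k)
    (hres : ∀ z, ENNReal.ofReal (1 - γ) • residual κ ν γ z = ν.withDensity fun w => k (z, w))
    (hkint : ∀ z, ∫⁻ w, k (z, w) ∂ν = ENNReal.ofReal (1 - γ)) :
    blockFunctional ν γ k (fun _ => 1) = 1 := by
  have := hZ.lintegral_prod_regBlock hγ hk hres hkint 1 (F := fun _ _ => 1)
    fun _ => measurable_const
  simpa using this.symm

/-- Each block has the law given by `blockFunctional`. -/
lemma IsRegenerativeCoupling.lintegral_regBlock (hZ : IsRegenerativeCoupling P κ ν γ Z η)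
    (hγ : γ ∈ Set.Ioo (0 : ℝ) 1) (hk : Measurable k)
    (hres : ∀ z, ENNReal.ofReal (1 - γ) • residual κ ν γ z = ν.withDensity fun w => k (z, w))
    (hkint : ∀ z, ∫⁻ w, k (z, w) ∂ν = ENNReal.ofReal (1 - γ)) (i : ℕ)
    {f : Plane × Plane → ℝ≥0∞} (hf : Measurable f) :
    ∫⁻ ω, f (regBlock Z η i ω) ∂P = blockFunctional ν γ k f := by
  have := hZ.lintegral_prod_regBlock hγ hk hres hkint (i + 1)
    (F := fun j => if j = i then f else fun _ => 1)
    fun j => by split_ifs; exacts [hf, measurable_const]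
  rw [Finset.prod_eq_single i] at this
  · rw [if_pos rfl] at this
    rw [← this]
    refine lintegral_congr fun ω => ?_
    rw [Finset.prod_eq_single i]
    · rw [if_pos rfl]
    · intro j _ hj; rw [if_neg hj]
    · intro h; simp at h
  · intro j _ hj; rw [if_neg hj, hZ.blockFunctional_one hγ hk hres hkint]
  · intro h; simp at h

/-- The blocks are independent. -/
lemma IsRegenerativeCoupling.iIndepFun_regBlock (hZ : IsRegenerativeCoupling P κ ν γ Z η)
    (hγ : γ ∈ Set.Ioo (0 : ℝ) 1) (hk : Measurable k)
    (hres : ∀ z, ENNReal.ofReal (1 - γ) • residual κ ν γ z = ν.withDensity fun w => k (z, w))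
    (hkint : ∀ z, ∫⁻ w, k (z, w) ∂ν = ENNReal.ofReal (1 - γ)) :
    iIndepFun (regBlock Z η) P := by
  classical
  refine iIndepFun_iff_measure_inter_preimage_eq_mul.2 fun S sets hS => ?_
  have hmeas (i : ℕ) := measurable_regBlock hZ.measurable_coin hZ.measurable_state i
  obtain ⟨n, hn⟩ : ∃ n, S ⊆ Finset.range n :=
    ⟨S.sup id + 1, fun i hi => Finset.mem_range.2 (Nat.lt_succ_of_le (Finset.le_sup (f := id) hi))⟩
  -- Padding with the constant 1 outside `S` reduces a finite set of indices to an initial segment,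
  -- where the product formula applies.
  set F : ℕ → Plane × Plane → ℝ≥0∞ := fun i => if i ∈ S then (sets i).indicator 1 else fun _ => 1
    with hFdef
  have hF (i : ℕ) : Measurable (F i) := by
    simp only [hFdef]
    split_ifs with h
    · exact measurable_one.indicator (hS i h)
    · exact measurable_const
  have key := hZ.lintegral_prod_regBlock hγ hk hres hkint n hF
  have hprod (g : ℕ → ℝ≥0∞) (hg : ∀ i ∉ S, g i = 1) :
      ∏ i ∈ Finset.range n, g i = ∏ i ∈ S, g i :=
    (Finset.prod_subset hn fun i _ hi => hg i hi).symm
  rw [hprod (fun i => blockFunctional ν γ k (F i)) fun i hi => by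
    simp only [hFdef, if_neg hi]; exact hZ.blockFunctional_one hγ hk hres hkint] at key
  have hset : MeasurableSet (⋂ i ∈ S, regBlock Z η i ⁻¹' sets i) :=
    Finset.measurableSet_biInter _ fun i hi => hmeas i (hS i hi)
  have hleft : ∫⁻ ω, ∏ i ∈ Finset.range n, F i (regBlock Z η i ω) ∂P =
      P (⋂ i ∈ S, regBlock Z η i ⁻¹' sets i) := by
    rw [← lintegral_indicator_one hset]
    refine lintegral_congr fun ω => ?_
    rw [hprod (fun i => F i (regBlock Z η i ω)) fun i hi => by simp only [hFdef, if_neg hi]]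
    by_cases h : ω ∈ ⋂ i ∈ S, regBlock Z η i ⁻¹' sets i
    · rw [Set.indicator_of_mem h]
      refine Finset.prod_eq_one fun i hi => ?_
      have : regBlock Z η i ω ∈ sets i := by
        simp only [Set.mem_iInter] at h; exact h i hi
      simp [hFdef, hi, this]
    · rw [Set.indicator_of_notMem h]
      simp only [Set.mem_iInter, not_forall] at h
      obtain ⟨i, hi, h⟩ := h
      have : regBlock Z η i ω ∉ sets i := h
      exact Finset.prod_eq_zero hi (by simp [hFdef, hi, this])
  rw [← hleft, key]
  refine Finset.prod_congr rfl fun i hi => ?_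
  rw [← hZ.lintegral_regBlock hγ hk hres hkint i (hF i),
    ← lintegral_indicator_one (hmeas i (hS i hi))]
  refine lintegral_congr fun ω => ?_
  simp only [hFdef, if_pos hi]
  rfl

end times

end KR

end


/-! ### The law of a block: comparison with geometric mixtures of Gaussian convolutions. -/

noncomputable section

namespace KR

open scoped ENNReal

section gaussian

/-- The difference of the two coordinates. -/
def diffHom : Plane × Plane →+ Plane := AddMonoidHom.fst Plane Plane - AddMonoidHom.snd Plane Plane

lemma diffHom_apply (x : Plane × Plane) : diffHom x = x.1 - x.2 := rfl

lemma measurable_diffHom : Measurable diffHom :=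
  (measurable_fst.sub measurable_snd : Measurable fun x : Plane × Plane => x.1 - x.2)

variable {W : Measure Path}

lemma IsWiener.charFun_endpoint (hW : IsWiener W) (ξ : Plane) :
    charFun (W.map fun x => x.at 1) ξ = Real.exp (-‖ξ‖ ^ 2 / 2) := by
  have h := hW.gaussian 0 1 zero_le_one
  have h0 : (fun x : Path => x.at 1 - x.at 0) = fun x => x.at 1 := by
    ext1 x
    have : x.at 0 = 0 := x.2
    rw [this, sub_zero]
  rw [h0] at h
  rw [h]
  have h1 : (((1 : unitInterval) : ℝ) - ((0 : unitInterval) : ℝ)) •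
      (1 : Matrix (Fin 2) (Fin 2) ℝ) = 1 := by simp
  rw [h1, charFun_multivariateGaussian Matrix.PosSemidef.one]
  have h2 : (ξ.ofLp ⬝ᵥ (1 : Matrix (Fin 2) (Fin 2) ℝ).mulVec ξ.ofLp) = ‖ξ‖ ^ 2 := by
    rw [Matrix.one_mulVec, EuclideanSpace.norm_sq_eq]
    simp [dotProduct, pow_two]
  rw [h2]
  push_cast
  simp [neg_div]

/-- The difference of two independent standard Gaussian endpoints has covariance 2I; this is the
Gaussian component in `IsStepLaw`. -/
lemma IsWiener.charFun_diff (hW : IsWiener W) (ξ : Plane) :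
    charFun (((W.prod W).map displacement).map diffHom) ξ = Real.exp (-‖ξ‖ ^ 2) := by
  have := hW.isProbabilityMeasure
  rw [charFun_apply, integral_map measurable_diffHom.aemeasurable (by fun_prop),
    integral_map measurable_displacement.aemeasurable]
  · have h (z : Path × Path) : Complex.exp (inner ℝ (diffHom (displacement z)) ξ * Complex.I) =
        Complex.exp (inner ℝ (z.1.at 1) ξ * Complex.I) *
          Complex.exp (inner ℝ (z.2.at 1) (-ξ) * Complex.I) := by
      rw [← Complex.exp_add, diffHom_apply, inner_sub_left, inner_neg_right]
      simp only [displacement]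
      push_cast
      ring_nf
    simp only [h]
    rw [integral_prod_mul (fun x : Path => Complex.exp (inner ℝ (x.at 1) ξ * Complex.I))
      (fun x : Path => Complex.exp (inner ℝ (x.at 1) (-ξ) * Complex.I))]
    have h1 (ζ : Plane) : ∫ x : Path, Complex.exp (inner ℝ (x.at 1) ζ * Complex.I) ∂W =
        Real.exp (-‖ζ‖ ^ 2 / 2) := by
      rw [← hW.charFun_endpoint, charFun_apply, integral_map (measurable_path_at 1).aemeasurable
        (by fun_prop)]
    rw [h1, h1, norm_neg, ← Complex.ofReal_mul, ← Real.exp_add]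
    ring_nf
  · have := measurable_diffHom
    exact Measurable.aestronglyMeasurable (by fun_prop)

end gaussian

section sandwich

variable {ν : Measure (Path × Path)} {γ a : ℝ}
  {k k' : (Path × Path) × (Path × Path) → ℝ≥0∞}

lemma kernelStep_mono (h : ∀ q, k q ≤ k' q) {φ φ' : (Plane × Plane) × (Path × Path) → ℝ≥0∞}
    (hφ : ∀ q, φ q ≤ φ' q) (q) : kernelStep ν k φ q ≤ kernelStep ν k' φ' q :=
  lintegral_mono fun _ => mul_le_mul' (h _) (hφ _)

/-- Monotonicity in the kernel lets a failure density close to 1 - γ be replaced by the constants 1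
- γ ∓ θ, for which the block law is explicit. -/
lemma blockFunctional_mono (h : ∀ q, k q ≤ k' q) (F : Plane × Plane → ℝ≥0∞) :
    blockFunctional ν γ k F ≤ blockFunctional ν γ k' F := by
  refine ENNReal.tsum_le_tsum fun l => mul_le_mul' le_rfl (lintegral_mono fun z => ?_)
  have (l : ℕ) : ∀ q, (kernelStep ν k)^[l] (fun q => F q.1) q ≤
      (kernelStep ν k')^[l] (fun q => F q.1) q := by
    induction l with
    | zero => exact fun q => le_rfl
    | succ l ih =>
      intro q
      rw [Function.iterate_succ_apply', Function.iterate_succ_apply']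
      exact kernelStep_mono h ih q
  exact this l _

lemma lintegral_swap_of_map_eq (hν : ν.map Prod.swap = ν) (f : Path × Path → ℝ≥0∞) :
    ∫⁻ z, f z.swap ∂ν = ∫⁻ z, f z ∂ν := by
  have e : ν = ν.map (MeasurableEquiv.prodComm : (Path × Path) ≃ᵐ (Path × Path)) := hν.symm
  conv_rhs => rw [e]
  rw [lintegral_map_equiv]
  rfl

lemma kernelStep_swap (hν : ν.map Prod.swap = ν) (hk : ∀ z w, k (z.swap, w.swap) = k (z, w))
    (φ : (Plane × Plane) × (Path × Path) → ℝ≥0∞) (q) :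
    kernelStep ν k (fun q => φ (q.1.swap, q.2.swap)) q =
      kernelStep ν k φ (q.1.swap, q.2.swap) := by
  refine Eq.trans (lintegral_congr fun w => ?_) (lintegral_swap_of_map_eq hν _)
  change _ = k (q.2.swap, w.swap) * φ (q.1.swap + displacement w.swap, w.swap)
  rw [hk]
  rfl

lemma blockFunctional_swap (hν : ν.map Prod.swap = ν)
    (hk : ∀ z w, k (z.swap, w.swap) = k (z, w)) (F : Plane × Plane → ℝ≥0∞) :
    blockFunctional ν γ k (fun x => F x.swap) = blockFunctional ν γ k F := by
  have key (l : ℕ) : (kernelStep ν k)^[l] (fun q => F q.1.swap) =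
      fun q => (kernelStep ν k)^[l] (fun q => F q.1) (q.1.swap, q.2.swap) := by
    induction l with
    | zero => rfl
    | succ l ih =>
      rw [Function.iterate_succ_apply', Function.iterate_succ_apply', ih]
      ext q
      exact kernelStep_swap hν hk _ q
  refine tsum_congr fun l => ?_
  congr 1
  rw [key, ← lintegral_swap_of_map_eq hν]
  rfl

variable [IsProbabilityMeasure ν]

/-- The law of a block for the constant kernel `a`: a geometric mixture of convolution powers of
the law of the displacement. -/
def constLaw (ν : Measure (Path × Path)) (γ a : ℝ) : Measure (Plane × Plane) :=
  Measure.sum fun l : ℕ => ENNReal.ofReal (γ * a ^ l) • convPow (ν.map displacement) (l + 1)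

lemma kernelStep_const_iterate (ha : 0 ≤ a) {F : Plane × Plane → ℝ≥0∞} (hF : Measurable F) (l : ℕ)
    (q) : (kernelStep ν fun _ => ENNReal.ofReal a)^[l] (fun q => F q.1) q =
      ENNReal.ofReal (a ^ l) * ∫⁻ x, F (q.1 + x) ∂(convPow (ν.map displacement) l) := by
  have : IsProbabilityMeasure (ν.map displacement) :=
    Measure.isProbabilityMeasure_map measurable_displacement.aemeasurable
  induction l generalizing q with
  | zero => simp [convPow]
  | succ l ih =>
    have hF2 : Measurable fun x => F (q.1 + x) := hF.comp (measurable_const_add q.1)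
    have hF3 : Measurable fun p : (Plane × Plane) × (Plane × Plane) => F (q.1 + (p.1 + p.2)) :=
      hF2.comp (measurable_fst.add measurable_snd)
    have hF4 : Measurable fun x => ∫⁻ y, F (q.1 + (x + y)) ∂(convPow (ν.map displacement) l) :=
      hF3.lintegral_prod_right'
    have hF5 : Measurable fun w => ∫⁻ y, F (q.1 + (displacement w + y))
        ∂(convPow (ν.map displacement) l) := hF4.comp measurable_displacement
    rw [Function.iterate_succ_apply', kernelStep]
    simp only [ih]
    rw [convPow, Measure.lintegral_conv hF2, lintegral_map hF4 measurable_displacement,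
      ← lintegral_const_mul _ hF5]
    refine lintegral_congr fun w => ?_
    simp only [add_assoc]
    rw [← mul_assoc, ← ENNReal.ofReal_mul ha, pow_succ' a l]

lemma blockFunctional_const (hγ : 0 ≤ γ) (ha : 0 ≤ a) {F : Plane × Plane → ℝ≥0∞}
    (hF : Measurable F) :
    blockFunctional ν γ (fun _ => ENNReal.ofReal a) F = ∫⁻ x, F x ∂(constLaw ν γ a) := by
  have : IsProbabilityMeasure (ν.map displacement) :=
    Measure.isProbabilityMeasure_map measurable_displacement.aemeasurable
  rw [constLaw, lintegral_sum_measure]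
  refine tsum_congr fun l => ?_
  have hF3 : Measurable fun p : (Plane × Plane) × (Plane × Plane) => F (p.1 + p.2) :=
    hF.comp (measurable_fst.add measurable_snd)
  have hF4 : Measurable fun x => ∫⁻ y, F (x + y) ∂(convPow (ν.map displacement) l) :=
    hF3.lintegral_prod_right'
  have hF5 : Measurable fun w => ∫⁻ y, F (displacement w + y)
      ∂(convPow (ν.map displacement) l) := hF4.comp measurable_displacement
  rw [lintegral_smul_measure, convPow, Measure.lintegral_conv hF,
    lintegral_map hF4 measurable_displacement]
  simp only [kernelStep_const_iterate ha hF]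
  rw [lintegral_const_mul _ hF5, ← mul_assoc,
    ← ENNReal.ofReal_mul hγ, smul_eq_mul]

lemma map_convPow {E E' : Type*} [AddMonoid E] [MeasurableSpace E] [MeasurableAdd₂ E]
    [AddMonoid E'] [MeasurableSpace E'] [MeasurableAdd₂ E'] (μ : Measure E) [IsFiniteMeasure μ]
    (L : E →+ E') (hL : Measurable L) (n : ℕ) :
    (convPow μ n).map L = convPow (μ.map L) n := by
  induction n with
  | zero => simp [convPow, Measure.map_dirac' hL]
  | succ n ih => rw [convPow, Measure.map_conv_addMonoidHom L hL, ih, convPow]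

end sandwich

section steplaw

/-- Since 1 - cos is nonnegative, its integral is monotone in the measure; since it vanishes to
second order at ξ = 0, comparison measures of total mass different from 1 still give sharp bounds
near ξ = 0. -/
lemma lintegral_one_sub_cos (μ : Measure Plane) [IsProbabilityMeasure μ] (ξ : Plane) :
    ∫⁻ x, ENNReal.ofReal (1 - Real.cos (inner ℝ x ξ)) ∂μ =
      ENNReal.ofReal (1 - (charFun μ ξ).re) := by
  have hint : Integrable (fun x : Plane => Complex.exp (inner ℝ x ξ * Complex.I)) μ := by
    refine Integrable.of_bound (C := 1) (by fun_prop) (ae_of_all _ fun x => ?_)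
    rw [Complex.norm_exp_ofReal_mul_I]
  have hcos : Integrable (fun x : Plane => Real.cos (inner ℝ x ξ)) μ := by
    refine Integrable.of_bound (C := 1) (by fun_prop) (ae_of_all _ fun x => ?_)
    exact Real.abs_cos_le_one _
  have hre : (charFun μ ξ).re = ∫ x : Plane, Real.cos (inner ℝ x ξ) ∂μ := by
    rw [charFun_apply]
    have := integral_re (𝕜 := ℂ) hint
    simp only [RCLike.re_to_complex, Complex.exp_ofReal_mul_I_re] at this
    exact this.symm
  have hsub : Integrable (fun x : Plane => 1 - Real.cos (inner ℝ x ξ)) μ :=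
    (integrable_const _).sub hcos
  rw [← ofReal_integral_eq_lintegral_ofReal hsub
    (ae_of_all _ fun x => sub_nonneg.2 (Real.cos_le_one _)), integral_sub (integrable_const _) hcos,
    hre]
  simp

variable {W : Measure Path} {γ a : ℝ}

lemma tsum_geometric_mul_one_sub_exp (ha : a ∈ Set.Ico (0 : ℝ) 1) {s : ℝ} (hs : 0 ≤ s) :
    HasSum (fun l : ℕ => γ * a ^ l * (1 - Real.exp (-s) ^ (l + 1)))
      (γ * (1 - Real.exp (-s)) / ((1 - a) * (1 - a * Real.exp (-s)))) := by
  set y := Real.exp (-s) with hy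
  have hy0 : 0 < y := Real.exp_pos _
  have hy1 : y ≤ 1 := Real.exp_le_one_iff.2 (by linarith)
  have hay : a * y < 1 := by nlinarith [ha.1, ha.2]
  have h1 := hasSum_geometric_of_lt_one ha.1 ha.2
  have h2 := hasSum_geometric_of_lt_one (mul_nonneg ha.1 hy0.le) hay
  have h3 := (h1.mul_left γ).sub (h2.mul_left (γ * y))
  have e : γ * (1 - y) / ((1 - a) * (1 - a * y)) = γ * (1 - a)⁻¹ - γ * y * (1 - a * y)⁻¹ := by
    have h4 : 1 - a ≠ 0 := by linarith [ha.2]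
    have h5 : 1 - a * y ≠ 0 := by linarith
    rw [← div_eq_mul_inv, ← div_eq_mul_inv, div_sub_div _ _ h4 h5]
    ring
  rw [e]
  refine h3.congr_fun fun l => ?_
  rw [mul_pow, pow_succ]
  ring

/-- The mixture is Σ γ a^l N^{*(l+1)}, so the integral is a difference of two geometric series. For
a = 1 - γ it behaves like |ξ|²/γ as ξ → 0. -/
lemma IsWiener.lintegral_one_sub_cos_constLaw (hW : IsWiener W) (hγ : 0 ≤ γ)
    (ha : a ∈ Set.Ico (0 : ℝ) 1) (ξ : Plane) :
    ∫⁻ x, ENNReal.ofReal (1 - Real.cos (inner ℝ (diffHom x) ξ)) ∂(constLaw (W.prod W) γ a) =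
      ENNReal.ofReal (γ * (1 - Real.exp (-‖ξ‖ ^ 2)) /
        ((1 - a) * (1 - a * Real.exp (-‖ξ‖ ^ 2)))) := by
  have := hW.isProbabilityMeasure
  have h1 : IsProbabilityMeasure ((W.prod W).map displacement) :=
    Measure.isProbabilityMeasure_map measurable_displacement.aemeasurable
  have h2 : IsProbabilityMeasure (((W.prod W).map displacement).map diffHom) :=
    Measure.isProbabilityMeasure_map measurable_diffHom.aemeasurable
  have hy1 : Real.exp (-‖ξ‖ ^ 2) ≤ 1 := Real.exp_le_one_iff.2 (by nlinarith [sq_nonneg ‖ξ‖])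
  have hmeas : Measurable fun x : Plane => ENNReal.ofReal (1 - Real.cos (inner ℝ x ξ)) := by
    fun_prop
  have hsum := tsum_geometric_mul_one_sub_exp (γ := γ) ha (sq_nonneg ‖ξ‖)
  rw [constLaw, lintegral_sum_measure, ← hsum.tsum_eq, ENNReal.ofReal_tsum_of_nonneg _ hsum.summable]
  · refine tsum_congr fun l => ?_
    rw [lintegral_smul_measure, ← lintegral_map (f := fun x : Plane =>
      ENNReal.ofReal (1 - Real.cos (inner ℝ x ξ))) hmeas measurable_diffHom,
      map_convPow _ _ measurable_diffHom, lintegral_one_sub_cos, charFun_convPow, hW.charFun_diff,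
      ← Complex.ofReal_pow, Complex.ofReal_re, smul_eq_mul,
      ENNReal.ofReal_mul (mul_nonneg hγ (pow_nonneg ha.1 l))]
  · intro l
    exact mul_nonneg (mul_nonneg hγ (pow_nonneg ha.1 l))
      (sub_nonneg.2 (pow_le_one₀ (Real.exp_pos _).le hy1))

lemma constLaw_univ (ν : Measure (Path × Path)) [IsProbabilityMeasure ν] (hγ : 0 ≤ γ)
    (ha : a ∈ Set.Ico (0 : ℝ) 1) : constLaw ν γ a Set.univ = ENNReal.ofReal (γ / (1 - a)) := by
  have h1 : IsProbabilityMeasure (ν.map displacement) :=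
    Measure.isProbabilityMeasure_map measurable_displacement.aemeasurable
  have hsum := (hasSum_geometric_of_lt_one ha.1 ha.2).mul_left γ
  rw [constLaw, Measure.sum_apply _ MeasurableSet.univ, div_eq_mul_inv, ← hsum.tsum_eq,
    ENNReal.ofReal_tsum_of_nonneg (fun l => mul_nonneg hγ (pow_nonneg ha.1 l)) hsum.summable]
  simp

lemma smul_le_constLaw (ν : Measure (Path × Path)) [IsProbabilityMeasure ν] (γ a : ℝ) :
    ENNReal.ofReal γ • ν.map displacement ≤ constLaw ν γ a := by
  have h1 : IsProbabilityMeasure (ν.map displacement) :=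
    Measure.isProbabilityMeasure_map measurable_displacement.aemeasurable
  refine le_trans (le_of_eq ?_) (Measure.le_sum _ 0)
  simp [convPow]

/-- Exchanging the two copies changes the sign of the difference, so the law of the difference is
symmetric. -/
lemma im_charFun_eq_zero {m : Measure (Plane × Plane)} (hm : m.map Prod.swap = m) (ξ : Plane) :
    (charFun (m.map diffHom) ξ).im = 0 := by
  have h : charFun (m.map diffHom) (-ξ) = charFun (m.map diffHom) ξ := by
    rw [charFun_apply, charFun_apply, integral_map measurable_diffHom.aemeasurable (by fun_prop),
      integral_map measurable_diffHom.aemeasurable (by fun_prop)]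
    conv_rhs => rw [← hm]
    have hd := measurable_diffHom
    rw [integral_map measurable_swap.aemeasurable (Measurable.aestronglyMeasurable (by fun_prop))]
    refine integral_congr_ae (ae_of_all _ fun x => ?_)
    simp only [diffHom_apply, Prod.fst_swap, Prod.snd_swap, inner_neg_right]
    rw [← inner_neg_left, neg_sub]
  rw [charFun_neg] at h
  exact Complex.conj_eq_iff_im.1 h

/-- A choice of the size of the perturbation of the geometric law. -/
lemma exists_perturbation {τ : ℝ} (hγ : γ ∈ Set.Ioo (0 : ℝ) 1) (hτ : τ ∈ Set.Ioo (0 : ℝ) 1) :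
    ∃ θ > 0, θ < γ ∧ θ ≤ 1 - γ ∧ γ ^ 2 * (1 + (1 + τ) / γ * θ) ≤ (1 + τ) * (γ - θ) ^ 2 ∧
      (1 - τ) * (γ + θ) * (γ + 2 * θ) * (1 + θ) ≤ γ ^ 2 := by
  have hγ0 := hγ.1
  have h2 : 0 < γ ^ 2 := by positivity
  -- At θ = 0 the two required inequalities read γ² < (1+τ)γ² and (1-τ)γ² < γ², so they persist for
  -- small θ by continuity.
  have t1 : Tendsto (fun θ : ℝ => (1 + τ) * (γ - θ) ^ 2 - γ ^ 2 * (1 + (1 + τ) / γ * θ))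
      (𝓝[>] 0) (𝓝 ((1 + τ) * (γ - 0) ^ 2 - γ ^ 2 * (1 + (1 + τ) / γ * 0))) :=
    (Continuous.tendsto (by fun_prop) 0).mono_left nhdsWithin_le_nhds
  have t2 : Tendsto (fun θ : ℝ => γ ^ 2 - (1 - τ) * (γ + θ) * (γ + 2 * θ) * (1 + θ))
      (𝓝[>] 0) (𝓝 (γ ^ 2 - (1 - τ) * (γ + 0) * (γ + 2 * 0) * (1 + 0))) :=
    (Continuous.tendsto (by fun_prop) 0).mono_left nhdsWithin_le_nhds
  have e1 : ∀ᶠ θ in 𝓝[>] (0 : ℝ), θ ∈ Set.Ioo 0 γ := Ioo_mem_nhdsGT hγ0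
  have e2 : ∀ᶠ θ in 𝓝[>] (0 : ℝ), θ ∈ Set.Ioo 0 (1 - γ) := Ioo_mem_nhdsGT (sub_pos.2 hγ.2)
  obtain ⟨θ, h3, h4, h5, h6⟩ := ((t1.eventually (lt_mem_nhds (a := 0) (by nlinarith [hτ.1]))).and
    ((t2.eventually (lt_mem_nhds (a := 0) (by nlinarith [hτ.1]))).and
      (e1.and e2))).exists
  exact ⟨θ, h5.1, h5.2, h6.2.le, by linarith, by linarith⟩

/-- A symmetric block law that is close to the geometric mixture gives a step law. -/
lemma IsWiener.isStepLaw (hW : IsWiener W) {τ θ : ℝ} (hγ : γ ∈ Set.Ioo (0 : ℝ) 1)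
    (hτ : τ ∈ Set.Ioo (0 : ℝ) 1) (hθ0 : 0 < θ) (hθγ : θ < γ) (hθ1 : θ ≤ 1 - γ)
    (h1 : γ ^ 2 * (1 + (1 + τ) / γ * θ) ≤ (1 + τ) * (γ - θ) ^ 2)
    (h2 : (1 - τ) * (γ + θ) * (γ + 2 * θ) * (1 + θ) ≤ γ ^ 2)
    {m : Measure (Plane × Plane)} [IsProbabilityMeasure m]
    (hlow : constLaw (W.prod W) γ (1 - γ - θ) ≤ m) (hup : m ≤ constLaw (W.prod W) γ (1 - γ + θ))
    (hm : m.map Prod.swap = m) : IsStepLaw γ τ θ (m.map diffHom) := by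
  have := hW.isProbabilityMeasure
  have hp1 : IsProbabilityMeasure ((W.prod W).map displacement) :=
    Measure.isProbabilityMeasure_map measurable_displacement.aemeasurable
  have hp2 : IsProbabilityMeasure (m.map diffHom) :=
    Measure.isProbabilityMeasure_map measurable_diffHom.aemeasurable
  have hγ0 := hγ.1
  have hmeas (ξ : Plane) : Measurable fun x : Plane => ENNReal.ofReal (1 - Real.cos (inner ℝ x ξ)) :=
    by fun_prop
  have key (ξ : Plane) : ENNReal.ofReal (1 - (charFun (m.map diffHom) ξ).re) =
      ∫⁻ x, ENNReal.ofReal (1 - Real.cos (inner ℝ (diffHom x) ξ)) ∂m := by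
    rw [← lintegral_one_sub_cos, lintegral_map (hmeas ξ) measurable_diffHom]
  refine ⟨hp2, ⟨((W.prod W).map displacement).map diffHom,
    Measure.isProbabilityMeasure_map measurable_diffHom.aemeasurable, fun ξ => hW.charFun_diff ξ,
    ?_⟩, im_charFun_eq_zero hm, fun ξ hξ => ?_, fun ξ hξ => ?_⟩
  -- The Gaussian component is the term l = 0 of the mixture, a block consisting of a single
  -- segment.
  · rw [← Measure.map_smul]
    exact Measure.map_mono ((smul_le_constLaw _ γ _).trans hlow) measurable_diffHom
  all_goals
    set s := ‖ξ‖ ^ 2 with hs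
    set f := (charFun (m.map diffHom) ξ).re with hf
    have hs0 : 0 ≤ s := sq_nonneg _
    set y := Real.exp (-s) with hy
    have hy0 : 0 < y := Real.exp_pos _
    have hy1 : y ≤ 1 := Real.exp_le_one_iff.2 (by linarith)
    have hys : 1 - s ≤ y := by have := Real.add_one_le_exp (-s); linarith
  · have hle : γ * (1 - y) / ((1 - (1 - γ - θ)) * (1 - (1 - γ - θ) * y)) ≤ 1 - f := by
      have := lintegral_mono' hlow
        (le_refl fun x => ENNReal.ofReal (1 - Real.cos (inner ℝ (diffHom x) ξ)))
      rw [hW.lintegral_one_sub_cos_constLaw hγ0.le ⟨by linarith, by linarith⟩, ← key] at this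
      refine (ENNReal.ofReal_le_ofReal_iff ?_).1 this
      have := (Complex.abs_re_le_norm _).trans (norm_charFun_le_one (μ := m.map diffHom) ξ)
      linarith [le_abs_self f]
    have hys2 : y * (1 + s) ≤ 1 := by
      have h := Real.add_one_le_exp s
      have : y * Real.exp s = 1 := by rw [hy, ← Real.exp_add]; simp
      nlinarith
    have hA : 0 < 1 - (1 - γ - θ) * y := by nlinarith
    have hB : 1 - (1 - γ - θ) * y ≤ γ + 2 * θ := by nlinarith
    -- For s ≤ θ one has 1 - y ≥ s/(1+s) ≥ s/(1+θ) and a denominator of at most (γ+θ)(γ+2θ). The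
    -- hypothesis `h2` is tailored to this quotient.
    have hge : (1 - τ) * s / γ ≤ γ * (1 - y) / ((1 - (1 - γ - θ)) * (1 - (1 - γ - θ) * y)) := by
      rw [div_le_div_iff₀ hγ0 (mul_pos (by linarith) hA)]
      have hT : 0 < 1 - τ := by linarith [hτ.2]
      have e1 : (1 - τ) * s * ((1 - (1 - γ - θ)) * (1 - (1 - γ - θ) * y)) * (1 + s) ≤
          (1 - τ) * s * ((γ + θ) * (γ + 2 * θ)) * (1 + θ) := by
        have : 1 - (1 - γ - θ) = γ + θ := by ring
        rw [this]
        gcongr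
      have e2 : (1 - τ) * s * ((γ + θ) * (γ + 2 * θ)) * (1 + θ) ≤ s * γ ^ 2 := by nlinarith
      have e3 : s * γ ^ 2 ≤ γ * (1 - y) * γ * (1 + s) := by nlinarith [sq_nonneg γ]
      exact le_of_mul_le_mul_right (e1.trans (e2.trans e3)) (by linarith)
    have := Real.add_one_le_exp (-((1 - τ) / γ) * s)
    have e : (1 - τ) * s / γ = (1 - τ) / γ * s := by ring
    linarith
  · have hle : 1 - f ≤ γ * (1 - y) / ((1 - (1 - γ + θ)) * (1 - (1 - γ + θ) * y)) := by
      have := lintegral_mono' hup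
        (le_refl fun x => ENNReal.ofReal (1 - Real.cos (inner ℝ (diffHom x) ξ)))
      rw [hW.lintegral_one_sub_cos_constLaw hγ0.le ⟨by linarith, by linarith⟩, ← key] at this
      refine (ENNReal.ofReal_le_ofReal_iff ?_).1 this
      have hA : 0 < 1 - (1 - γ + θ) * y := by nlinarith
      exact div_nonneg (mul_nonneg hγ0.le (by linarith)) (mul_nonneg (by linarith) hA.le)
    set c := (1 + τ) / γ with hc
    have hc0 : 0 < c := div_pos (by linarith [hτ.1]) hγ0
    -- The target is chosen so that f ≥ 1 - cs/(1+cs) = 1/(1+cs) ≥ exp(-cs); `h1` provides it for s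
    -- ≤ θ.
    have hle2 : γ * (1 - y) / ((1 - (1 - γ + θ)) * (1 - (1 - γ + θ) * y)) ≤ c * s / (1 + c * s) := by
      have hA : γ - θ ≤ 1 - (1 - γ + θ) * y := by nlinarith
      have hcs : 0 < 1 + c * s := by positivity
      have hgt : 0 < γ - θ := by linarith
      have e0 : γ * (1 - y) / ((1 - (1 - γ + θ)) * (1 - (1 - γ + θ) * y)) ≤
          γ * s / (γ - θ) ^ 2 := by
        have hy' : 1 - y ≤ s := by linarith
        have hA' : (γ - θ) * (γ - θ) ≤ (1 - (1 - γ + θ)) * (1 - (1 - γ + θ) * y) :=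
          mul_le_mul (by linarith) hA hgt.le (by linarith)
        rw [pow_two]
        gcongr
      refine e0.trans ?_
      rw [div_le_div_iff₀ (by positivity) hcs]
      have e1 : γ ^ 2 * (1 + c * s) ≤ (1 + τ) * (γ - θ) ^ 2 := by
        refine le_trans ?_ h1
        gcongr
      have e2 : γ * c = 1 + τ := by rw [hc]; field_simp
      refine le_of_mul_le_mul_left ?_ hγ0
      have : s * (γ ^ 2 * (1 + c * s)) ≤ s * ((1 + τ) * (γ - θ) ^ 2) := by gcongr
      calc γ * (γ * s * (1 + c * s)) = s * (γ ^ 2 * (1 + c * s)) := by ring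
        _ ≤ _ := this
        _ = γ * (c * s * (γ - θ) ^ 2) := by rw [← e2]; ring
    have h3 : Real.exp (-c * s) ≤ 1 / (1 + c * s) := by
      rw [neg_mul, Real.exp_neg, ← one_div]
      have hcs : 0 < 1 + c * s := by positivity
      exact one_div_le_one_div_of_le hcs (by linarith [Real.add_one_le_exp (c * s)])
    have h4 : 1 / (1 + c * s) = 1 - c * s / (1 + c * s) := by
      have hcs : 0 < 1 + c * s := by positivity
      field_simp
      ring
    linarith

/-- The lower comparison measure does not depend on ε, so its tightness gives one block radius for
all small ε. Its mass γ/(γ+θ) exceeds 1 - t because θ ≤ γt/2. -/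
lemma exists_radius_constLaw (ν : Measure (Path × Path)) [IsProbabilityMeasure ν]
    (hγ : γ ∈ Set.Ioo (0 : ℝ) 1) {t : ℝ} (ht : t ∈ Set.Ioo (0 : ℝ) 1) :
    ∃ θ ∈ Set.Ioo (0 : ℝ) (1 - γ), ∃ R, 0 ≤ R ∧
      ENNReal.ofReal (1 - t) ≤ ∫⁻ x, smallBlock R x ∂(constLaw ν γ (1 - γ - θ)) := by
  have hγ0 := hγ.1
  set θ := min (γ * t / 2) ((1 - γ) / 2) with hθ
  have hθ0 : 0 < θ := lt_min (by have := ht.1; positivity) (by linarith [hγ.2])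
  have hθ1 : θ < 1 - γ := lt_of_le_of_lt (min_le_right _ _) (by linarith [hγ.2])
  have hθ2 : θ ≤ γ * t / 2 := min_le_left _ _
  refine ⟨θ, ⟨hθ0, hθ1⟩, ?_⟩
  have hmono : Monotone fun n : ℕ => Metric.closedBall (0 : Plane × Plane) n :=
    fun m n h => Metric.closedBall_subset_closedBall (by exact_mod_cast h)
  have hlim := tendsto_measure_iUnion_atTop (μ := constLaw ν γ (1 - γ - θ)) hmono
  rw [Metric.iUnion_closedBall_nat, constLaw_univ ν hγ0.le ⟨by linarith, by linarith⟩] at hlim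
  have hlt : ENNReal.ofReal (1 - t) < ENNReal.ofReal (γ / (1 - (1 - γ - θ))) := by
    refine (ENNReal.ofReal_lt_ofReal_iff (div_pos hγ0 (by linarith))).2 ?_
    rw [lt_div_iff₀ (by linarith)]
    nlinarith [ht.1, ht.2, mul_pos hγ0 ht.1]
  obtain ⟨n, hn⟩ := (hlim.eventually (lt_mem_nhds hlt)).exists
  refine ⟨n, Nat.cast_nonneg n, ?_⟩
  have : ∫⁻ x, smallBlock n x ∂(constLaw ν γ (1 - γ - θ)) =
      constLaw ν γ (1 - γ - θ) (Metric.closedBall 0 n) :=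
    (lintegral_indicator_const measurableSet_closedBall 1).trans (one_mul _)
  rw [this]
  exact hn.le

end steplaw

end KR

end


/-! ### Densities of the tilted measure, of the transition probability and of the failure part. -/

noncomputable section

namespace KR

open scoped ENNReal

section correlation

lemma exists_bound_corr {φ : ℝ → ℝ} {ψ : Plane → ℝ} (h : IsMollifierPair φ ψ) :
    Continuous (fun q : ℝ × Plane => corr φ ψ q.1 q.2) ∧ (∀ s y, 0 ≤ corr φ ψ s y) ∧
      ∃ K : ℝ, 0 ≤ K ∧ ∀ s y, corr φ ψ s y ≤ K := by
  have hφ := h.smooth_time.continuous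
  have hψ := h.smooth_space.continuous
  have cφ : HasCompactSupport φ := .of_support_subset_isCompact isCompact_Icc h.support_time
  have cψ : HasCompactSupport ψ :=
    .of_support_subset_isCompact (isCompact_closedBall _ _) h.support_space
  have cφ' : HasCompactSupport fun t => φ (-t) := cφ.comp_homeomorph (Homeomorph.neg ℝ)
  have c1 : Continuous (convolution φ (fun t => φ (-t)) (ContinuousLinearMap.mul ℝ ℝ) volume) :=
    cφ'.continuous_convolution_right _ hφ.locallyIntegrable (hφ.comp continuous_neg)
  have c2 : Continuous (convolution ψ ψ (ContinuousLinearMap.mul ℝ ℝ) volume) :=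
    cψ.continuous_convolution_right _ hψ.locallyIntegrable hψ
  have n1 (s : ℝ) : 0 ≤ convolution φ (fun t => φ (-t)) (ContinuousLinearMap.mul ℝ ℝ) volume s :=
    integral_nonneg fun t => mul_nonneg (h.nonneg_time _) (h.nonneg_time _)
  have n2 (y : Plane) : 0 ≤ convolution ψ ψ (ContinuousLinearMap.mul ℝ ℝ) volume y :=
    integral_nonneg fun t => mul_nonneg (h.nonneg_space _) (h.nonneg_space _)
  obtain ⟨C1, hC1⟩ := c1.bounded_above_of_compact_support (cφ.convolution _ cφ')
  obtain ⟨C2, hC2⟩ := c2.bounded_above_of_compact_support (cψ.convolution _ cψ)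
  have hC1' := (norm_nonneg _).trans (hC1 0)
  refine ⟨(c1.comp continuous_fst).mul (c2.comp continuous_snd),
    fun s y => mul_nonneg (n1 s) (n2 y), C1 * C2,
    mul_nonneg hC1' ((norm_nonneg _).trans (hC2 0)), fun s y => ?_⟩
  exact mul_le_mul ((le_abs_self _).trans (hC1 s)) ((le_abs_self _).trans (hC2 y)) (n2 y) hC1'

lemma integral_mem_Icc {α : Type*} [MeasurableSpace α] (μ : Measure α) [IsProbabilityMeasure μ]
    {f : α → ℝ} {a b : ℝ} (hf : Measurable f) (h : ∀ x, f x ∈ Set.Icc a b) :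
    ∫ x, f x ∂μ ∈ Set.Icc a b := by
  have hint : Integrable f μ := by
    refine Integrable.of_bound (C := max |a| |b|) hf.aestronglyMeasurable (ae_of_all _ fun x => ?_)
    exact abs_le_max_abs_abs (h x).1 (h x).2
  constructor
  · simpa using integral_mono (integrable_const a) hint fun x => (h x).1
  · simpa using integral_mono hint (integrable_const b) fun x => (h x).2

variable {R : ℝ → Plane → ℝ} {K : ℝ}

lemma measurable_selfInteraction (hR : Continuous fun q : ℝ × Plane => R q.1 q.2) :
    Measurable fun x : Path => ∫ q : unitInterval × unitInterval,
      R ((q.1 : ℝ) - (q.2 : ℝ)) (x.at q.1 - x.at q.2) := by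
  have h : Continuous fun z : Path × (unitInterval × unitInterval) =>
      R ((z.2.1 : ℝ) - (z.2.2 : ℝ)) (z.1.1 z.2.1 - z.1.1 z.2.2) :=
    hR.comp (f := fun z : Path × (unitInterval × unitInterval) =>
      (((z.2.1 : ℝ) - (z.2.2 : ℝ)), (z.1.1 z.2.1 - z.1.1 z.2.2))) (by fun_prop)
  exact (StronglyMeasurable.integral_prod_right' h.measurable.stronglyMeasurable).measurable

lemma measurable_interaction (hR : Continuous fun q : ℝ × Plane => R q.1 q.2) (a β ε : ℝ) :
    Measurable fun z : Path × Path => interaction R a β ε z.1 z.2 := by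
  have h : Continuous fun z : (Path × Path) × (unitInterval × unitInterval) =>
      R (a + (z.2.1 : ℝ) - (z.2.2 : ℝ)) (z.1.2.1 z.2.1 + z.1.1.1 1 - z.1.1.1 z.2.2) :=
    hR.comp (f := fun z : (Path × Path) × (unitInterval × unitInterval) =>
      ((a + (z.2.1 : ℝ) - (z.2.2 : ℝ)), (z.1.2.1 z.2.1 + z.1.1.1 1 - z.1.1.1 z.2.2))) (by fun_prop)
  exact ((StronglyMeasurable.integral_prod_right' h.measurable.stronglyMeasurable).measurable
    ).const_mul _

lemma couplingSq_nonneg {β ε : ℝ} (hε : ε ∈ Set.Ioo (0 : ℝ) 1) : 0 ≤ couplingSq β ε :=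
  div_nonneg (sq_nonneg _) (Real.log_nonneg ((one_le_div hε.1).2 hε.2.le))

lemma interaction_mem_Icc (hR : Continuous fun q : ℝ × Plane => R q.1 q.2)
    (h0 : ∀ s y, 0 ≤ R s y) (hK : ∀ s y, R s y ≤ K) {β ε : ℝ} (hε : ε ∈ Set.Ioo (0 : ℝ) 1) (a : ℝ)
    (x y : Path) : interaction R a β ε x y ∈ Set.Icc 0 (couplingSq β ε * K) := by
  have hm : Continuous fun q : unitInterval × unitInterval =>
      R (a + (q.1 : ℝ) - (q.2 : ℝ)) (y.1 q.1 + x.1 1 - x.1 q.2) :=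
    hR.comp (f := fun q : unitInterval × unitInterval =>
      ((a + (q.1 : ℝ) - (q.2 : ℝ)), (y.1 q.1 + x.1 1 - x.1 q.2))) (by fun_prop)
  have h := integral_mem_Icc (volume : Measure (unitInterval × unitInterval)) hm.measurable
    fun q => ⟨h0 _ _, hK _ _⟩
  have hc := couplingSq_nonneg (β := β) hε
  exact ⟨mul_nonneg hc h.1, mul_le_mul_of_nonneg_left h.2 hc⟩

/-- The tilted Wiener measure has a density close to `1`. -/
lemma exists_density_tiltedWiener (W : Measure Path) [IsProbabilityMeasure W]
    (hR : Continuous fun q : ℝ × Plane => R q.1 q.2)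
    (h0 : ∀ s y, 0 ≤ R s y) (hK : ∀ s y, R s y ≤ K) {β ε : ℝ} (hε : ε ∈ Set.Ioo (0 : ℝ) 1) :
    IsProbabilityMeasure (tiltedWiener W R β ε) ∧ ∃ f : Path → ℝ, Measurable f ∧
      (∀ x, f x ∈ Set.Icc (Real.exp (-(couplingSq β ε * K))) (Real.exp (couplingSq β ε * K))) ∧
      tiltedWiener W R β ε = W.withDensity fun x => ENNReal.ofReal (f x) := by
  set D := couplingSq β ε * K with hD
  have hc := couplingSq_nonneg (β := β) hε
  set g : Path → ℝ := fun x => couplingSq β ε / 2 * ∫ q : unitInterval × unitInterval,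
    R ((q.1 : ℝ) - (q.2 : ℝ)) (x.at q.1 - x.at q.2) with hg
  have hgm : Measurable g := (measurable_selfInteraction hR).const_mul _
  have hgb (x : Path) : g x ∈ Set.Icc 0 D := by
    have hm : Continuous fun q : unitInterval × unitInterval =>
        R ((q.1 : ℝ) - (q.2 : ℝ)) (x.1 q.1 - x.1 q.2) :=
      hR.comp (f := fun q : unitInterval × unitInterval =>
        (((q.1 : ℝ) - (q.2 : ℝ)), (x.1 q.1 - x.1 q.2))) (by fun_prop)
    have h := integral_mem_Icc (volume : Measure (unitInterval × unitInterval)) hm.measurable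
      fun q => ⟨h0 _ _, hK _ _⟩
    have hK0 : 0 ≤ K := (h0 0 0).trans (hK 0 0)
    refine ⟨mul_nonneg (by linarith) h.1, ?_⟩
    refine (mul_le_mul_of_nonneg_left h.2 (by linarith)).trans ?_
    nlinarith [mul_nonneg hc hK0]
  have heb (x : Path) : Real.exp (g x) ∈ Set.Icc 1 (Real.exp D) :=
    ⟨Real.one_le_exp (hgb x).1, Real.exp_le_exp.2 (hgb x).2⟩
  have hS := integral_mem_Icc W hgm.exp heb
  set S := ∫ x, Real.exp (g x) ∂W with hSdef
  have hS0 : 0 < S := lt_of_lt_of_le one_pos hS.1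
  refine ⟨isProbabilityMeasure_tilted ?_, fun x => Real.exp (g x) / S, hgm.exp.div_const _,
    fun x => ⟨?_, ?_⟩, rfl⟩
  · refine Integrable.of_bound (C := Real.exp D) hgm.exp.aestronglyMeasurable
      (ae_of_all _ fun x => ?_)
    rw [Real.norm_of_nonneg (Real.exp_pos _).le]
    exact (heb x).2
  · rw [le_div_iff₀ hS0, Real.exp_neg]
    refine le_trans ?_ (heb x).1
    rw [inv_mul_le_iff₀ (Real.exp_pos _), mul_one]
    exact hS.2
  · rw [div_le_iff₀ hS0]
    exact (heb x).2.trans (le_mul_of_one_le_right (Real.exp_pos _).le hS.1)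

variable {μ : Measure Path} {I : Path → Path → ℝ} {r : ℝ} {Ψ : Path → ℝ} {D : ℝ}

lemma IsPrincipalEigenpair.integrable [IsProbabilityMeasure μ] (h : IsPrincipalEigenpair μ I r Ψ) :
    Integrable Ψ μ := by
  obtain ⟨c, C, hc, hC⟩ := h.bounds
  refine Integrable.of_bound (C := C) h.measurable.aestronglyMeasurable (ae_of_all _ fun x => ?_)
  rw [Real.norm_of_nonneg (hc.le.trans (hC x).1)]
  exact (hC x).2

lemma IsPrincipalEigenpair.pos_apply (h : IsPrincipalEigenpair μ I r Ψ) (x : Path) : 0 < Ψ x := by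
  obtain ⟨c, C, hc, hC⟩ := h.bounds
  exact hc.trans_le (hC x).1

lemma IsPrincipalEigenpair.integrable_exp_mul [IsProbabilityMeasure μ]
    (h : IsPrincipalEigenpair μ I r Ψ)
    (hI : Measurable fun z : Path × Path => I z.1 z.2) (hIb : ∀ x y, I x y ∈ Set.Icc 0 D)
    (x : Path) : Integrable (fun y => Real.exp (I x y) * Ψ y) μ := by
  refine h.integrable.bdd_mul (c := Real.exp D)
    (hI.comp measurable_prodMk_left).exp.aestronglyMeasurable (ae_of_all _ fun y => ?_)
  rw [Real.norm_of_nonneg (Real.exp_pos _).le]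
  exact Real.exp_le_exp.2 (hIb x y).2

/-- The eigenvalue equation expresses r Ψ(x) as an average of exp(I) ∈ [1, exp D] with respect to
the probability density Ψ. -/
lemma IsPrincipalEigenpair.mul_mem_Icc [IsProbabilityMeasure μ] (h : IsPrincipalEigenpair μ I r Ψ)
    (hI : Measurable fun z : Path × Path => I z.1 z.2) (hIb : ∀ x y, I x y ∈ Set.Icc 0 D)
    (x : Path) : r * Ψ x ∈ Set.Icc 1 (Real.exp D) := by
  rw [← h.eigen x]
  constructor
  · rw [← h.normalized]
    exact integral_mono h.integrable (h.integrable_exp_mul hI hIb x) fun y =>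
      le_mul_of_one_le_left (h.pos_apply y).le (Real.one_le_exp (hIb x y).1)
  · have : Real.exp D = ∫ y, Real.exp D * Ψ y ∂μ := by
      rw [integral_const_mul, h.normalized, mul_one]
    rw [this]
    exact integral_mono (h.integrable_exp_mul hI hIb x) (h.integrable.const_mul _) fun y =>
      mul_le_mul_of_nonneg_right (Real.exp_le_exp.2 (hIb x y).2) (h.pos_apply y).le

/-- Integrating r Ψ against μ puts r itself into [1, exp D]; dividing by r gives bounds for Ψ that
depend on D only. -/
lemma IsPrincipalEigenpair.eigenfunction_mem_Icc [IsProbabilityMeasure μ]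
    (h : IsPrincipalEigenpair μ I r Ψ)
    (hI : Measurable fun z : Path × Path => I z.1 z.2) (hIb : ∀ x y, I x y ∈ Set.Icc 0 D)
    (x : Path) : Ψ x ∈ Set.Icc (Real.exp (-D)) (Real.exp D) := by
  have hr : r ∈ Set.Icc 1 (Real.exp D) := by
    have := integral_mem_Icc μ (h.measurable.const_mul r) (h.mul_mem_Icc hI hIb)
    rwa [integral_const_mul, h.normalized, mul_one] at this
  have hx := h.mul_mem_Icc hI hIb x
  have h0 := h.pos_apply x
  constructor
  · rw [Real.exp_neg, inv_le_iff_one_le_mul₀ (Real.exp_pos _), mul_comm]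
    exact hx.1.trans (mul_le_mul_of_nonneg_right hr.2 h0.le)
  · exact (le_mul_of_one_le_left h0.le hr.1).trans hx.2

lemma IsPrincipalEigenpair.lintegral_transition [IsProbabilityMeasure μ]
    (h : IsPrincipalEigenpair μ I r Ψ)
    (hI : Measurable fun z : Path × Path => I z.1 z.2) (hIb : ∀ x y, I x y ∈ Set.Icc 0 D)
    (x : Path) : transition μ I r Ψ x Set.univ = 1 := by
  have h0 := h.pos_apply
  rw [transition, withDensity_apply _ MeasurableSet.univ, Measure.restrict_univ,
    ← ofReal_integral_eq_lintegral_ofReal ((h.integrable_exp_mul hI hIb x).div_const _)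
      (ae_of_all _ fun y => div_nonneg (mul_nonneg (Real.exp_pos _).le (h0 y).le)
        (mul_nonneg h.pos.le (h0 x).le)), integral_div, h.eigen,
    div_self (mul_pos h.pos (h0 x)).ne', ENNReal.ofReal_one]

/-- The transition probability has a density with respect to `W` that is close to `1`. -/
lemma IsPrincipalEigenpair.exists_density_transition {W : Measure Path} [IsProbabilityMeasure μ]
    (h : IsPrincipalEigenpair μ I r Ψ)
    (hI : Measurable fun z : Path × Path => I z.1 z.2) (hIb : ∀ x y, I x y ∈ Set.Icc 0 D)
    {f : Path → ℝ} (hf : Measurable f)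
    (hfb : ∀ x, f x ∈ Set.Icc (Real.exp (-D)) (Real.exp D))
    (hμ : μ = W.withDensity fun x => ENNReal.ofReal (f x)) :
    ∃ g : Path × Path → ℝ, Measurable g ∧
      (∀ z, g z ∈ Set.Icc (Real.exp (-(3 * D))) (Real.exp (3 * D))) ∧
      ∀ x, transition μ I r Ψ x = W.withDensity fun y => ENNReal.ofReal (g (x, y)) := by
  have h0 := h.pos_apply
  have hm := h.measurable
  have hquot : Measurable fun z : Path × Path =>
      Real.exp (I z.1 z.2) * Ψ z.2 / (r * Ψ z.1) := by fun_prop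
  refine ⟨fun z => f z.2 * (Real.exp (I z.1 z.2) * Ψ z.2 / (r * Ψ z.1)),
    (hf.comp measurable_snd).mul hquot, fun z => ?_, fun x => ?_⟩
  -- The exponent 3D collects one D each from the density of μ, from Ψ(y), and from exp(I) or r
  -- Ψ(x).
  · have h1 := hfb z.2
    have h2 := hIb z.1 z.2
    have h3 := h.eigenfunction_mem_Icc hI hIb z.2
    have h4 := h.mul_mem_Icc hI hIb z.1
    have h5 : 0 < r * Ψ z.1 := lt_of_lt_of_le one_pos h4.1
    have e1 : Real.exp (-(3 * D)) = Real.exp (-D) * (1 * Real.exp (-D) / Real.exp D) := by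
      rw [one_mul, ← Real.exp_sub, ← Real.exp_add]; ring_nf
    have e2 : Real.exp (3 * D) = Real.exp D * (Real.exp D * Real.exp D / 1) := by
      rw [div_one, ← Real.exp_add, ← Real.exp_add]; ring_nf
    have h6 : 0 < Ψ z.2 := h0 _
    have h7 : 0 < f z.2 := (Real.exp_pos _).trans_le h1.1
    constructor
    · rw [e1]
      refine mul_le_mul h1.1 ?_ (by positivity) h7.le
      exact div_le_div₀ (by positivity) (mul_le_mul (Real.one_le_exp h2.1) h3.1
        (Real.exp_pos _).le (Real.exp_pos _).le) h5 h4.2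
    · rw [e2]
      refine mul_le_mul h1.2 ?_ (by positivity) (Real.exp_pos _).le
      exact div_le_div₀ (by positivity) (mul_le_mul (Real.exp_le_exp.2 h2.2) h3.2 h6.le
        (Real.exp_pos _).le) one_pos h4.1
  · have hx : Measurable fun y => Real.exp (I x y) * Ψ y / (r * Ψ x) :=
      hquot.comp measurable_prodMk_left
    rw [transition, hμ, ← withDensity_mul _ hf.ennreal_ofReal hx.ennreal_ofReal]
    congr 1
    ext y
    rw [Pi.mul_apply, ← ENNReal.ofReal_mul ((Real.exp_pos _).le.trans (hfb y).1)]

end correlation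

section density

variable {W : Measure Path} [IsProbabilityMeasure W] {γ : ℝ}

/-- If the transition probability has density `g` with respect to `W`, this is the density of the
failure part of the coupling with respect to `W.prod W`. -/
def failDensity (g : Path × Path → ℝ) (γ : ℝ) (q : (Path × Path) × (Path × Path)) : ℝ≥0∞ :=
  ENNReal.ofReal (g (q.1.1, q.2.1) * g (q.1.2, q.2.2) - γ)

lemma measurable_failDensity {g : Path × Path → ℝ} (hg : Measurable g) :
    Measurable (failDensity g γ) := by
  unfold failDensity
  fun_prop

lemma failDensity_swap (g : Path × Path → ℝ) (z w : Path × Path) :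
    failDensity g γ (z.swap, w.swap) = failDensity g γ (z, w) := by
  simp only [failDensity, Prod.fst_swap, Prod.snd_swap, mul_comm]

lemma pairTransition_eq {μ : Measure Path} {I : Path → Path → ℝ} {r : ℝ} {Ψ : Path → ℝ}
    {g : Path × Path → ℝ} (hg : Measurable g) (hg0 : ∀ z, 0 ≤ g z) (hγ : 0 ≤ γ)
    (hgγ : ∀ z w, γ ≤ g z * g w)
    (ht : ∀ x, transition μ I r Ψ x = W.withDensity fun y => ENNReal.ofReal (g (x, y)))
    (z : Path × Path) :
    pairTransition μ I r Ψ z = (W.prod W).withDensity (fun w => failDensity g γ (z, w)) +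
      ENNReal.ofReal γ • W.prod W := by
  have hx (x : Path) : Measurable fun y => ENNReal.ofReal (g (x, y)) :=
    (hg.comp measurable_prodMk_left).ennreal_ofReal
  have hk : Measurable fun w => failDensity g γ (z, w) :=
    (measurable_failDensity hg).comp measurable_prodMk_left
  rw [pairTransition, ht, ht, prod_withDensity (hx _) (hx _), ← withDensity_const,
    ← withDensity_add_left hk]
  congr 1
  ext w
  rw [Pi.add_apply, failDensity, ← ENNReal.ofReal_mul (hg0 _),
    ← ENNReal.ofReal_add (sub_nonneg.2 (hgγ _ _)) hγ, sub_add_cancel]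

/-- Since κ dominates γ W × W, the truncated subtraction of measures in `residual` is a genuine one.
-/
lemma smul_residual_eq {κ : Path × Path → Measure (Path × Path)}
    {k : (Path × Path) × (Path × Path) → ℝ≥0∞} (hγ : γ < 1)
    (h : ∀ z, κ z = (W.prod W).withDensity (fun w => k (z, w)) + ENNReal.ofReal γ • W.prod W)
    (z : Path × Path) :
    ENNReal.ofReal (1 - γ) • residual κ (W.prod W) γ z =
      (W.prod W).withDensity fun w => k (z, w) := by
  have : IsFiniteMeasure (ENNReal.ofReal γ • W.prod W) :=
    Measure.smul_finite _ ENNReal.ofReal_ne_top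
  rw [residual, h, Measure.add_sub_cancel, smul_smul, ENNReal.mul_inv_cancel
    (by simpa using hγ) ENNReal.ofReal_ne_top, one_smul]

lemma lintegral_failDensity {κ : Path × Path → Measure (Path × Path)}
    {k : (Path × Path) × (Path × Path) → ℝ≥0∞} (hγ : γ ∈ Set.Ioo (0 : ℝ) 1)
    (h : ∀ z, κ z = (W.prod W).withDensity (fun w => k (z, w)) + ENNReal.ofReal γ • W.prod W)
    (z : Path × Path) (hz : κ z Set.univ = 1) :
    ∫⁻ w, k (z, w) ∂(W.prod W) = ENNReal.ofReal (1 - γ) := by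
  rw [h, Measure.add_apply, withDensity_apply _ MeasurableSet.univ, Measure.restrict_univ] at hz
  simp only [Measure.smul_apply, measure_univ, smul_eq_mul, mul_one] at hz
  rw [ENNReal.ofReal_sub _ hγ.1.le, ENNReal.ofReal_one, ← hz,
    ENNReal.add_sub_cancel_right ENNReal.ofReal_ne_top]

lemma tendsto_couplingSq (β : ℝ) : Tendsto (couplingSq β) (𝓝[>] 0) (𝓝 0) :=
  tendsto_log_one_div.const_div_atTop _

/-- For small `ε` the failure part of the coupling has a symmetric density with respect to
`W.prod W`, and this density tends to `1 - γ` uniformly. -/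
theorem exists_failDensity {φ : ℝ → ℝ} {ψ : Plane → ℝ} (hφψ : IsMollifierPair φ ψ)
    (W : Measure Path) [IsProbabilityMeasure W] (a β : ℝ) {ε₀ : ℝ} (hγ : γ ∈ Set.Ioo (0 : ℝ) 1)
    (hε₀ : ε₀ ∈ Set.Ioc (0 : ℝ) 1) {r : ℝ → ℝ} {Ψ : ℝ → Path → ℝ}
    (heigen : ∀ ε ∈ Set.Ioo (0 : ℝ) ε₀,
      IsPrincipalEigenpair (tiltedWiener W (corr φ ψ) β ε)
        (interaction (corr φ ψ) a β ε) (r ε) (Ψ ε)) {θ : ℝ} (hθ : 0 < θ) :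
    ∀ᶠ ε in 𝓝[>] (0 : ℝ), ∃ k : (Path × Path) × (Path × Path) → ℝ≥0∞, Measurable k ∧
      (∀ z w, k (z.swap, w.swap) = k (z, w)) ∧
      (∀ z, ENNReal.ofReal (1 - γ) • residual (pairTransition (tiltedWiener W (corr φ ψ) β ε)
        (interaction (corr φ ψ) a β ε) (r ε) (Ψ ε)) (W.prod W) γ z =
          (W.prod W).withDensity fun w => k (z, w)) ∧
      (∀ z, ∫⁻ w, k (z, w) ∂(W.prod W) = ENNReal.ofReal (1 - γ)) ∧
      (∀ q, ENNReal.ofReal (1 - γ - θ) ≤ k q) ∧ ∀ q, k q ≤ ENNReal.ofReal (1 - γ + θ) := by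
  obtain ⟨hR, hR0, K, hK0, hK⟩ := exists_bound_corr hφψ
  have hlim1 : Tendsto (fun ε => Real.exp (6 * (couplingSq β ε * K))) (𝓝[>] 0) (𝓝 1) := by
    have := (((tendsto_couplingSq β).mul_const K).const_mul 6).rexp
    simpa using this
  have hlim2 : Tendsto (fun ε => Real.exp (-(6 * (couplingSq β ε * K)))) (𝓝[>] 0) (𝓝 1) := by
    have := (((tendsto_couplingSq β).mul_const K).const_mul 6).neg.rexp
    simpa using this
  -- The pair density is a product of two one-copy densities and so lies between exp(∓6D) with D =
  -- β_ε² K → 0. The last condition, exp(-6D) > γ, makes it exceed γ.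
  filter_upwards [Ioo_mem_nhdsGT hε₀.1, hlim1.eventually (gt_mem_nhds (by linarith : 1 < 1 + θ)),
    hlim2.eventually (lt_mem_nhds (by linarith : 1 - θ < 1)),
    hlim2.eventually (lt_mem_nhds hγ.2)] with ε hε h1 h2 h3
  have hε1 : ε ∈ Set.Ioo (0 : ℝ) 1 := ⟨hε.1, hε.2.trans_le hε₀.2⟩
  obtain ⟨hprob, f, hf, hfb, hμ⟩ := exists_density_tiltedWiener W hR hR0 hK (β := β) hε1
  have hI := measurable_interaction hR a β ε
  have hIb := interaction_mem_Icc hR hR0 hK (β := β) hε1 a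
  have he := heigen ε hε
  obtain ⟨g, hg, hgb, ht⟩ := he.exists_density_transition hI hIb hf hfb hμ
  have hgpos (z) : 0 < g z := (Real.exp_pos _).trans_le (hgb z).1
  have hgg1 (z w) : g z * g w ≤ Real.exp (6 * (couplingSq β ε * K)) := by
    refine (mul_le_mul (hgb z).2 (hgb w).2 (hgpos w).le (Real.exp_pos _).le).trans (le_of_eq ?_)
    rw [← Real.exp_add]; ring_nf
  have hgg2 (z w) : Real.exp (-(6 * (couplingSq β ε * K))) ≤ g z * g w := by
    refine le_trans (le_of_eq ?_) (mul_le_mul (hgb z).1 (hgb w).1 (Real.exp_pos _).le (hgpos z).le)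
    rw [← Real.exp_add]; ring_nf
  have hpair := pairTransition_eq hg (fun z => (hgpos z).le) hγ.1.le
    (fun z w => h3.le.trans (hgg2 z w)) ht
  refine ⟨failDensity g γ, measurable_failDensity hg, failDensity_swap g,
    smul_residual_eq hγ.2 hpair, fun z => lintegral_failDensity hγ hpair z ?_, fun q => ?_,
    fun q => ?_⟩
  · have hone (x : Path) := he.lintegral_transition hI hIb x
    have : IsProbabilityMeasure (transition (tiltedWiener W (corr φ ψ) β ε)
        (interaction (corr φ ψ) a β ε) (r ε) (Ψ ε) z.1) := ⟨hone _⟩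
    have : IsProbabilityMeasure (transition (tiltedWiener W (corr φ ψ) β ε)
        (interaction (corr φ ψ) a β ε) (r ε) (Ψ ε) z.2) := ⟨hone _⟩
    rw [pairTransition]
    exact measure_univ
  · exact ENNReal.ofReal_le_ofReal (by linarith [hgg2 (q.1.1, q.2.1) (q.1.2, q.2.2)])
  · exact ENNReal.ofReal_le_ofReal (by linarith [hgg1 (q.1.1, q.2.1) (q.1.2, q.2.2)])

end density

end KR

end


/-! ### Conclusion: the regeneration blocks satisfy the hypotheses of the limit theorem for iid
blocks. -/

noncomputable section

namespace KR

open scoped ENNReal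

section conclusion

variable {Ω : Type*} [MeasurableSpace Ω] {P : Measure Ω}
  {Z : ℕ → Ω → Path × Path} {η : ℕ → Ω → Bool}

/-- The expected sum over tuples of increments in terms of the regeneration blocks. -/
lemma integral_nonDirectedSum {p : ℕ} {g : (Fin p → Plane) → ℝ} (hg : Measurable g)
    (hg0 : ∀ x, 0 ≤ g x) (hZ : ∀ n, Measurable (Z n)) (hη : ∀ n, Measurable (η n))
    (hs : ∀ᵐ ω ∂P, HasSuccesses fun n => η n ω) (δ : Fin p → ℤ) (N : ℕ) :
    ∫ ω, nonDirectedSum g δ N (fun n => Z n ω) (fun n => η n ω) ∂P =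
      (tupleExpectation P (regBlock Z η) g δ N).toReal := by
  have hm := measurable_regBlock hη hZ
  have hmeas (j : Fin p → ℕ) :
      Measurable fun ω => g fun i => shiftedDiff (regBlock Z η) (j i) (δ i) ω :=
    hg.comp (measurable_pi_lambda _ fun i => by
      unfold shiftedDiff posX posY
      fun_prop)
  have hae : (fun ω => nonDirectedSum g δ N (fun n => Z n ω) (fun n => η n ω)) =ᵐ[P] fun ω =>
      ∑ j ∈ increasingTuples p N, g fun i => shiftedDiff (regBlock Z η) (j i) (δ i) ω := by
    filter_upwards [hs] with ω hω
    simp only [nonDirectedSum, increment_eq_shiftedDiff hω]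
  rw [integral_congr_ae hae, integral_eq_lintegral_of_nonneg_ae
    (ae_of_all _ fun ω => Finset.sum_nonneg fun j _ => hg0 _)
    (Finset.measurable_fun_sum _ fun j _ => hmeas j).aestronglyMeasurable, tupleExpectation]
  congr 1
  rw [← lintegral_finsetSum _ fun j _ => (hmeas j).ennreal_ofReal]
  exact lintegral_congr fun ω => ENNReal.ofReal_sum_of_nonneg fun j _ => hg0 _

variable [IsProbabilityMeasure P]
  {κ : Path × Path → Measure (Path × Path)} {W : Measure Path} {γ θ θ' : ℝ}
  {k : (Path × Path) × (Path × Path) → ℝ≥0∞}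

lemma lintegral_constLaw_le_blockFunctional {ν : Measure (Path × Path)} [IsProbabilityMeasure ν]
    {a : ℝ} (hγ : 0 ≤ γ) (ha : 0 ≤ a) (h : ∀ q, ENNReal.ofReal a ≤ k q)
    {F : Plane × Plane → ℝ≥0∞} (hF : Measurable F) :
    ∫⁻ x, F x ∂(constLaw ν γ a) ≤ blockFunctional ν γ k F := by
  rw [← blockFunctional_const hγ ha hF]
  exact blockFunctional_mono h F

lemma blockFunctional_le_lintegral_constLaw {ν : Measure (Path × Path)} [IsProbabilityMeasure ν]
    {a : ℝ} (hγ : 0 ≤ γ) (ha : 0 ≤ a) (h : ∀ q, k q ≤ ENNReal.ofReal a)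
    {F : Plane × Plane → ℝ≥0∞} (hF : Measurable F) :
    blockFunctional ν γ k F ≤ ∫⁻ x, F x ∂(constLaw ν γ a) := by
  rw [← blockFunctional_const hγ ha hF]
  exact blockFunctional_mono h F

lemma IsRegenerativeCoupling.map_regBlock {ν : Measure (Path × Path)} [IsProbabilityMeasure ν]
    (hZ : IsRegenerativeCoupling P κ ν γ Z η)
    (hγ : γ ∈ Set.Ioo (0 : ℝ) 1) (hk : Measurable k)
    (hres : ∀ z, ENNReal.ofReal (1 - γ) • residual κ ν γ z = ν.withDensity fun w => k (z, w))
    (hkint : ∀ z, ∫⁻ w, k (z, w) ∂ν = ENNReal.ofReal (1 - γ)) (i : ℕ) :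
    P.map (regBlock Z η i) = P.map (regBlock Z η 0) := by
  have hm := measurable_regBlock hZ.measurable_coin hZ.measurable_state
  refine Measure.ext_of_lintegral _ fun f hf => ?_
  rw [lintegral_map hf (hm i), lintegral_map hf (hm 0),
    hZ.lintegral_regBlock hγ hk hres hkint i hf, hZ.lintegral_regBlock hγ hk hres hkint 0 hf]

/-- The step law of the walk of regeneration blocks. -/
lemma IsRegenerativeCoupling.isStepLaw_regBlock (hW : IsWiener W)
    (hZ : IsRegenerativeCoupling P κ (W.prod W) γ Z η)
    (hγ : γ ∈ Set.Ioo (0 : ℝ) 1) (hk : Measurable k)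
    (hsymm : ∀ z w, k (z.swap, w.swap) = k (z, w))
    (hres : ∀ z, ENNReal.ofReal (1 - γ) • residual κ (W.prod W) γ z =
      (W.prod W).withDensity fun w => k (z, w))
    (hkint : ∀ z, ∫⁻ w, k (z, w) ∂(W.prod W) = ENNReal.ofReal (1 - γ)) {τ : ℝ}
    (hτ : τ ∈ Set.Ioo (0 : ℝ) 1) (hθ0 : 0 < θ) (hθγ : θ < γ) (hθ1 : θ ≤ 1 - γ)
    (h1 : γ ^ 2 * (1 + (1 + τ) / γ * θ) ≤ (1 + τ) * (γ - θ) ^ 2)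
    (h2 : (1 - τ) * (γ + θ) * (γ + 2 * θ) * (1 + θ) ≤ γ ^ 2)
    (hlow : ∀ q, ENNReal.ofReal (1 - γ - θ) ≤ k q)
    (hup : ∀ q, k q ≤ ENNReal.ofReal (1 - γ + θ)) :
    IsStepLaw γ τ θ ((P.map (regBlock Z η 0)).map diffHom) := by
  have := hW.isProbabilityMeasure
  have hm := measurable_regBlock hZ.measurable_coin hZ.measurable_state
  have hp : IsProbabilityMeasure (P.map (regBlock Z η 0)) :=
    Measure.isProbabilityMeasure_map (hm 0).aemeasurable
  have hlaw {F : Plane × Plane → ℝ≥0∞} (hF : Measurable F) :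
      ∫⁻ x, F x ∂(P.map (regBlock Z η 0)) = blockFunctional (W.prod W) γ k F := by
    rw [lintegral_map hF (hm 0), hZ.lintegral_regBlock hγ hk hres hkint 0 hF]
  refine hW.isStepLaw hγ hτ hθ0 hθγ hθ1 h1 h2 ?_ ?_ ?_
  · refine Measure.le_iff.2 fun s hs => ?_
    rw [← lintegral_indicator_one hs, ← lintegral_indicator_one hs,
      hlaw (measurable_one.indicator hs)]
    exact lintegral_constLaw_le_blockFunctional hγ.1.le (by linarith) hlow
      (measurable_one.indicator hs)
  · refine Measure.le_iff.2 fun s hs => ?_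
    rw [← lintegral_indicator_one hs, ← lintegral_indicator_one hs,
      hlaw (measurable_one.indicator hs)]
    exact blockFunctional_le_lintegral_constLaw hγ.1.le (by linarith [hγ.2]) hup
      (measurable_one.indicator hs)
  · refine Measure.ext_of_lintegral _ fun f hf => ?_
    rw [lintegral_map hf measurable_swap, hlaw hf]
    exact (hlaw (hf.comp measurable_swap)).trans
      (blockFunctional_swap Measure.prod_swap hsymm f)

/-- The normalized expectation converges to the common `L¹`-norm. -/
theorem tendsto_integral_nonDirectedSum {φ : ℝ → ℝ} {ψ : Plane → ℝ} (hφψ : IsMollifierPair φ ψ)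
    (hW : IsWiener W) {a β ε₀ : ℝ} (hγ : γ ∈ Set.Ioo (0 : ℝ) 1) (hε₀ : ε₀ ∈ Set.Ioc (0 : ℝ) 1)
    {r : ℝ → ℝ} {Ψ : ℝ → Path → ℝ}
    (heigen : ∀ ε ∈ Set.Ioo (0 : ℝ) ε₀,
      IsPrincipalEigenpair (tiltedWiener W (corr φ ψ) β ε)
        (interaction (corr φ ψ) a β ε) (r ε) (Ψ ε))
    {Z : ℝ → ℕ → Ω → Path × Path} {η : ℝ → ℕ → Ω → Bool}
    (hZ : ∀ ε ∈ Set.Ioo (0 : ℝ) ε₀,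
      IsRegenerativeCoupling P
        (pairTransition (tiltedWiener W (corr φ ψ) β ε)
          (interaction (corr φ ψ) a β ε) (r ε) (Ψ ε))
        (W.prod W) γ (Z ε) (η ε))
    {p : ℕ} {G : ℝ → (Fin p → Plane) → ℝ} {A : ℝ} (hG : IsAdmissible G A)
    (hdom : ∀ J : Finset (Fin p), ∃ (H : ℝ → ({i : Fin p // i ∉ J} → Plane) → ℝ) (B : ℝ),
      IsAdmissible H B ∧ ∀ ε ∈ Set.Ioo (0 : ℝ) 1, ∀ x, partialSup (G ε) J x ≤ H ε x)
    {δ : Fin p → ℤ} (hδ : ∀ i, δ i = -1 ∨ δ i = 0 ∨ δ i = 1)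
    {M : ℝ → ℝ} (hMpos : ∀ ε ∈ Set.Ioo (0 : ℝ) 1, 0 < M ε)
    (hM : Tendsto (fun ε => Real.log (M ε) / Real.log (1 / ε)) (𝓝[>] 0) (𝓝 0)) :
    Tendsto
      (fun ε => (∫ ω, nonDirectedSum (G ε) δ ⌊M ε / ε ^ 2⌋₊
          (fun n => Z ε n ω) (fun n => η ε n ω) ∂P) /
        (γ / (2 * Real.pi) * Real.log (1 / ε)) ^ p)
      (𝓝[>] 0) (𝓝 A) := by
  have := hW.isProbabilityMeasure
  have hdens {θ : ℝ} (hθ : 0 < θ) := exists_failDensity hφψ W a β hγ hε₀ heigen hθ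
  have hsmall : ∀ᶠ ε in 𝓝[>] (0 : ℝ), ε ∈ Set.Ioo 0 ε₀ := Ioo_mem_nhdsGT hε₀.1
  have hmain := tendsto_tupleExpectation (P := P) (b := fun ε => regBlock (Z ε) (η ε))
    (μ := fun ε => (P.map (regBlock (Z ε) (η ε) 0)).map diffHom) hγ ?_ ?_ ?_ hG hdom hδ hMpos hM
  · refine hmain.congr' ?_
    -- Any tolerance would do here: only the existence of a density of the failure part is used, not
    -- its closeness to 1 - γ.
    filter_upwards [hsmall, hdens one_pos] with ε hε ⟨k, hk, _, hres, hkint, _⟩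
    have hε1 : ε ∈ Set.Ioo (0 : ℝ) 1 := ⟨hε.1, hε.2.trans_le hε₀.2⟩
    have hZε := hZ ε hε
    rw [integral_nonDirectedSum (hG.measurable ε hε1) (hG.nonneg ε hε1) hZε.measurable_state
      hZε.measurable_coin (hZε.ae_hasSuccesses hγ hk hres hkint)]
  · filter_upwards [hsmall, hdens one_pos] with ε hε ⟨k, hk, _, hres, hkint, _⟩
    have hZε := hZ ε hε
    have hm := measurable_regBlock hZε.measurable_coin hZε.measurable_state
    refine ⟨hm, hZε.iIndepFun_regBlock hγ hk hres hkint, fun i => ?_⟩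
    rw [← hZε.map_regBlock hγ hk hres hkint i, Measure.map_map measurable_diffHom (hm i)]
    rfl
  · intro τ hτ
    obtain ⟨θ, hθ0, hθγ, hθ1, h1, h2⟩ := exists_perturbation hγ hτ
    refine ⟨θ, hθ0, ?_⟩
    filter_upwards [hsmall, hdens hθ0] with ε hε ⟨k, hk, hsymm, hres, hkint, hlow, hup⟩
    exact (hZ ε hε).isStepLaw_regBlock hW hγ hk hsymm hres hkint hτ hθ0 hθγ hθ1 h1 h2 hlow hup
  · intro t ht
    -- The block law dominates the mixture with ratio 1 - γ - θ, so a radius that works for the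
    -- mixture works for the blocks.
    obtain ⟨θ, hθ, R, hR0, hR⟩ := exists_radius_constLaw (W.prod W) hγ ht
    refine ⟨R, hR0, ?_⟩
    filter_upwards [hsmall, hdens hθ.1] with ε hε ⟨k, hk, hsymm, hres, hkint, hlow, hup⟩
    refine ⟨blockFunctional (W.prod W) γ k (smallBlock R), hR.trans ?_, fun i => ?_⟩
    · exact lintegral_constLaw_le_blockFunctional hγ.1.le (by linarith [hθ.2]) hlow
        (measurable_smallBlock R)
    · exact (hZ ε hε).lintegral_regBlock hγ hk hres hkint i (measurable_smallBlock R)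

lemma isEquivalent_of_tendsto_div {α : Type*} {l : Filter α} {u v : α → ℝ} {A : ℝ} (hA : A ≠ 0)
    (hv : ∀ᶠ x in l, v x ≠ 0) (h : Tendsto (fun x => u x / v x) l (𝓝 A)) :
    Asymptotics.IsEquivalent l u fun x => v x * A := by
  refine (Asymptotics.isEquivalent_iff_tendsto_one (hv.mono fun x hx => mul_ne_zero hx hA)).2 ?_
  have := h.div_const A
  rw [div_self hA] at this
  exact this.congr fun x => div_div _ _ _

end conclusion

end KR

end

theorem lemmaB1
    -- the mollifiers, the Wiener measure, and the parameters of the chain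
    (φ : ℝ → ℝ) (ψ : KR.Plane → ℝ) (hφψ : KR.IsMollifierPair φ ψ)
    (W : Measure KR.Path) (hW : KR.IsWiener W)
    (a β γ ε₀ : ℝ) (hγ : γ ∈ Set.Ioo (0 : ℝ) 1) (hε₀ : ε₀ ∈ Set.Ioc (0 : ℝ) 1)
    (r : ℝ → ℝ) (Ψ : ℝ → KR.Path → ℝ)
    (heigen : ∀ ε ∈ Set.Ioo (0 : ℝ) ε₀,
      KR.IsPrincipalEigenpair (KR.tiltedWiener W (KR.corr φ ψ) β ε)
        (KR.interaction (KR.corr φ ψ) a β ε) (r ε) (Ψ ε))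
    -- the chain started from two independent Brownian segments, with its regeneration coins
    {Ω : Type*} [MeasurableSpace Ω] (P : Measure Ω) [IsProbabilityMeasure P]
    (Z : ℝ → ℕ → Ω → KR.Path × KR.Path) (η : ℝ → ℕ → Ω → Bool)
    (hZ : ∀ ε ∈ Set.Ioo (0 : ℝ) ε₀,
      KR.IsRegenerativeCoupling P
        (KR.pairTransition (KR.tiltedWiener W (KR.corr φ ψ) β ε)
          (KR.interaction (KR.corr φ ψ) a β ε) (r ε) (Ψ ε))
        (W.prod W) γ (Z ε) (η ε))
    -- the family of functions
    (p : ℕ) (G : ℝ → (Fin p → KR.Plane) → ℝ) (A : ℝ) (hG : KR.IsAdmissible G A)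
    (hdom : ∀ J : Finset (Fin p), ∃ (H : ℝ → ({i : Fin p // i ∉ J} → KR.Plane) → ℝ) (B : ℝ),
      KR.IsAdmissible H B ∧
        ∀ ε ∈ Set.Ioo (0 : ℝ) 1, ∀ x, KR.partialSup (G ε) J x ≤ H ε x)
    -- the shifts and the time horizon
    (δ : Fin p → ℤ) (hδ : ∀ i, δ i = -1 ∨ δ i = 0 ∨ δ i = 1)
    (M : ℝ → ℝ) (hMpos : ∀ ε ∈ Set.Ioo (0 : ℝ) 1, 0 < M ε)
    (hM : Tendsto (fun ε => Real.log (M ε) / Real.log (1 / ε)) (𝓝[>] 0) (𝓝 0)) :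
    Tendsto
      (fun ε => (∫ ω, KR.nonDirectedSum (G ε) δ ⌊M ε / ε ^ 2⌋₊
          (fun n => Z ε n ω) (fun n => η ε n ω) ∂P) /
        (γ / (2 * Real.pi) * Real.log (1 / ε)) ^ p)
      (𝓝[>] 0) (𝓝 A) ∧
    (A ≠ 0 →
      Asymptotics.IsEquivalent (𝓝[>] 0)
        (fun ε => ∫ ω, KR.nonDirectedSum (G ε) δ ⌊M ε / ε ^ 2⌋₊
          (fun n => Z ε n ω) (fun n => η ε n ω) ∂P)
        (fun ε => (γ / (2 * Real.pi) * Real.log (1 / ε)) ^ p * A)) := by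
  have h := KR.tendsto_integral_nonDirectedSum (P := P) hφψ hW hγ hε₀ heigen hZ hG hdom hδ hMpos hM
  refine ⟨h, fun hA => KR.isEquivalent_of_tendsto_div hA ?_ h⟩
  filter_upwards [KR.tendsto_log_one_div.eventually_gt_atTop 0] with ε hε
  have := hγ.1
  have := Real.pi_pos
  positivity
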